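/- Let $n\ge 2$ and $s$ be integers with $s>n/2$, let $b>0$, and let $V$ be a real finite-dimensional inner-product space. Write points of $\mathbb{R}^n$ as $x=(x',x_n)\in\mathbb{R}^{n-1}\times\mathbb{R}$. For $k\in\mathbb{N}$ let $H^k(\mathbb{R}^n;V)$ be the usual $L^2$-based Sobolev space. For $d\ge1$ and $\sigma\ge 0$ let $X^{\sigma}(\mathbb{R}^{d})$ be the space of real tempered distributions $\eta$ on $\mathbb{R}^{d}$ whose Fourier transform $\hat\eta$ (with the convention $\hat f(\xi)=\int f(x)e^{-2\pi i x\cdot\xi}\,dx$) is a locally integrable function with $$\|\eta\|_{X^{\sigma}}^2=\int_{\mathbb{R}^{d}}\omega_\sigma(\xi)|\hat\eta(\xi)|^2\,d\xi<\infty,\qquad \omega_\sigma(\xi)=\begin{cases}\dfrac{\xi_1^2+|\xi|^4}{|\xi|^2}, & |\xi|<1,\\[1ex] (1+|\xi|^2)^{\sigma}, & |\xi|\ge 1.\end{cases}$$ Let $\psi\in C_c^\infty(\mathbb{R})$ satisfy $0\le\psi\le1$, $\psi=1$ on $[-2b,2b]$ and $\operatorname{supp}\psi\subset(-3b,3b)$,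 and put $\varphi(t)=t\psi(t)$. Every $\eta\in X^{s+1/2}(\mathbb{R}^{n-1})$ is a continuous function, so that $$\mathfrak{E}_\eta:\mathbb{R}^n\to\mathbb{R}^n,\qquad \mathfrak{E}_\eta(x)=\bigl(x',\,x_n+\varphi(x_n)\eta(x')/b\bigr)$$ is defined pointwise. Call $\delta\in(0,1)$ admissible if for every $\eta\in X^{s+1/2}(\mathbb{R}^{n-1})$ with $\|\eta\|_{X^{s+1/2}}<\delta$ the map $\mathfrak{E}_\eta$ is a bi-Lipschitz homeomorphism and a $C^1$ diffeomorphism of $\mathbb{R}^n$ with $\sup_{x}|\nabla\mathfrak{E}_\eta(x)-I|<1/2$, where $|\cdot|$ is the operator norm. Then there is an admissible $\delta$. Moreover, for every admissible $\delta_*$, writing $B(0,\delta_*)$ for the open ball of radius $\delta_*$ about $0$ in $X^{s+1/2}(\mathbb{R}^{n-1})$, the map $$\Lambda:H^{s+1}(\mathbb{R}^n;V)\times B(0,\delta_*)\to H^{s}(\mathbb{R}^n;V),\qquad \Lambda(f,\eta)=f\circ\mathfrak{E}_\eta,$$ is well defined and $C^1$ (with respect to the norm topologies), and its derivative is $$D\Lambda(f,\eta)(g,\zeta)=\frac{\varphi}{b}\,(\partial_nf\circ\mathfrak{E}_\eta)\,\zeta+g\circ\mathfrak{E}_\eta$$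 for all $f,g\in H^{s+1}(\mathbb{R}^n;V)$, $\eta\in B(0,\delta_*)$ and $\zeta\in X^{s+1/2}(\mathbb{R}^{n-1})$, where $\varphi$ stands for the function $x\mapsto\varphi(x_n)$ and $\zeta$ for $x\mapsto\zeta(x')$. -/

import Mathlib

open MeasureTheory
open scoped SchwartzMap FourierTransform ContDiff

namespace OmegaLemma

noncomputable section

/-! ### The Sobolev spaces `H^k(ℝⁿ; V)`, `k ∈ ℕ` -/

section Sobolev

variable {n j : ℕ} {V : Type*} [NormedAddCommGroup V] [NormedSpace ℝ V]

/-- The classical partial derivative `∂_{w 0} ∂_{w 1} ⋯ ∂_{w (j-1)} θ (x)`. -/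
def partialDeriv (w : Fin j → Fin n) (θ : EuclideanSpace ℝ (Fin n) → ℝ)
    (x : EuclideanSpace ℝ (Fin n)) : ℝ :=
  iteratedFDeriv ℝ j θ x (fun i => EuclideanSpace.single (w i) 1)

/-- `g = ∂_{w 0} ⋯ ∂_{w (j-1)} f` in the weak (distributional) sense on `ℝⁿ`. -/
def IsWeakDeriv (w : Fin j → Fin n) (f g : EuclideanSpace ℝ (Fin n) → V) : Prop :=
  ∀ θ : EuclideanSpace ℝ (Fin n) → ℝ, ContDiff ℝ ∞ θ → HasCompactSupport θ →
    ∫ x, partialDeriv w θ x • f x = (-1 : ℝ) ^ j • ∫ x, θ x • g x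

theorem integrable_partialDeriv_smul (w : Fin j → Fin n) {θ : EuclideanSpace ℝ (Fin n) → ℝ}
    (hθ : ContDiff ℝ ∞ θ) (hc : HasCompactSupport θ)
    (f : Lp V 2 (volume : Measure (EuclideanSpace ℝ (Fin n)))) :
    Integrable (fun x => partialDeriv w θ x • f x) := by
  have hf : LocallyIntegrable (f : EuclideanSpace ℝ (Fin n) → V) volume :=
    (Lp.memLp f).locallyIntegrable (by norm_num)
  refine hf.integrable_smul_left_of_hasCompactSupport ?_ ?_
  · have h := hθ.continuous_iteratedFDeriv (m := j) (by exact_mod_cast le_top)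
    exact (ContinuousMultilinearMap.apply ℝ (fun _ : Fin j => EuclideanSpace ℝ (Fin n)) ℝ
      (fun i => EuclideanSpace.single (w i) 1)).continuous.comp h
  · exact (hc.iteratedFDeriv j).comp_left
      (g := fun A : ContinuousMultilinearMap ℝ (fun _ : Fin j => EuclideanSpace ℝ (Fin n)) ℝ =>
        A (fun i => EuclideanSpace.single (w i) 1)) (by simp)

theorem integrable_smul_test {θ : EuclideanSpace ℝ (Fin n) → ℝ}
    (hθ : ContDiff ℝ ∞ θ) (hc : HasCompactSupport θ)
    (f : Lp V 2 (volume : Measure (EuclideanSpace ℝ (Fin n)))) :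
    Integrable (fun x => θ x • f x) :=
  ((Lp.memLp f).locallyIntegrable (by norm_num)).integrable_smul_left_of_hasCompactSupport
    hθ.continuous hc

theorem IsWeakDeriv.add {w : Fin j → Fin n}
    {f₁ f₂ g₁ g₂ : Lp V 2 (volume : Measure (EuclideanSpace ℝ (Fin n)))}
    (h₁ : IsWeakDeriv w f₁ g₁) (h₂ : IsWeakDeriv w f₂ g₂) :
    IsWeakDeriv w (f₁ + f₂ : Lp V 2 volume) (g₁ + g₂ : Lp V 2 volume) := by
  intro θ hθ hc
  have e₁ : ∫ x, partialDeriv w θ x • (f₁ + f₂ : Lp V 2 volume) x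
      = ∫ x, (partialDeriv w θ x • f₁ x + partialDeriv w θ x • f₂ x) := by
    refine integral_congr_ae ?_
    filter_upwards [Lp.coeFn_add f₁ f₂] with x hx
    rw [hx, Pi.add_apply, smul_add]
  have e₂ : ∫ x, θ x • (g₁ + g₂ : Lp V 2 volume) x = ∫ x, (θ x • g₁ x + θ x • g₂ x) := by
    refine integral_congr_ae ?_
    filter_upwards [Lp.coeFn_add g₁ g₂] with x hx
    rw [hx, Pi.add_apply, smul_add]
  rw [e₁, e₂, integral_add (integrable_partialDeriv_smul w hθ hc f₁)
    (integrable_partialDeriv_smul w hθ hc f₂), integral_add (integrable_smul_test hθ hc g₁)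
    (integrable_smul_test hθ hc g₂), h₁ θ hθ hc, h₂ θ hθ hc, smul_add]

theorem IsWeakDeriv.const_smul {w : Fin j → Fin n} (c : ℝ)
    {f g : Lp V 2 (volume : Measure (EuclideanSpace ℝ (Fin n)))} (h : IsWeakDeriv w f g) :
    IsWeakDeriv w (c • f : Lp V 2 volume) (c • g : Lp V 2 volume) := by
  intro θ hθ hc
  have e₁ : ∫ x, partialDeriv w θ x • (c • f : Lp V 2 volume) x
      = ∫ x, c • (partialDeriv w θ x • f x) := by
    refine integral_congr_ae ?_
    filter_upwards [Lp.coeFn_smul c f] with x hx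
    rw [hx, Pi.smul_apply, smul_comm]
  have e₂ : ∫ x, θ x • (c • g : Lp V 2 volume) x = ∫ x, c • (θ x • g x) := by
    refine integral_congr_ae ?_
    filter_upwards [Lp.coeFn_smul c g] with x hx
    rw [hx, Pi.smul_apply, smul_comm]
  rw [e₁, e₂, integral_smul, integral_smul, h θ hθ hc, smul_comm]

/-- The set underlying `H^k(ℝⁿ; V)`: the `f ∈ L²(ℝⁿ; V)` all of whose weak partial derivatives of
order at most `k` are in `L²(ℝⁿ; V)`. -/
def sobolevSubmodule (n k : ℕ) (V : Type*) [NormedAddCommGroup V] [NormedSpace ℝ V] :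
    Submodule ℝ (Lp V 2 (volume : Measure (EuclideanSpace ℝ (Fin n)))) where
  carrier := {f | ∀ (j : ℕ), j ≤ k → ∀ w : Fin j → Fin n,
    ∃ g : Lp V 2 (volume : Measure (EuclideanSpace ℝ (Fin n))), IsWeakDeriv w f g}
  add_mem' := by
    intro f₁ f₂ h₁ h₂ j hj w
    obtain ⟨g₁, hg₁⟩ := h₁ j hj w
    obtain ⟨g₂, hg₂⟩ := h₂ j hj w
    exact ⟨g₁ + g₂, hg₁.add hg₂⟩
  zero_mem' := by
    intro j _ w
    refine ⟨0, ?_⟩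
    have h : IsWeakDeriv w ((0 : ℝ) • (0 : Lp V 2 volume) : Lp V 2 volume)
        ((0 : ℝ) • (0 : Lp V 2 volume) : Lp V 2 volume) := by
      intro θ hθ hc
      have e : ∀ u : EuclideanSpace ℝ (Fin n) → ℝ,
          ∫ x, u x • ((0 : ℝ) • (0 : Lp V 2 volume) : Lp V 2 volume) x = 0 := by
        intro u
        rw [zero_smul]
        refine integral_eq_zero_of_ae ?_
        filter_upwards [Lp.coeFn_zero V 2 (volume : Measure (EuclideanSpace ℝ (Fin n)))] with x hx
        rw [hx, Pi.zero_apply, smul_zero]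
      rw [e, e, smul_zero]
    simpa using h
  smul_mem' := by
    intro c f h j hj w
    obtain ⟨g, hg⟩ := h j hj w
    exact ⟨c • g, hg.const_smul c⟩

/-- The Sobolev space `H^k(ℝⁿ; V)`. -/
def H (n k : ℕ) (V : Type*) [NormedAddCommGroup V] [NormedSpace ℝ V] : Type _ :=
  sobolevSubmodule n k V

namespace H

variable {k : ℕ}

instance : AddCommGroup (H n k V) := inferInstanceAs (AddCommGroup (sobolevSubmodule n k V))

instance : Module ℝ (H n k V) := inferInstanceAs (Module ℝ (sobolevSubmodule n k V))

/-- The inclusion `H^k(ℝⁿ; V) → L²(ℝⁿ; V)`. -/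
def toL2 : H n k V →ₗ[ℝ] Lp V 2 (volume : Measure (EuclideanSpace ℝ (Fin n))) :=
  (sobolevSubmodule n k V).subtype

/-- An element of `H^k(ℝⁿ; V)` as a function on `ℝⁿ` (defined almost everywhere). -/
instance : CoeFun (H n k V) (fun _ => EuclideanSpace ℝ (Fin n) → V) := ⟨fun f => toL2 f⟩

theorem toL2_injective : Function.Injective (toL2 : H n k V →ₗ[ℝ] _) :=
  Subtype.val_injective

end H

theorem IsWeakDeriv.unique [CompleteSpace V] {w : Fin j → Fin n}
    {f : EuclideanSpace ℝ (Fin n) → V}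
    {g₁ g₂ : Lp V 2 (volume : Measure (EuclideanSpace ℝ (Fin n)))}
    (h₁ : IsWeakDeriv w f g₁) (h₂ : IsWeakDeriv w f g₂) : g₁ = g₂ := by
  refine Lp.ext (ae_eq_of_integral_contDiff_smul_eq
    ((Lp.memLp g₁).locallyIntegrable (by norm_num))
    ((Lp.memLp g₂).locallyIntegrable (by norm_num)) ?_)
  intro θ hθ hc
  have h := (h₁ θ hθ hc).symm.trans (h₂ θ hθ hc)
  exact smul_right_injective V (pow_ne_zero j (by norm_num : (-1 : ℝ) ≠ 0)) h

namespace H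

variable {k : ℕ} [CompleteSpace V]

/-- The weak partial derivative `∂_{w 0} ⋯ ∂_{w (j-1)} f ∈ L²(ℝⁿ; V)` of `f ∈ H^k(ℝⁿ; V)`, of order
`j ≤ k`. -/
def weakDeriv (hj : j ≤ k) (w : Fin j → Fin n) :
    H n k V →ₗ[ℝ] Lp V 2 (volume : Measure (EuclideanSpace ℝ (Fin n))) where
  toFun f := (f.2 j hj w).choose
  map_add' f₁ f₂ := ((f₁ + f₂).2 j hj w).choose_spec.unique
    ((f₁.2 j hj w).choose_spec.add (f₂.2 j hj w).choose_spec)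
  map_smul' c f := ((c • f).2 j hj w).choose_spec.unique
    ((f.2 j hj w).choose_spec.const_smul c)

theorem isWeakDeriv_weakDeriv (hj : j ≤ k) (w : Fin j → Fin n) (f : H n k V) :
    IsWeakDeriv w f (weakDeriv hj w f) :=
  (f.2 j hj w).choose_spec

/-- The family of all weak partial derivatives of order at most `k`. -/
def jet : H n k V →ₗ[ℝ] PiLp 2 (fun _ : (Σ j : Fin (k + 1), (Fin j → Fin n)) =>
    Lp V 2 (volume : Measure (EuclideanSpace ℝ (Fin n)))) :=
  (WithLp.linearEquiv 2 ℝ _).symm.toLinearMap ∘ₗ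
    LinearMap.pi (fun w => weakDeriv (Nat.lt_succ_iff.mp w.1.2) w.2)

theorem jet_injective : Function.Injective (jet : H n k V →ₗ[ℝ] _) := by
  intro f₁ f₂ h
  have h0 := congrArg (fun u : PiLp 2 (fun _ : (Σ j : Fin (k + 1), (Fin j → Fin n)) =>
    Lp V 2 (volume : Measure (EuclideanSpace ℝ (Fin n)))) => u ⟨0, fun i => i.elim0⟩) h
  have key : ∀ f : H n k V,
      toL2 f = weakDeriv (Nat.zero_le k) (fun i : Fin 0 => i.elim0) f := by
    intro f
    refine IsWeakDeriv.unique (w := fun i : Fin 0 => i.elim0) (f := f) ?_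
      (isWeakDeriv_weakDeriv _ _ f)
    intro θ hθ hc
    simp [partialDeriv]
  refine toL2_injective ?_
  rw [key f₁, key f₂]
  exact h0

/-- The norm `‖f‖² = ∑_{j ≤ k} ∫ |∇^j f|²` of `H^k(ℝⁿ; V)`, the sum of the squared `L²` norms of all
weak partial derivatives of order at most `k`. -/
instance : NormedAddCommGroup (H n k V) :=
  NormedAddCommGroup.induced (H n k V) _ jet jet_injective

instance : NormedSpace ℝ (H n k V) :=
  NormedSpace.induced ℝ (H n k V) _ jet

end H

end Sobolev

/-! ### The anisotropic spaces `X^s(ℝᵈ)`, `d ≥ 1` -/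

section Anisotropic

/-- The tempered distribution `T` is real: `T = T̄`, where `T̄(θ)` is the conjugate of `T(θ̄)`. -/
def IsRealDistribution {d : ℕ} (T : 𝓢'(EuclideanSpace ℝ (Fin d), ℂ)) : Prop :=
  ∀ θ θ' : 𝓢(EuclideanSpace ℝ (Fin d), ℂ), (∀ x, θ' x = star (θ x)) → T θ' = star (T θ)

/-- The tempered distribution `T` is the locally integrable function `F`. -/
def IsFunction {d : ℕ} (T : 𝓢'(EuclideanSpace ℝ (Fin d), ℂ))
    (F : EuclideanSpace ℝ (Fin d) → ℂ) : Prop :=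
  LocallyIntegrable F volume ∧
    ∀ θ : 𝓢(EuclideanSpace ℝ (Fin d), ℂ),
      Integrable (fun ξ => θ ξ * F ξ) ∧ T θ = ∫ ξ, θ ξ * F ξ

theorem IsFunction.add {d : ℕ} {T₁ T₂ : 𝓢'(EuclideanSpace ℝ (Fin d), ℂ)}
    {F₁ F₂ : EuclideanSpace ℝ (Fin d) → ℂ} (h₁ : IsFunction T₁ F₁) (h₂ : IsFunction T₂ F₂) :
    IsFunction (T₁ + T₂) (F₁ + F₂) := by
  refine ⟨h₁.1.add h₂.1, fun θ => ?_⟩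
  simp only [Pi.add_apply, mul_add]
  refine ⟨(h₁.2 θ).1.add (h₂.2 θ).1, ?_⟩
  rw [integral_add (h₁.2 θ).1 (h₂.2 θ).1, ← (h₁.2 θ).2, ← (h₂.2 θ).2]
  rfl

theorem IsFunction.smul {d : ℕ} (c : ℝ) {T : 𝓢'(EuclideanSpace ℝ (Fin d), ℂ)}
    {F : EuclideanSpace ℝ (Fin d) → ℂ} (h : IsFunction T F) :
    IsFunction (c • T) (c • F) := by
  refine ⟨h.1.smul c, fun θ => ?_⟩
  simp only [Pi.smul_apply, mul_smul_comm]
  refine ⟨(h.2 θ).1.smul c, ?_⟩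
  rw [integral_smul, ← (h.2 θ).2]
  rfl

theorem IsFunction.unique {d : ℕ} {T : 𝓢'(EuclideanSpace ℝ (Fin d), ℂ)}
    {F₁ F₂ : EuclideanSpace ℝ (Fin d) → ℂ} (h₁ : IsFunction T F₁) (h₂ : IsFunction T F₂) :
    F₁ =ᵐ[volume] F₂ := by
  refine ae_eq_of_integral_contDiff_smul_eq h₁.1 h₂.1 ?_
  intro g hg hc
  have hc' : HasCompactSupport (Complex.ofRealCLM ∘ g) := hc.comp_left rfl
  have hg' : ContDiff ℝ ∞ (Complex.ofRealCLM ∘ g) := by fun_prop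
  have h := (h₁.2 (hc'.toSchwartzMap hg')).2.symm.trans (h₂.2 (hc'.toSchwartzMap hg')).2
  simpa using h

theorem fourier_smul_real {d : ℕ} (c : ℝ) (T : 𝓢'(EuclideanSpace ℝ (Fin d), ℂ)) :
    𝓕 (c • T) = c • 𝓕 T := by
  ext θ
  rfl

variable {d : ℕ} [NeZero d]

/-- The weight `ω_s(ξ)`, equal to `(ξ₁² + |ξ|⁴) / |ξ|²` for `|ξ| < 1` and to `(1 + |ξ|²)^s` for
`|ξ| ≥ 1`; the first coordinate `ξ₁` is `ξ 0`. -/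
def weight (s : ℝ) (ξ : EuclideanSpace ℝ (Fin d)) : ℝ :=
  open scoped Classical in
  if ‖ξ‖ < 1 then ((ξ 0) ^ 2 + ‖ξ‖ ^ 4) / ‖ξ‖ ^ 2 else (1 + ‖ξ‖ ^ 2) ^ s

theorem weight_pos (s : ℝ) {ξ : EuclideanSpace ℝ (Fin d)} (hξ : ξ ≠ 0) : 0 < weight s ξ := by
  have h : 0 < ‖ξ‖ := norm_pos_iff.mpr hξ
  unfold weight
  split_ifs <;> positivity

/-- The set underlying `X^s(ℝᵈ)`: the real tempered distributions `T` whose Fourier transform is a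
locally integrable function `F` with `∫ ω_s |F|² < ∞`. -/
def anisotropicSubmodule (d : ℕ) [NeZero d] (s : ℝ) :
    Submodule ℝ 𝓢'(EuclideanSpace ℝ (Fin d), ℂ) where
  carrier := {T | IsRealDistribution T ∧ ∃ F : EuclideanSpace ℝ (Fin d) → ℂ,
    IsFunction (𝓕 T) F ∧ MemLp (fun ξ => √(weight s ξ) • F ξ) 2 volume}
  add_mem' := by
    rintro T₁ T₂ ⟨r₁, F₁, h₁, m₁⟩ ⟨r₂, F₂, h₂, m₂⟩
    refine ⟨fun θ θ' h => ?_, F₁ + F₂, ?_, ?_⟩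
    · change T₁ θ' + T₂ θ' = star (T₁ θ + T₂ θ)
      rw [r₁ θ θ' h, r₂ θ θ' h, star_add]
    · rw [FourierTransform.fourier_add]
      exact h₁.add h₂
    · refine (m₁.add m₂).ae_eq (Filter.Eventually.of_forall fun ξ => ?_)
      simp only [Pi.add_apply, smul_add]
  zero_mem' := by
    refine ⟨fun θ θ' _ => ?_, 0, ⟨?_, fun θ => ?_⟩, ?_⟩
    · change (0 : ℂ) = star (0 : ℂ)
      rw [star_zero]
    · exact locallyIntegrable_zero
    · refine ⟨by simp, ?_⟩
      simp only [Pi.zero_apply, mul_zero, integral_zero]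
      rfl
    · simp
  smul_mem' := by
    rintro c T ⟨r, F, h, m⟩
    refine ⟨fun θ θ' hθ => ?_, c • F, ?_, ?_⟩
    · change c • T θ' = star (c • T θ)
      rw [r θ θ' hθ, star_smul, star_trivial c]
    · rw [fourier_smul_real]
      exact h.smul c
    · have := m.const_smul c
      refine this.ae_eq (Filter.Eventually.of_forall fun ξ => ?_)
      simp only [Pi.smul_apply]
      exact smul_comm _ _ _

/-- The space `X^s(ℝᵈ)`. -/
def X (d : ℕ) [NeZero d] (s : ℝ) : Type :=
  anisotropicSubmodule d s

namespace X

variable {s : ℝ}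

instance : AddCommGroup (X d s) := inferInstanceAs (AddCommGroup (anisotropicSubmodule d s))

instance : Module ℝ (X d s) := inferInstanceAs (Module ℝ (anisotropicSubmodule d s))

/-- The tempered distribution underlying an element of `X^s(ℝᵈ)`. -/
def toDistribution : X d s →ₗ[ℝ] 𝓢'(EuclideanSpace ℝ (Fin d), ℂ) :=
  (anisotropicSubmodule d s).subtype

/-- The Fourier transform of `η ∈ X^s(ℝᵈ)` as a function (defined almost everywhere). -/
def fourierFun (η : X d s) : EuclideanSpace ℝ (Fin d) → ℂ := η.2.2.choose

theorem isFunction_fourierFun (η : X d s) : IsFunction (𝓕 (toDistribution η)) (fourierFun η) :=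
  η.2.2.choose_spec.1

theorem memLp_fourierFun (η : X d s) :
    MemLp (fun ξ => √(weight s ξ) • fourierFun η ξ) 2 volume :=
  η.2.2.choose_spec.2

/-- The map `η ↦ √ω_s η̂ ∈ L²(ℝᵈ; ℂ)`. -/
def weightedFourier : X d s →ₗ[ℝ] Lp ℂ 2 (volume : Measure (EuclideanSpace ℝ (Fin d))) where
  toFun η := (memLp_fourierFun η).toLp _
  map_add' η₁ η₂ := by
    rw [← MemLp.toLp_add]
    refine (MemLp.toLp_eq_toLp_iff _ _).mpr ?_
    have h : IsFunction (𝓕 (toDistribution (η₁ + η₂))) (fourierFun η₁ + fourierFun η₂) := by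
      rw [map_add, FourierTransform.fourier_add]
      exact (isFunction_fourierFun η₁).add (isFunction_fourierFun η₂)
    filter_upwards [(isFunction_fourierFun (η₁ + η₂)).unique h] with ξ hξ
    simp only [hξ, Pi.add_apply, smul_add]
  map_smul' c η := by
    rw [RingHom.id_apply, ← MemLp.toLp_const_smul]
    refine (MemLp.toLp_eq_toLp_iff _ _).mpr ?_
    have h : IsFunction (𝓕 (toDistribution (c • η))) (c • fourierFun η) := by
      rw [map_smul, fourier_smul_real]
      exact (isFunction_fourierFun η).smul c
    filter_upwards [(isFunction_fourierFun (c • η)).unique h] with ξ hξ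
    simp only [hξ, Pi.smul_apply]
    exact smul_comm _ _ _

theorem weightedFourier_injective : Function.Injective (weightedFourier : X d s →ₗ[ℝ] _) := by
  rw [injective_iff_map_eq_zero]
  intro η h
  have h' := (memLp_fourierFun η).coeFn_toLp.symm.trans
    ((Lp.eq_zero_iff_ae_eq_zero (f := (memLp_fourierFun η).toLp _)).mp h)
  have hF : fourierFun η =ᵐ[volume] 0 := by
    filter_upwards [h', (measure_eq_zero_iff_ae_notMem (s := {(0 : EuclideanSpace ℝ (Fin d))})).mp
      (measure_singleton _)] with ξ hξ hξ0
    exact (smul_eq_zero.mp hξ).resolve_left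
      (Real.sqrt_ne_zero'.mpr (weight_pos s (by simpa using hξ0)))
  have hT : 𝓕 (toDistribution η) = 0 := by
    ext θ
    rw [((isFunction_fourierFun η).2 θ).2]
    refine integral_eq_zero_of_ae ?_
    filter_upwards [hF] with ξ hξ
    rw [hξ, Pi.zero_apply, mul_zero]
  have hT' : toDistribution η = 0 := by
    have e : 𝓕⁻ (𝓕 (toDistribution η)) = toDistribution η :=
      FourierTransform.fourierInv_fourier_eq _
    rw [← e, hT]
    ext θ
    rfl
  exact Subtype.ext hT'

/-- The norm `‖η‖² = ∫ ω_s |η̂|²` of `X^s(ℝᵈ)`. -/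
instance : NormedAddCommGroup (X d s) :=
  NormedAddCommGroup.induced (X d s) _ weightedFourier weightedFourier_injective

instance : NormedSpace ℝ (X d s) :=
  NormedSpace.induced ℝ (X d s) _ weightedFourier

/-- The distribution `η` is the continuous real-valued function `g`. -/
def IsContinuousFunction (η : X d s) (g : EuclideanSpace ℝ (Fin d) → ℝ) : Prop :=
  Continuous g ∧ ∀ θ : 𝓢(EuclideanSpace ℝ (Fin d), ℂ), HasCompactSupport θ →
    toDistribution η θ = ∫ x, θ x * (g x : ℂ)

open scoped Classical in
/-- The pointwise values of `η`: the continuous function that the distribution `η` is, if there is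
one. -/
def toFun (η : X d s) : EuclideanSpace ℝ (Fin d) → ℝ :=
  if h : ∃ g, IsContinuousFunction η g then h.choose else 0

instance : CoeFun (X d s) (fun _ => EuclideanSpace ℝ (Fin d) → ℝ) := ⟨toFun⟩

end X

end Anisotropic

/-! ### The map `𝔈_η` and composition with it

Here `n = d + 1`; a point of `ℝⁿ` is `x = (x', x_n)` with `x' ∈ ℝᵈ`, and `x_n = x (Fin.last d)`. -/

section Composition

/-- `x' = (x₁, …, x_{n-1})`. -/
def horizontal {d : ℕ} (x : EuclideanSpace ℝ (Fin (d + 1))) : EuclideanSpace ℝ (Fin d) :=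
  WithLp.toLp 2 (fun i => x i.castSucc)

/-- `ψ ∈ C_c^∞(ℝ)` with `0 ≤ ψ ≤ 1`, `ψ = 1` on `[-2b, 2b]` and `supp ψ ⊂ (-3b, 3b)`. -/
structure IsCutoff (b : ℝ) (ψ : ℝ → ℝ) : Prop where
  contDiff : ContDiff ℝ ∞ ψ
  hasCompactSupport : HasCompactSupport ψ
  nonneg : ∀ t, 0 ≤ ψ t
  le_one : ∀ t, ψ t ≤ 1
  eq_one : ∀ t ∈ Set.Icc (-(2 * b)) (2 * b), ψ t = 1
  tsupport_subset : tsupport ψ ⊆ Set.Ioo (-(3 * b)) (3 * b)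

variable {d : ℕ} [NeZero d] {σ : ℝ}

/-- `𝔈_η(x) = (x', x_n + φ(x_n) η(x') / b)`, where `φ(t) = t ψ(t)`. -/
def E (b : ℝ) (ψ : ℝ → ℝ) (η : X d σ) (x : EuclideanSpace ℝ (Fin (d + 1))) :
    EuclideanSpace ℝ (Fin (d + 1)) :=
  WithLp.toLp 2 (Fin.snoc (fun i : Fin d => horizontal x i)
    (x (Fin.last d) + x (Fin.last d) * ψ (x (Fin.last d)) * η (horizontal x) / b))

/-- The radii `0 < δ < 1` such that, for every `η` with `‖η‖_{X^σ} < δ`, the map `𝔈_η` is a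
bi-Lipschitz homeomorphism and a `C¹` diffeomorphism of `ℝⁿ`, and `sup |∇𝔈_η - I| < 1/2`. -/
def IsAdmissibleRadius (d : ℕ) [NeZero d] (σ b : ℝ) (ψ : ℝ → ℝ) (δ : ℝ) : Prop :=
  0 < δ ∧ δ < 1 ∧ ∀ η : X d σ, ‖η‖ < δ →
    (∃ G : EuclideanSpace ℝ (Fin (d + 1)) → EuclideanSpace ℝ (Fin (d + 1)),
      Function.LeftInverse G (E b ψ η) ∧ Function.RightInverse G (E b ψ η) ∧
      (∃ K, LipschitzWith K (E b ψ η)) ∧ (∃ K, LipschitzWith K G) ∧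
      ContDiff ℝ 1 (E b ψ η) ∧ ContDiff ℝ 1 G) ∧
    ∃ c < (1 / 2 : ℝ), ∀ x, ‖fderiv ℝ (E b ψ η) x - ContinuousLinearMap.id ℝ _‖ ≤ c

variable {k : ℕ} {V : Type*} [NormedAddCommGroup V] [NormedSpace ℝ V] [CompleteSpace V]

/-- The weak partial derivative `∂_n f` of `f ∈ H^k(ℝⁿ; V)`, `k ≥ 1`. -/
def lastDeriv (hk : 1 ≤ k) (f : H (d + 1) k V) : EuclideanSpace ℝ (Fin (d + 1)) → V :=
  H.weakDeriv hk (fun _ : Fin 1 => Fin.last d) f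

open scoped Classical in
/-- `Λ(f, η) = f ∘ 𝔈_η` as an element of `H^s(ℝⁿ; V)` (and `0` if `f ∘ 𝔈_η` is not one). -/
def Lam (b : ℝ) (ψ : ℝ → ℝ) (s : ℕ) (p : H (d + 1) (s + 1) V × X d σ) : H (d + 1) s V :=
  if h : ∃ u : H (d + 1) s V, u =ᵐ[volume] fun x => p.1 (E b ψ p.2 x) then h.choose else 0

end Composition

end

end OmegaLemma

/-! Formally, the derivative of `f ∘ 𝔈_η` in the direction `ζ` is `(φ/b) ζ (∂ₙf ∘ 𝔈_η)`. It spends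
one derivative of `f`, which is why `f` lies in `H^{s+1}` and the result in `H^s`. Two bounds carry
the proof: composition with `𝔈_η` is bounded on `H^k` for `k ≤ s`, uniformly over the ball, and
multiplication by `φ(xₙ) ζ(x') / b` is bounded on `H^k` with norm linear in `‖ζ‖`.

Multiplication. Since `η` depends on `x'` only, multiplying by it is, on the Fourier side, a partial
convolution with `η̂`. By Cauchy–Schwarz against the weight `ω`, this is bounded on `H^k` once `∫
|ζ|^{2p}/ω(ζ) · (1+|ξ|²)^k/(1+|ξ-(ζ,0)|²)^k dζ` is bounded in `ξ`, with `p = 0` for `η`, `p = 1` for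
its first derivatives, and `k + p ≤ s` (`kernel_le`, `exists_lintegral_kernel_le`,
`sobolevEnergy_partialConv_le`, `exists_mul_complex`). Low frequencies are harmless because
`|ζ|²/(ζ₁²+|ζ|⁴)` is integrable near `0` in every dimension; high frequencies use `s > n/2`. The
case `k = 0` also shows that `η̂` and `|ζ| η̂` are integrable, so `η` is `C¹` with bounds by `‖η‖`;
small `η` then gives an admissible radius.

Composition. Admissibility implies that `𝔈_η` contracts distances by at most a factor `2`, so
preimages gain at most a factor `2ⁿ` in volume and composition is bounded on `L²`. The chain rule
and the multiplier bounds lift this to `H^k` by induction (`exists_comp_E`). Uniform boundedness and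
density give continuity in `η` for fixed `f`, hence joint continuity (`continuousOn_compH_uncurry`).

Differentiability. Checked on Schwartz functions and extended by density, `f ∘ 𝔈_{η+ζ} - f ∘ 𝔈_η =
∫₀¹ (φ/b) ζ (∂ₙf ∘ 𝔈_{η+tζ}) dt` (`compH_add_sub_compH`). Hence `η ↦ (· ∘ 𝔈_η)` is Lipschitz in
operator norm from `H^{s+1}` to `H^s`, and the Taylor remainder is small by the joint continuity
(`hasFDerivAt_Lam`, `continuousOn_LamDeriv`). -/

namespace OmegaLemma
noncomputable section
local notation "𝔼" n:max => EuclideanSpace ℝ (Fin n)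
local notation "𝕃" n:max V:max => Lp V 2 (volume : Measure (EuclideanSpace ℝ (Fin n)))
set_option linter.unusedSectionVars false

/-! ### Weak derivatives and the structure of `H^k`. -/

section Basics

variable {n j k : ℕ} {V W : Type*} [NormedAddCommGroup V] [NormedSpace ℝ V]
  [NormedAddCommGroup W] [NormedSpace ℝ W]

theorem partialDeriv_one (i : Fin n) (θ : 𝔼 n → ℝ) (x : 𝔼 n) :
    partialDeriv (fun _ : Fin 1 => i) θ x = fderiv ℝ θ x (EuclideanSpace.single i 1) := by
  simp [partialDeriv, iteratedFDeriv_one_apply]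

theorem contDiff_partialDeriv (w : Fin j → Fin n) {θ : 𝔼 n → ℝ} (hθ : ContDiff ℝ ∞ θ) :
    ContDiff ℝ ∞ (partialDeriv w θ) := by
  have h : ContDiff ℝ ∞ (iteratedFDeriv ℝ j θ) :=
    hθ.iteratedFDeriv_right (m := ∞) (by exact_mod_cast le_top)
  exact (ContinuousMultilinearMap.apply ℝ (fun _ : Fin j => 𝔼 n) ℝ
    (fun i => EuclideanSpace.single (w i) 1)).contDiff.comp h

theorem hasCompactSupport_partialDeriv (w : Fin j → Fin n) {θ : 𝔼 n → ℝ}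
    (hc : HasCompactSupport θ) : HasCompactSupport (partialDeriv w θ) :=
  (hc.iteratedFDeriv j).comp_left
    (g := fun A : ContinuousMultilinearMap ℝ (fun _ : Fin j => 𝔼 n) ℝ =>
      A (fun i => EuclideanSpace.single (w i) 1)) (by simp)

/-- The head of the index word is the outermost derivative. Peeling it off lets weak derivatives be
treated one order at a time. -/
theorem partialDeriv_cons (i : Fin n) (w : Fin j → Fin n) {θ : 𝔼 n → ℝ}
    (hθ : ContDiff ℝ ∞ θ) :
    partialDeriv (Fin.cons i w : Fin (j + 1) → Fin n) θ
      = partialDeriv (fun _ : Fin 1 => i) (partialDeriv w θ) := by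
  funext x
  rw [partialDeriv_one, partialDeriv, iteratedFDeriv_succ_apply_left]
  have h : ContDiff ℝ ∞ (iteratedFDeriv ℝ j θ) :=
    hθ.iteratedFDeriv_right (m := ∞) (by exact_mod_cast le_top)
  have hd : HasFDerivAt (iteratedFDeriv ℝ j θ) (fderiv ℝ (iteratedFDeriv ℝ j θ) x) x :=
    ((h.differentiable (by simp)) x).hasFDerivAt
  have := ((ContinuousMultilinearMap.apply ℝ (fun _ : Fin j => 𝔼 n) ℝ
    (fun i => EuclideanSpace.single (w i) 1)).hasFDerivAt.comp x hd).fderiv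
  change _ = fderiv ℝ ((ContinuousMultilinearMap.apply ℝ (fun _ : Fin j => 𝔼 n) ℝ
    (fun i => EuclideanSpace.single (w i) 1)) ∘ iteratedFDeriv ℝ j θ) x _
  rw [this]
  rfl

theorem IsWeakDeriv.congr {w : Fin j → Fin n} {f f' g g' : 𝔼 n → V} (h : IsWeakDeriv w f g)
    (hf : f =ᵐ[volume] f') (hg : g =ᵐ[volume] g') : IsWeakDeriv w f' g' := by
  intro θ hθ hc
  have e₁ : ∫ x, partialDeriv w θ x • f' x = ∫ x, partialDeriv w θ x • f x :=
    integral_congr_ae (by filter_upwards [hf] with x hx; rw [hx])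
  have e₂ : ∫ x, θ x • g' x = ∫ x, θ x • g x :=
    integral_congr_ae (by filter_upwards [hg] with x hx; rw [hx])
  rw [e₁, e₂, h θ hθ hc]

/-- If `∂ᵢ f = f₁` weakly, then `∂ᵢ ∂^w f = g` if and only if `∂^w f₁ = g`. -/
theorem isWeakDeriv_cons_iff {i : Fin n} {w : Fin j → Fin n} {f f₁ g : 𝔼 n → V}
    (h : IsWeakDeriv (fun _ : Fin 1 => i) f f₁) :
    IsWeakDeriv (Fin.cons i w : Fin (j + 1) → Fin n) f g ↔ IsWeakDeriv w f₁ g := by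
  refine forall_congr' fun θ => forall_congr' fun hθ => forall_congr' fun hc => ?_
  -- `∂^w θ` is itself a test function, so `h` applies to it; the sign it produces is the extra
  -- factor in `(-1)^(j+1)`.
  rw [partialDeriv_cons i w hθ, h _ (contDiff_partialDeriv w hθ)
    (hasCompactSupport_partialDeriv w hc), pow_one, neg_one_smul, pow_succ, mul_neg_one, neg_smul,
    neg_inj]

theorem memLp_test {θ : 𝔼 n → ℝ} (hθ : Continuous θ) (hc : HasCompactSupport θ) :
    MemLp θ 2 volume :=
  hθ.memLp_of_hasCompactSupport hc

/-- The functional `f ↦ ∫ θ f` on `L²`. -/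
def pairing (V : Type*) [NormedAddCommGroup V] [NormedSpace ℝ V] [CompleteSpace V] {θ : 𝔼 n → ℝ}
    (hθ : MemLp θ 2 volume) : 𝕃 n V →L[ℝ] V :=
  (ContinuousLinearMap.lsmul ℝ ℝ).lpPairing volume 2 2 (hθ.toLp θ)

theorem pairing_apply [CompleteSpace V] {θ : 𝔼 n → ℝ} (hθ : MemLp θ 2 volume) (f : 𝕃 n V) :
    pairing V hθ f = ∫ x, θ x • f x := by
  rw [pairing, ContinuousLinearMap.lpPairing_eq_integral]
  refine integral_congr_ae ?_
  filter_upwards [hθ.coeFn_toLp] with x hx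
  rw [hx, ContinuousLinearMap.lsmul_apply]

/-- Each test identity equates two continuous functionals on `L² × L²`, so the relation is an
intersection of closed sets. This is what makes `H^k` complete. -/
theorem isClosed_isWeakDeriv [CompleteSpace V] (w : Fin j → Fin n) :
    IsClosed {p : 𝕃 n V × 𝕃 n V | IsWeakDeriv w p.1 p.2} := by
  have : {p : 𝕃 n V × 𝕃 n V | IsWeakDeriv w p.1 p.2}
      = ⋂ (θ : 𝔼 n → ℝ) (hθ : ContDiff ℝ ∞ θ) (hc : HasCompactSupport θ),
        {p : 𝕃 n V × 𝕃 n V |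
          pairing V (memLp_test (contDiff_partialDeriv w hθ).continuous
            (hasCompactSupport_partialDeriv w hc)) p.1
          = (-1 : ℝ) ^ j • pairing V (memLp_test hθ.continuous hc) p.2} := by
    ext p
    simp only [Set.mem_ofPred_eq, Set.mem_iInter, pairing_apply]
    rfl
  rw [this]
  refine isClosed_iInter fun θ => isClosed_iInter fun hθ => isClosed_iInter fun hc => ?_
  exact isClosed_eq ((pairing V _).continuous.comp continuous_fst)
    (((pairing V _).continuous.comp continuous_snd).const_smul _)

theorem IsWeakDeriv.clm_comp [CompleteSpace V] [CompleteSpace W] (L : V →L[ℝ] W) {w : Fin j → Fin n}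
    {f g : 𝕃 n V} (h : IsWeakDeriv w f g) :
    IsWeakDeriv w (L.compLp f : 𝕃 n W) (L.compLp g : 𝕃 n W) := by
  intro θ hθ hc
  have e₁ : ∫ x, partialDeriv w θ x • (L.compLp f : 𝕃 n W) x
      = ∫ x, L (partialDeriv w θ x • f x) :=
    integral_congr_ae (by filter_upwards [L.coeFn_compLp f] with x hx; rw [hx, map_smul])
  have e₂ : ∫ x, θ x • (L.compLp g : 𝕃 n W) x = ∫ x, L (θ x • g x) :=
    integral_congr_ae (by filter_upwards [L.coeFn_compLp g] with x hx; rw [hx, map_smul])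
  rw [e₁, e₂, L.integral_comp_comm (integrable_partialDeriv_smul w hθ hc f),
    L.integral_comp_comm (integrable_smul_test hθ hc g), h θ hθ hc, map_smul]

namespace H

theorem ext_ae {f g : H n k V} (h : (f : 𝔼 n → V) =ᵐ[volume] g) : f = g :=
  toL2_injective (Lp.ext h)

variable [CompleteSpace V] [CompleteSpace W]

theorem norm_weakDeriv_le (hj : j ≤ k) (w : Fin j → Fin n) (f : H n k V) :
    ‖weakDeriv hj w f‖ ≤ ‖f‖ :=
  PiLp.norm_apply_le (jet f) ⟨⟨j, Nat.lt_succ_of_le hj⟩, w⟩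

theorem norm_le_sum (f : H n k V) :
    ‖f‖ ≤ ∑ w : (Σ j : Fin (k + 1), (Fin j → Fin n)),
      ‖weakDeriv (Nat.lt_succ_iff.mp w.1.2) w.2 f‖ := by
  change ‖jet f‖ ≤ _
  rw [PiLp.norm_eq_of_L2]
  refine Real.sqrt_le_iff.mpr ⟨Finset.sum_nonneg fun _ _ => norm_nonneg _, ?_⟩
  exact Finset.sum_sq_le_sq_sum_of_nonneg fun _ _ => norm_nonneg _

theorem weakDeriv_eq {hj : j ≤ k} {w : Fin j → Fin n} {f : H n k V} {g : 𝕃 n V}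
    (h : IsWeakDeriv w f g) : weakDeriv hj w f = g :=
  (isWeakDeriv_weakDeriv hj w f).unique h

theorem isWeakDeriv_zero (w : Fin 0 → Fin n) (f : 𝔼 n → V) : IsWeakDeriv w f f := by
  intro θ _ _
  simp [partialDeriv]

theorem weakDeriv_zero (w : Fin 0 → Fin n) (f : H n k V) :
    weakDeriv (Nat.zero_le k) w f = toL2 f :=
  weakDeriv_eq (isWeakDeriv_zero w f)

theorem norm_toL2_le (f : H n k V) : ‖toL2 f‖ ≤ ‖f‖ := by
  rw [← weakDeriv_zero (fun i => i.elim0) f]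
  exact norm_weakDeriv_le _ _ f

variable (n k V) in
/-- The inclusion `H^k → L²` as a bounded map. -/
def toL2L : H n k V →L[ℝ] 𝕃 n V :=
  toL2.mkContinuous 1 fun f => by rw [one_mul]; exact norm_toL2_le f

@[simp] theorem toL2L_apply (f : H n k V) : toL2L n k V f = toL2 f := rfl

/-- The weak derivative `∂ᵢ : H^{k+1} → H^k`. -/
def pdAux (i : Fin n) : H n (k + 1) V →ₗ[ℝ] H n k V where
  toFun f := ⟨weakDeriv (Nat.le_add_left 1 k) (fun _ : Fin 1 => i) f, fun j hj w =>
    ⟨weakDeriv (Nat.succ_le_succ hj) (Fin.cons i w : Fin (j + 1) → Fin n) f,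
      (isWeakDeriv_cons_iff (isWeakDeriv_weakDeriv _ _ f)).mp (isWeakDeriv_weakDeriv _ _ f)⟩⟩
  map_add' f g := Subtype.ext (map_add (weakDeriv _ _) f g)
  map_smul' c f := Subtype.ext (map_smul (weakDeriv _ _) c f)

theorem isWeakDeriv_pdAux (i : Fin n) (f : H n (k + 1) V) :
    IsWeakDeriv (fun _ : Fin 1 => i) f (pdAux i f) :=
  isWeakDeriv_weakDeriv (Nat.le_add_left 1 k) _ f

theorem weakDeriv_pdAux (hj : j ≤ k) (i : Fin n) (w : Fin j → Fin n) (f : H n (k + 1) V) :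
    weakDeriv hj w (pdAux i f)
      = weakDeriv (Nat.succ_le_succ hj) (Fin.cons i w : Fin (j + 1) → Fin n) f :=
  weakDeriv_eq ((isWeakDeriv_cons_iff (isWeakDeriv_pdAux i f)).mp (isWeakDeriv_weakDeriv _ _ f))

variable (n k) in
/-- The number of partial derivatives of order at most `k`. -/
def numJet : ℕ := Fintype.card (Σ j : Fin (k + 1), (Fin j → Fin n))

theorem norm_le_numJet_mul {f : H n k V} {C : ℝ}
    (h : ∀ (j : ℕ) (hj : j ≤ k) (w : Fin j → Fin n), ‖weakDeriv hj w f‖ ≤ C) :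
    ‖f‖ ≤ numJet n k * C := by
  refine (norm_le_sum f).trans ((Finset.sum_le_sum fun w _ => h _ _ _).trans (le_of_eq ?_))
  rw [Finset.sum_const, nsmul_eq_mul, Finset.card_univ, numJet]

variable (V) in
/-- The weak derivative `∂ᵢ : H^{k+1} → H^k` as a bounded map. -/
def pd (k : ℕ) (i : Fin n) : H n (k + 1) V →L[ℝ] H n k V :=
  (pdAux i).mkContinuous (numJet n k) fun f => norm_le_numJet_mul fun j hj w => by
    rw [weakDeriv_pdAux]
    exact norm_weakDeriv_le _ _ f

theorem isWeakDeriv_pd (i : Fin n) (f : H n (k + 1) V) :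
    IsWeakDeriv (fun _ : Fin 1 => i) f (pd V k i f) :=
  isWeakDeriv_pdAux i f

theorem weakDeriv_pd (hj : j ≤ k) (i : Fin n) (w : Fin j → Fin n) (f : H n (k + 1) V) :
    weakDeriv hj w (pd V k i f)
      = weakDeriv (Nat.succ_le_succ hj) (Fin.cons i w : Fin (j + 1) → Fin n) f :=
  weakDeriv_pdAux hj i w f

theorem pd_eq {i : Fin n} {f : H n (k + 1) V} {g : H n k V}
    (h : IsWeakDeriv (fun _ : Fin 1 => i) f g) : pd V k i f = g :=
  toL2_injective ((isWeakDeriv_pd i f).unique h)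

/-- The norm of `H^{k+1}` is controlled by the `L²` norm and the `H^k` norms of the first
derivatives. -/
theorem norm_succ_le (f : H n (k + 1) V) :
    ‖f‖ ≤ numJet n (k + 1) * (‖toL2 f‖ + ∑ i, ‖pd V k i f‖) := by
  have h0 : 0 ≤ ∑ i, ‖pd V k i f‖ := Finset.sum_nonneg fun _ _ => norm_nonneg _
  refine norm_le_numJet_mul fun j hj w => ?_
  cases j with
  | zero => rw [weakDeriv_zero]; linarith
  | succ j =>
    have e : weakDeriv hj w f = weakDeriv (Nat.le_of_succ_le_succ hj) (Fin.tail w)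
        (pd V k (w 0) f) := by
      rw [weakDeriv_pd]
      congr 1
    rw [e]
    have h1 : ‖pd V k (w 0) f‖ ≤ ∑ i, ‖pd V k i f‖ :=
      Finset.single_le_sum (f := fun i => ‖pd V k i f‖) (fun _ _ => norm_nonneg _)
        (Finset.mem_univ _)
    linarith [norm_weakDeriv_le (Nat.le_of_succ_le_succ hj) (Fin.tail w) (pd V k (w 0) f),
      norm_nonneg (toL2 f)]

/-- A function in `L²` whose first weak derivatives are in `H^k` is in `H^{k+1}`. -/
theorem exists_of_isWeakDeriv (u : 𝕃 n V) (g : Fin n → H n k V)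
    (h : ∀ i, IsWeakDeriv (fun _ : Fin 1 => i) u (g i)) :
    ∃ U : H n (k + 1) V, toL2 U = u ∧ ∀ i, pd V k i U = g i := by
  have hU : u ∈ sobolevSubmodule n (k + 1) V := by
    intro j hj w
    cases j with
    | zero => exact ⟨u, isWeakDeriv_zero w u⟩
    | succ j =>
      refine ⟨weakDeriv (Nat.le_of_succ_le_succ hj) (Fin.tail w) (g (w 0)), ?_⟩
      rw [← Fin.cons_self_tail w]
      exact (isWeakDeriv_cons_iff (h (w 0))).mpr (isWeakDeriv_weakDeriv _ _ _)
  exact ⟨⟨u, hU⟩, rfl, fun i => pd_eq (h i)⟩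

variable (n V) in
/-- `L² = H⁰`. -/
def ofL2 : 𝕃 n V →ₗ[ℝ] H n 0 V where
  toFun u := ⟨u, fun j hj w => by
    obtain rfl : j = 0 := Nat.le_zero.mp hj
    exact ⟨u, isWeakDeriv_zero w u⟩⟩
  map_add' _ _ := rfl
  map_smul' _ _ := rfl

theorem norm_zero_le (f : H n 0 V) : ‖f‖ ≤ numJet n 0 * ‖toL2 f‖ :=
  norm_le_numJet_mul fun j hj w => by
    obtain rfl : j = 0 := Nat.le_zero.mp hj
    exact (congrArg norm (weakDeriv_zero w f)).le

variable (n k V) in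
/-- The inclusion `H^{k+1} → H^k`. -/
def incl : H n (k + 1) V →L[ℝ] H n k V :=
  LinearMap.mkContinuous
    { toFun := fun f => ⟨toL2 f, fun j hj w => f.2 j (hj.trans (Nat.le_succ k)) w⟩
      map_add' := fun _ _ => rfl
      map_smul' := fun _ _ => rfl } (numJet n k) fun f => norm_le_numJet_mul fun j hj w => by
    refine le_of_eq_of_le (congrArg norm ?_)
      (norm_weakDeriv_le (hj.trans (Nat.le_succ k)) w f)
    exact weakDeriv_eq (isWeakDeriv_weakDeriv (hj.trans (Nat.le_succ k)) w f)

variable (n k) in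
/-- Composition with a linear map `V → W` on the left. -/
def mapL (L : V →L[ℝ] W) : H n k V →L[ℝ] H n k W :=
  LinearMap.mkContinuous
    { toFun := fun f => ⟨L.compLp (toL2 f), fun j hj w =>
        ⟨L.compLp (weakDeriv hj w f), (isWeakDeriv_weakDeriv hj w f).clm_comp L⟩⟩
      map_add' := fun f g => Subtype.ext (map_add (L.compLpₗ 2 volume) (toL2 f) (toL2 g))
      map_smul' := fun c f => Subtype.ext (map_smul (L.compLpₗ 2 volume) c (toL2 f)) }
    (numJet n k * ‖L‖) fun f => by
    rw [mul_assoc]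
    refine norm_le_numJet_mul fun j hj w => ?_
    refine le_of_eq_of_le (congrArg norm ?_) ((L.norm_compLp_le (weakDeriv hj w f)).trans
      (mul_le_mul_of_nonneg_left (norm_weakDeriv_le hj w f) (norm_nonneg L)))
    exact weakDeriv_eq ((isWeakDeriv_weakDeriv hj w f).clm_comp L)

theorem coeFn_mapL (L : V →L[ℝ] W) (f : H n k V) :
    (mapL n k L f : 𝔼 n → W) =ᵐ[volume] fun x => L (f x) :=
  L.coeFn_compLp (toL2 f)

theorem coeFn_add (f g : H n k V) : ((f + g : H n k V) : 𝔼 n → V) =ᵐ[volume] f + g := by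
  rw [map_add]; exact Lp.coeFn_add _ _

theorem coeFn_smul (c : ℝ) (f : H n k V) :
    ((c • f : H n k V) : 𝔼 n → V) =ᵐ[volume] c • (f : 𝔼 n → V) := by
  rw [map_smul]; exact Lp.coeFn_smul _ _

theorem aestronglyMeasurable (f : H n k V) : AEStronglyMeasurable (f : 𝔼 n → V) volume :=
  (Lp.memLp (toL2 f)).1

variable (n k V) in
/-- The jet as a linear isometry. -/
def jetₗᵢ : H n k V →ₗᵢ[ℝ] PiLp 2 (fun _ : (Σ j : Fin (k + 1), (Fin j → Fin n)) => 𝕃 n V) where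
  toLinearMap := jet
  norm_map' _ := rfl

/-- The jet is an isometry whose range is the set of families `G` with each `G w` the weak
derivative of the order-zero entry, a closed condition. Completeness is needed for Bochner integrals
of `H^k`-valued paths. -/
instance : CompleteSpace (H n k V) := by
  rw [completeSpace_iff_isComplete_range (jetₗᵢ n k V).isometry.isUniformInducing]
  refine IsClosed.isComplete ?_
  let w₀ : Σ j : Fin (k + 1), (Fin j → Fin n) := ⟨0, fun i => i.elim0⟩
  have e : Set.range (jetₗᵢ n k V) = ⋂ w : (Σ j : Fin (k + 1), (Fin j → Fin n)),
      {G | IsWeakDeriv w.2 (G w₀) (G w)} := by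
    ext G
    simp only [Set.mem_range, Set.mem_iInter, Set.mem_ofPred_eq]
    constructor
    · rintro ⟨f, rfl⟩ w
      have h0 : (jetₗᵢ n k V f) w₀ = toL2 f := weakDeriv_zero _ f
      rw [h0]
      exact isWeakDeriv_weakDeriv (Nat.lt_succ_iff.mp w.1.2) w.2 f
    · intro h
      refine ⟨⟨G w₀, fun j hj w => ⟨G ⟨⟨j, Nat.lt_succ_of_le hj⟩, w⟩, h ⟨⟨j, Nat.lt_succ_of_le hj⟩, w⟩⟩⟩, ?_⟩
      ext1 w
      exact weakDeriv_eq (hj := Nat.lt_succ_iff.mp w.1.2) (h w)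
  rw [e]
  refine isClosed_iInter fun w => ?_
  have hc : Continuous fun G : PiLp 2 (fun _ : (Σ j : Fin (k + 1), (Fin j → Fin n)) => 𝕃 n V) =>
      (G w₀, G w) := (PiLp.continuous_apply 2 _ w₀).prodMk (PiLp.continuous_apply 2 _ w)
  exact (isClosed_isWeakDeriv w.2).preimage hc

end H

end Basics

/-! ### Enlarging the class of test functions; comparison with tempered distributions. -/

section TestFunctions

variable {n : ℕ} {V : Type*} [NormedAddCommGroup V] [NormedSpace ℝ V] [CompleteSpace V]

theorem partialDeriv_mul (i : Fin n) {χ θ : 𝔼 n → ℝ} (hχ : Differentiable ℝ χ)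
    (hθ : Differentiable ℝ θ) (x : 𝔼 n) :
    partialDeriv (fun _ : Fin 1 => i) (fun y => χ y * θ y) x
      = χ x * partialDeriv (fun _ : Fin 1 => i) θ x
        + partialDeriv (fun _ : Fin 1 => i) χ x * θ x := by
  rw [partialDeriv_one, partialDeriv_one, partialDeriv_one,
    fderiv_fun_mul (hχ x) (hθ x)]
  simp [mul_comm]

/-- The test function in the definition of a first order weak derivative may be any smooth function
that is in `L²` together with its derivative. -/
theorem IsWeakDeriv.integral_eq_of_memLp {i : Fin n} {u g : 𝕃 n V}
    (h : IsWeakDeriv (fun _ : Fin 1 => i) u g) {θ : 𝔼 n → ℝ} (hθ : ContDiff ℝ ∞ θ)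
    (h0 : MemLp θ 2 volume) (h1 : MemLp (partialDeriv (fun _ : Fin 1 => i) θ) 2 volume) :
    ∫ x, partialDeriv (fun _ : Fin 1 => i) θ x • u x = -∫ x, θ x • g x := by
  let χ : ContDiffBump (0 : 𝔼 n) := ⟨1, 2, one_pos, one_lt_two⟩
  have hχs : ContDiff ℝ ∞ χ := χ.contDiff
  -- Cutoffs equal to `1` on growing balls, with derivatives of size `B/(m+1)`. Then `c m * θ` is an
  -- admissible test function, and dominated convergence removes the cutoff.
  let c : ℕ → 𝔼 n → ℝ := fun m x => χ (((m : ℝ) + 1)⁻¹ • x)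
  have hcs : ∀ m, ContDiff ℝ ∞ (c m) := fun m => hχs.comp (contDiff_id.const_smul ((m + 1 : ℝ)⁻¹))
  have hm : ∀ m : ℕ, ((m + 1 : ℝ)⁻¹) ≠ 0 := fun m => by positivity
  have hcc : ∀ m, HasCompactSupport (c m) := fun m =>
    χ.hasCompactSupport.comp_homeomorph (Homeomorph.smulOfNeZero _ (hm m))
  have hcd : ∀ m x, partialDeriv (fun _ : Fin 1 => i) (c m) x
      = (m + 1 : ℝ)⁻¹ * partialDeriv (fun _ : Fin 1 => i) χ ((m + 1 : ℝ)⁻¹ • x) := by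
    intro m x
    rw [partialDeriv_one, partialDeriv_one]
    have := fderiv_comp_smul (𝕜 := ℝ) (f := (χ : 𝔼 n → ℝ)) (x := x) ((m : ℝ) + 1)⁻¹
    change fderiv ℝ (fun y => χ ((m + 1 : ℝ)⁻¹ • y)) x _ = _
    rw [this]
    rfl
  obtain ⟨B, hB⟩ : ∃ B, ∀ x, ‖partialDeriv (fun _ : Fin 1 => i) χ x‖ ≤ B :=
    (contDiff_partialDeriv _ hχs).continuous.bounded_above_of_compact_support
      (hasCompactSupport_partialDeriv _ χ.hasCompactSupport)
  have hu := Lp.memLp u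
  have hg := Lp.memLp g
  have iu : ∀ {f : 𝔼 n → ℝ}, MemLp f 2 volume → Integrable (fun x => f x • u x) :=
    fun hf => memLp_one_iff_integrable.mp (hu.smul hf)
  have ig : Integrable (fun x => θ x • g x) := memLp_one_iff_integrable.mp (hg.smul h0)
  have hlim1 : ∀ x : 𝔼 n, Filter.Tendsto (fun m : ℕ => (m + 1 : ℝ)⁻¹ • x) Filter.atTop (nhds 0) := by
    intro x
    have : Filter.Tendsto (fun m : ℕ => (m + 1 : ℝ)⁻¹) Filter.atTop (nhds 0) := by
      simpa only [one_div] using tendsto_one_div_add_atTop_nhds_zero_nat (𝕜 := ℝ)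
    simpa using this.smul_const x
  have hlimc : ∀ x, Filter.Tendsto (fun m => c m x) Filter.atTop (nhds 1) := by
    intro x
    have h1 : χ 0 = 1 := χ.one_of_mem_closedBall (by simp [χ.rIn_pos.le])
    rw [← h1]
    exact (χ.continuous.tendsto 0).comp (hlim1 x)
  have hlimd : ∀ x, Filter.Tendsto (fun m => partialDeriv (fun _ : Fin 1 => i) (c m) x)
      Filter.atTop (nhds 0) := by
    intro x
    have : Filter.Tendsto (fun m : ℕ => (m + 1 : ℝ)⁻¹ * B) Filter.atTop (nhds 0) := by
      simpa only [one_div, zero_mul] using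
        (tendsto_one_div_add_atTop_nhds_zero_nat (𝕜 := ℝ)).mul_const B
    refine squeeze_zero_norm (fun m => ?_) this
    rw [hcd, norm_mul, Real.norm_of_nonneg (by positivity)]
    exact mul_le_mul_of_nonneg_left (hB _) (by positivity)
  have hcb : ∀ m x, |c m x| ≤ 1 := fun m x => by
    rw [abs_of_nonneg χ.nonneg]; exact χ.le_one
  have hdb : ∀ m x, |partialDeriv (fun _ : Fin 1 => i) (c m) x| ≤ B := fun m x => by
    rw [hcd, abs_mul, abs_of_nonneg (by positivity)]
    refine (mul_le_of_le_one_left (abs_nonneg _) ?_).trans (hB _)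
    exact inv_le_one_of_one_le₀ (by linarith [m.cast_nonneg (α := ℝ)])
  have key : ∀ m, ∫ x, partialDeriv (fun _ : Fin 1 => i) (fun y => c m y * θ y) x • u x
      = -∫ x, (c m x * θ x) • g x := fun m => by
    rw [h _ ((hcs m).mul hθ) (hcc m).mul_right, pow_one, neg_one_smul]
  have dθ := hθ.differentiable (by simp)
  have cd := fun m => (hcs m).differentiable (by simp)
  have L1 : Filter.Tendsto (fun m => ∫ x, partialDeriv (fun _ : Fin 1 => i)
      (fun y => c m y * θ y) x • u x) Filter.atTop
      (nhds (∫ x, partialDeriv (fun _ : Fin 1 => i) θ x • u x)) := by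
    refine tendsto_integral_of_dominated_convergence
      (fun x => ‖partialDeriv (fun _ : Fin 1 => i) θ x • u x‖ + B * ‖θ x • u x‖) ?_
      ((iu h1).norm.add ((iu h0).norm.const_mul B)) ?_ ?_
    · exact fun m => (contDiff_partialDeriv _ ((hcs m).mul hθ)).continuous.aestronglyMeasurable.smul
        hu.1
    · refine fun m => Filter.Eventually.of_forall fun x => ?_
      rw [partialDeriv_mul i (cd m) dθ, add_smul, mul_smul, mul_smul]
      refine (norm_add_le _ _).trans (add_le_add ?_ ?_)
      · rw [norm_smul]; exact mul_le_of_le_one_left (norm_nonneg _) (hcb m x)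
      · rw [norm_smul]; exact mul_le_mul_of_nonneg_right (hdb m x) (norm_nonneg _)
    · refine Filter.Eventually.of_forall fun x => ?_
      simp only [partialDeriv_mul i (cd _) dθ]
      have := (((hlimc x).mul_const (partialDeriv (fun _ : Fin 1 => i) θ x)).add
        ((hlimd x).mul_const (θ x))).smul_const (u x)
      simpa using this
  have L2 : Filter.Tendsto (fun m => ∫ x, (c m x * θ x) • g x) Filter.atTop
      (nhds (∫ x, θ x • g x)) := by
    refine tendsto_integral_of_dominated_convergence (fun x => ‖θ x • g x‖) ?_ ig.norm ?_ ?_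
    · exact fun m => ((hcs m).mul hθ).continuous.aestronglyMeasurable.smul hg.1
    · refine fun m => Filter.Eventually.of_forall fun x => ?_
      rw [mul_smul, norm_smul]; exact mul_le_of_le_one_left (norm_nonneg _) (hcb m x)
    · refine Filter.Eventually.of_forall fun x => ?_
      simpa using ((hlimc x).mul_const (θ x)).smul_const (g x)
  refine tendsto_nhds_unique L1 ?_
  simp only [key]
  exact L2.neg

/-- One side tests with real compactly supported functions, the other with complex Schwartz
functions. Real and imaginary parts of a Schwartz function are square integrable with their
derivatives, so `IsWeakDeriv.integral_eq_of_memLp` bridges the gap; conversely, real test functions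
are Schwartz. -/
theorem isWeakDeriv_iff_lineDerivOp {i : Fin n} {u g : 𝕃 n ℂ} :
    IsWeakDeriv (fun _ : Fin 1 => i) u g ↔
      LineDeriv.lineDerivOp (EuclideanSpace.single i (1 : ℝ)) (u : 𝓢'(𝔼 n, ℂ))
        = (g : 𝓢'(𝔼 n, ℂ)) := by
  have hd : ∀ (θ : 𝔼 n → ℝ) (x), partialDeriv (fun _ : Fin 1 => i) θ x
      = fderiv ℝ θ x (EuclideanSpace.single i 1) := fun θ x => partialDeriv_one i θ x
  constructor
  · intro h
    ext θ
    rw [TemperedDistribution.lineDerivOp_apply_apply, Lp.toTemperedDistribution_apply,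
      Lp.toTemperedDistribution_apply]
    have hre : ContDiff ℝ ∞ (fun x => (θ x).re) := Complex.reCLM.contDiff.comp (θ.smooth ⊤)
    have him : ContDiff ℝ ∞ (fun x => (θ x).im) := Complex.imCLM.contDiff.comp (θ.smooth ⊤)
    have dre : ∀ x, partialDeriv (fun _ : Fin 1 => i) (fun x => (θ x).re) x
        = (LineDeriv.lineDerivOp (EuclideanSpace.single i (1 : ℝ)) θ x).re := fun x => by
      rw [hd, SchwartzMap.lineDerivOp_apply_eq_fderiv]
      change fderiv ℝ (Complex.reCLM ∘ θ) x _ = _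
      rw [(Complex.reCLM.hasFDerivAt.comp x (θ.hasFDerivAt x)).fderiv]
      rfl
    have dim : ∀ x, partialDeriv (fun _ : Fin 1 => i) (fun x => (θ x).im) x
        = (LineDeriv.lineDerivOp (EuclideanSpace.single i (1 : ℝ)) θ x).im := fun x => by
      rw [hd, SchwartzMap.lineDerivOp_apply_eq_fderiv]
      change fderiv ℝ (Complex.imCLM ∘ θ) x _ = _
      rw [(Complex.imCLM.hasFDerivAt.comp x (θ.hasFDerivAt x)).fderiv]
      rfl
    have mθ := θ.memLp 2 (μ := volume)
    have mdθ := (LineDeriv.lineDerivOp (EuclideanSpace.single i (1 : ℝ)) θ).memLp 2 (μ := volume)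
    have e1 := h.integral_eq_of_memLp hre mθ.re (by rw [funext dre]; exact mdθ.re)
    have e2 := h.integral_eq_of_memLp him mθ.im (by rw [funext dim]; exact mdθ.im)
    simp only [dre] at e1
    simp only [dim] at e2
    have split : ∀ (p : 𝓢(𝔼 n, ℂ)) (f : 𝕃 n ℂ), ∫ x, p x • f x
        = (∫ x, (p x).re • f x) + Complex.I * ∫ x, (p x).im • f x := by
      intro p f
      have mp := p.memLp 2 (μ := volume)
      have i1 : Integrable fun x => (p x).re • f x :=
        memLp_one_iff_integrable.mp ((Lp.memLp f).smul mp.re)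
      have i2 : Integrable fun x => (p x).im • f x :=
        memLp_one_iff_integrable.mp ((Lp.memLp f).smul mp.im)
      rw [← integral_const_mul, ← integral_add i1 (i2.const_mul _)]
      refine integral_congr_ae (Filter.Eventually.of_forall fun x => ?_)
      simp only [smul_eq_mul, Complex.real_smul]
      nth_rewrite 1 [← Complex.re_add_im (p x)]
      ring
    have hneg : ∀ x, (-LineDeriv.lineDerivOp (EuclideanSpace.single i (1 : ℝ)) θ :
        𝓢(𝔼 n, ℂ)) x • u x
        = -(LineDeriv.lineDerivOp (EuclideanSpace.single i (1 : ℝ)) θ x • u x) := fun x => by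
      simp
    simp only [hneg]
    rw [integral_neg, split, split θ g, e1, e2]
    ring
  · intro h θ hθ hc
    have hc' : HasCompactSupport (Complex.ofRealCLM ∘ θ) := hc.comp_left rfl
    have hθ' : ContDiff ℝ ∞ (Complex.ofRealCLM ∘ θ) := by fun_prop
    have := congrArg (fun T : 𝓢'(𝔼 n, ℂ) => T (hc'.toSchwartzMap hθ')) h
    simp only [TemperedDistribution.lineDerivOp_apply_apply,
      Lp.toTemperedDistribution_apply] at this
    have hneg : ∀ x, (-LineDeriv.lineDerivOp (EuclideanSpace.single i (1 : ℝ))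
        (hc'.toSchwartzMap hθ') : 𝓢(𝔼 n, ℂ)) x • u x
        = -(partialDeriv (fun _ : Fin 1 => i) θ x • u x) := fun x => by
      have e : LineDeriv.lineDerivOp (EuclideanSpace.single i (1 : ℝ)) (hc'.toSchwartzMap hθ') x
          = (partialDeriv (fun _ : Fin 1 => i) θ x : ℂ) := by
        rw [SchwartzMap.lineDerivOp_apply_eq_fderiv, hd]
        change fderiv ℝ (Complex.ofRealCLM ∘ θ) x _ = _
        rw [(Complex.ofRealCLM.hasFDerivAt.comp x
          ((hθ.differentiable (by simp)) x).hasFDerivAt).fderiv]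
        rfl
      rw [neg_apply, e, neg_smul]
      simp
    simp only [hneg] at this
    rw [integral_neg] at this
    rw [pow_one, neg_one_smul, neg_eq_iff_eq_neg.mp this]
    simp

end TestFunctions

/-! ### Fourier characterization of `H^k(ℝⁿ; ℂ)`. -/

section FourierSide

open scoped ENNReal

variable {n k : ℕ}

/-- The Fourier transform is injective on tempered distributions and turns the directional
derivative into multiplication by `2πi ξᵢ`; the resulting identity of distributions between locally
integrable functions is an a.e. identity. -/
theorem isWeakDeriv_iff_fourier {i : Fin n} {u g : 𝕃 n ℂ} :
    IsWeakDeriv (fun _ : Fin 1 => i) u g ↔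
      ((𝓕 g : 𝕃 n ℂ) : 𝔼 n → ℂ) =ᵐ[volume]
        fun ξ => (2 * Real.pi * Complex.I * ξ i) * (𝓕 u : 𝕃 n ℂ) ξ := by
  have hinner : ∀ ξ : 𝔼 n, inner ℝ ξ (EuclideanSpace.single i (1 : ℝ)) = ξ i := fun ξ => by
    rw [EuclideanSpace.inner_single_right]; simp
  have hg : (fun ξ : 𝔼 n => (inner ℝ ξ (EuclideanSpace.single i (1 : ℝ)) : ℝ)).HasTemperateGrowth := by
    fun_prop
  have hgC : (fun ξ : 𝔼 n =>
      ((inner ℝ ξ (EuclideanSpace.single i (1 : ℝ)) : ℝ) : ℂ)).HasTemperateGrowth := by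
    fun_prop
  rw [isWeakDeriv_iff_lineDerivOp]
  have inj : ∀ S T : 𝓢'(𝔼 n, ℂ), S = T ↔ 𝓕 S = 𝓕 T := fun S T =>
    ⟨fun h => by rw [h], fun h => by
      rw [← FourierTransform.fourierInv_fourier_eq (F := 𝓢'(𝔼 n, ℂ)) S, h,
        FourierTransform.fourierInv_fourier_eq]⟩
  rw [inj, TemperedDistribution.fourier_lineDerivOp_eq, Lp.fourier_toTemperedDistribution_eq,
    Lp.fourier_toTemperedDistribution_eq]
  have eval : ∀ θ : 𝓢(𝔼 n, ℂ), ((2 * Real.pi * Complex.I) • TemperedDistribution.smulLeftCLM ℂ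
      (fun ξ : 𝔼 n => ((inner ℝ ξ (EuclideanSpace.single i (1 : ℝ)) : ℝ) : ℂ))
      ((𝓕 u : 𝕃 n ℂ) : 𝓢'(𝔼 n, ℂ))) θ
      = ∫ ξ, θ ξ • ((2 * Real.pi * Complex.I * ξ i) * (𝓕 u : 𝕃 n ℂ) ξ) := by
    intro θ
    change (2 * Real.pi * Complex.I) • (TemperedDistribution.smulLeftCLM ℂ
      (fun ξ : 𝔼 n => ((inner ℝ ξ (EuclideanSpace.single i (1 : ℝ)) : ℝ) : ℂ))
      ((𝓕 u : 𝕃 n ℂ) : 𝓢'(𝔼 n, ℂ))) θ = _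
    rw [TemperedDistribution.smulLeftCLM_apply_apply, Lp.toTemperedDistribution_apply,
      ← integral_smul]
    refine integral_congr_ae (Filter.Eventually.of_forall fun ξ => ?_)
    simp only [SchwartzMap.smulLeftCLM_apply_apply hgC]
    simp only [hinner, smul_eq_mul]
    ring
  have hu := Lp.memLp (𝓕 u : 𝕃 n ℂ)
  constructor
  · intro h
    refine ae_eq_of_integral_contDiff_smul_eq
      ((Lp.memLp (𝓕 g : 𝕃 n ℂ)).locallyIntegrable (by norm_num)) ?_ ?_
    · have hl : LocallyIntegrable ((𝓕 u : 𝕃 n ℂ) : 𝔼 n → ℂ) volume :=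
        hu.locallyIntegrable (by norm_num)
      have := hl.locallyIntegrableOn Set.univ
      rw [← locallyIntegrableOn_univ]
      exact this.continuousOn_mul (g := fun ξ : 𝔼 n => (2 * Real.pi * Complex.I * ξ i : ℂ))
        (by fun_prop) isOpen_univ.isLocallyClosed
    · intro θ hθ hc
      have hc' : HasCompactSupport (Complex.ofRealCLM ∘ θ) := hc.comp_left rfl
      have hθ' : ContDiff ℝ ∞ (Complex.ofRealCLM ∘ θ) := by fun_prop
      have e := congrArg (fun T : 𝓢'(𝔼 n, ℂ) => T (hc'.toSchwartzMap hθ')) h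
      rw [eval, Lp.toTemperedDistribution_apply] at e
      simpa using e.symm
  · intro h
    ext θ
    rw [eval, Lp.toTemperedDistribution_apply]
    refine integral_congr_ae ?_
    filter_upwards [h] with ξ hξ
    rw [hξ]

/-- The integral of `(1 + |ξ|²)^k |v(ξ)|²`. -/
def sobolevEnergy (k : ℕ) (v : 𝔼 n → ℂ) : ℝ≥0∞ :=
  ∫⁻ ξ, ENNReal.ofReal ((1 + ‖ξ‖ ^ 2) ^ k) * ‖v ξ‖ₑ ^ 2

theorem sobolevEnergy_congr {v w : 𝔼 n → ℂ} (h : v =ᵐ[volume] w) :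
    sobolevEnergy k v = sobolevEnergy k w :=
  lintegral_congr_ae (by filter_upwards [h] with ξ hξ; rw [hξ])

theorem sobolevEnergy_mono {l : ℕ} (h : k ≤ l) (v : 𝔼 n → ℂ) :
    sobolevEnergy k v ≤ sobolevEnergy l v :=
  lintegral_mono fun ξ => by
    gcongr
    linarith [sq_nonneg ‖ξ‖]

theorem sobolevEnergy_zero (v : 𝕃 n ℂ) : sobolevEnergy 0 v = ‖v‖ₑ ^ 2 := by
  rw [sobolevEnergy, Lp.enorm_def, eLpNorm_eq_lintegral_rpow_enorm_toReal (by norm_num) (by norm_num)]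
  rw [← ENNReal.rpow_natCast, ← ENNReal.rpow_mul]
  simp

/-- Split one factor of the weight as `1 + ∑ ξᵢ²` and use `(2π)² ≥ 1`. This is the induction step
for bounding the energy by the `H^k` norm. -/
theorem sobolevEnergy_succ_le (v : 𝔼 n → ℂ) (hv : AEStronglyMeasurable v volume) :
    sobolevEnergy (k + 1) v ≤ sobolevEnergy k v
      + ∑ i, sobolevEnergy k (fun ξ => (2 * Real.pi * Complex.I * ξ i) * v ξ) := by
  have hm : ∀ f : 𝔼 n → ℂ, AEStronglyMeasurable f volume → AEMeasurable
      (fun ξ => ENNReal.ofReal ((1 + ‖ξ‖ ^ 2) ^ k) * ‖f ξ‖ₑ ^ 2) volume := fun f hf => by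
    have := hf.enorm
    fun_prop
  have hm' : ∀ i, AEStronglyMeasurable (fun ξ : 𝔼 n => (2 * Real.pi * Complex.I * ξ i : ℂ) * v ξ)
      volume := fun i =>
    (by fun_prop : Continuous fun ξ : 𝔼 n => (2 * Real.pi * Complex.I * ξ i : ℂ)).aestronglyMeasurable.mul
      hv
  simp only [sobolevEnergy]
  rw [← lintegral_finsetSum' _ fun i _ => hm _ (hm' i), ← lintegral_add_left' (hm v hv)]
  refine lintegral_mono fun ξ => ?_
  rw [← Finset.mul_sum, ← mul_add, pow_succ, ENNReal.ofReal_mul (by positivity), mul_assoc]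
  gcongr
  have e : ∀ z : ℂ, ‖z‖ₑ ^ 2 = ENNReal.ofReal (‖z‖ ^ 2) := fun z => by
    rw [ENNReal.ofReal_pow (norm_nonneg _), ofReal_norm]
  simp only [e]
  rw [← ENNReal.ofReal_sum_of_nonneg (fun _ _ => by positivity), ← ENNReal.ofReal_mul (by positivity),
    ← ENNReal.ofReal_add (by positivity) (by positivity)]
  refine ENNReal.ofReal_le_ofReal ?_
  rw [add_mul, one_mul, EuclideanSpace.real_norm_sq_eq, Finset.sum_mul]
  refine add_le_add le_rfl (Finset.sum_le_sum fun i _ => ?_)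
  rw [norm_mul, mul_pow]
  refine mul_le_mul_of_nonneg_right ?_ (sq_nonneg _)
  simp only [norm_mul, Complex.norm_I, Complex.norm_real, RCLike.norm_ofNat, mul_one, Real.norm_eq_abs]
  rw [mul_pow, sq_abs]
  refine le_mul_of_one_le_left (sq_nonneg _) ?_
  rw [abs_of_pos Real.pi_pos]
  nlinarith [Real.pi_gt_three]

/-- The opposite comparison, from `ξᵢ² ≤ 1 + |ξ|²`: a symbol of order one costs one order of energy.
-/
theorem sobolevEnergy_mul_le (i : Fin n) (v : 𝔼 n → ℂ) :
    sobolevEnergy k (fun ξ => (2 * Real.pi * Complex.I * ξ i) * v ξ)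
      ≤ ENNReal.ofReal ((2 * Real.pi) ^ 2) * sobolevEnergy (k + 1) v := by
  rw [sobolevEnergy, sobolevEnergy, ← lintegral_const_mul' _ _ ENNReal.ofReal_ne_top]
  refine lintegral_mono fun ξ => ?_
  rw [pow_succ (1 + ‖ξ‖ ^ 2) k, enorm_mul, mul_pow, ← mul_assoc, ← mul_assoc]
  refine mul_le_mul' ?_ le_rfl
  have e : ∀ z : ℂ, ‖z‖ₑ ^ 2 = ENNReal.ofReal (‖z‖ ^ 2) := fun z => by
    rw [ENNReal.ofReal_pow (norm_nonneg _), ofReal_norm]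
  rw [e, ← ENNReal.ofReal_mul (by positivity), ← ENNReal.ofReal_mul (by positivity)]
  refine ENNReal.ofReal_le_ofReal ?_
  have h1 : ‖(2 * Real.pi * Complex.I * ξ i : ℂ)‖ ^ 2 = (2 * Real.pi) ^ 2 * (ξ i) ^ 2 := by
    simp only [norm_mul, Complex.norm_I, Complex.norm_real, RCLike.norm_ofNat, mul_one,
      Real.norm_eq_abs]
    rw [mul_pow, sq_abs, mul_pow, sq_abs, mul_pow]
  have h2 : (ξ i) ^ 2 ≤ ‖ξ‖ ^ 2 := by
    rw [EuclideanSpace.real_norm_sq_eq]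
    exact Finset.single_le_sum (f := fun i => (ξ i) ^ 2) (fun _ _ => sq_nonneg _)
      (Finset.mem_univ i)
  rw [h1]
  have : 0 ≤ (1 + ‖ξ‖ ^ 2) ^ k * (2 * Real.pi) ^ 2 := by positivity
  nlinarith

/-- The energy of the Fourier transform is controlled by the norm of `H^k`. -/
theorem exists_sobolevEnergy_le (n k : ℕ) : ∃ C : ℝ, 0 ≤ C ∧ ∀ f : H n k ℂ,
    sobolevEnergy k (𝓕 (H.toL2 f) : 𝕃 n ℂ) ≤ ENNReal.ofReal (C * ‖f‖ ^ 2) := by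
  induction k with
  | zero =>
    refine ⟨1, zero_le_one, fun f => ?_⟩
    rw [sobolevEnergy_zero, one_mul, ENNReal.ofReal_pow (norm_nonneg _), ← ofReal_norm,
      Lp.norm_fourier_eq]
    gcongr
    exact H.norm_toL2_le f
  | succ k ih =>
    obtain ⟨C, hC, ih⟩ := ih
    refine ⟨C * ‖H.incl n k ℂ‖ ^ 2 + ∑ i : Fin n, C * ‖H.pd (n := n) ℂ k i‖ ^ 2, by positivity, fun f => ?_⟩
    refine (sobolevEnergy_succ_le _ (Lp.memLp _).1).trans ?_
    rw [add_mul, Finset.sum_mul, ENNReal.ofReal_add (by positivity) (by positivity),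
      ENNReal.ofReal_sum_of_nonneg (fun _ _ => by positivity)]
    refine add_le_add ?_ (Finset.sum_le_sum fun i _ => ?_)
    · refine (ih (H.incl n k ℂ f)).trans (ENNReal.ofReal_le_ofReal ?_)
      rw [mul_assoc, ← mul_pow]
      gcongr
      exact (H.incl n k ℂ).le_opNorm f
    -- The function in this summand is the transform of `∂ᵢf ∈ H^k`, to which the induction
    -- hypothesis applies.
    · rw [← sobolevEnergy_congr (isWeakDeriv_iff_fourier.mp (H.isWeakDeriv_pd i f))]
      refine (ih (H.pd ℂ k i f)).trans (ENNReal.ofReal_le_ofReal ?_)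
      rw [mul_assoc, ← mul_pow]
      gcongr
      exact (H.pd ℂ k i).le_opNorm f

/-- A function whose Fourier transform has finite energy of order `k` is in `H^k`. -/
theorem exists_of_sobolevEnergy_lt_top (n k : ℕ) : ∃ C : ℝ, 0 ≤ C ∧ ∀ u : 𝕃 n ℂ, ∀ R : ℝ, 0 ≤ R →
    sobolevEnergy k (𝓕 u : 𝕃 n ℂ) ≤ ENNReal.ofReal (R ^ 2) →
    ∃ U : H n k ℂ, H.toL2 U = u ∧ ‖U‖ ≤ C * R := by
  have hbase : ∀ u : 𝕃 n ℂ, ∀ R : ℝ, 0 ≤ R →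
      sobolevEnergy 0 (𝓕 u : 𝕃 n ℂ) ≤ ENNReal.ofReal (R ^ 2) → ‖u‖ ≤ R := by
    intro u R hR h
    rw [sobolevEnergy_zero, ← ofReal_norm, Lp.norm_fourier_eq,
      ← ENNReal.ofReal_pow (norm_nonneg _), ENNReal.ofReal_le_ofReal_iff (by positivity)] at h
    exact le_of_sq_le_sq h hR
  induction k with
  | zero =>
    refine ⟨H.numJet n 0, by positivity, fun u R hR h => ⟨H.ofL2 n ℂ u, rfl, ?_⟩⟩
    refine (H.norm_zero_le _).trans ?_
    gcongr
    exact hbase u R hR h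
  | succ k ih =>
    obtain ⟨C, hC, ih⟩ := ih
    refine ⟨H.numJet n (k + 1) * (1 + ∑ _i : Fin n, C * (2 * Real.pi)), by positivity,
      fun u R hR h => ?_⟩
    have hu : ‖u‖ ≤ R := hbase u R hR ((sobolevEnergy_mono (Nat.zero_le _) _).trans h)
    have hg : ∀ i : Fin n, ∃ g : H n k ℂ, IsWeakDeriv (fun _ : Fin 1 => i) u g ∧
        ‖g‖ ≤ C * (2 * Real.pi) * R := by
      intro i
      have hE : sobolevEnergy k (fun ξ => (2 * Real.pi * Complex.I * ξ i) * (𝓕 u : 𝕃 n ℂ) ξ)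
          ≤ ENNReal.ofReal ((2 * Real.pi * R) ^ 2) := by
        refine (sobolevEnergy_mul_le i _).trans ?_
        rw [mul_pow (2 * Real.pi) R, ENNReal.ofReal_mul (by positivity)]
        exact mul_le_mul' le_rfl h
      have hmem : MemLp (fun ξ : 𝔼 n => (2 * Real.pi * Complex.I * ξ i) * (𝓕 u : 𝕃 n ℂ) ξ) 2
          volume := by
        refine ⟨(by fun_prop : Continuous fun ξ : 𝔼 n =>
          (2 * Real.pi * Complex.I * ξ i : ℂ)).aestronglyMeasurable.mul (Lp.memLp _).1, ?_⟩
        rw [eLpNorm_lt_top_iff_lintegral_rpow_enorm_lt_top (by norm_num) (by norm_num)]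
        refine lt_of_le_of_lt ?_
          (((sobolevEnergy_mono (Nat.zero_le k) _).trans hE).trans_lt ENNReal.ofReal_lt_top)
        simp [sobolevEnergy]
      -- The candidate for the weak derivative `∂ᵢu` is the inverse transform of `2πi ξᵢ û`, and by
      -- induction it lies in `H^k`.
      let w : 𝕃 n ℂ := hmem.toLp _
      have hw : 𝓕 (𝓕⁻ w : 𝕃 n ℂ) = w := FourierTransform.fourier_fourierInv_eq _
      obtain ⟨g, hg, hgn⟩ := ih (𝓕⁻ w : 𝕃 n ℂ) (2 * Real.pi * R) (by positivity) (by
        rw [hw, sobolevEnergy_congr hmem.coeFn_toLp]; exact hE)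
      refine ⟨g, ?_, by rw [mul_assoc]; exact hgn⟩
      rw [isWeakDeriv_iff_fourier, hg, hw]
      exact hmem.coeFn_toLp
    choose g hg hgn using hg
    obtain ⟨U, hU, hUg⟩ := H.exists_of_isWeakDeriv u g hg
    refine ⟨U, hU, (H.norm_succ_le U).trans ?_⟩
    rw [mul_assoc]
    gcongr
    rw [add_mul, one_mul, Finset.sum_mul, hU]
    gcongr with i
    rw [hUg]
    exact hgn i

end FourierSide

/-! ### Density of Schwartz functions in `H^k`. -/

section Density

open scoped ENNReal

variable {n k : ℕ}

/-- With the weight absorbed into the function, the energy is a squared `L²` norm, so that density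
of Schwartz functions in `L²` becomes usable. -/
theorem sobolevEnergy_eq_lintegral_rpow (v : 𝔼 n → ℂ) :
    sobolevEnergy k v
      = ∫⁻ ξ, ‖((1 + ‖ξ‖ ^ 2) ^ ((k : ℝ) / 2) : ℝ) • v ξ‖ₑ ^ (2 : ℝ) := by
  refine lintegral_congr fun ξ => ?_
  rw [enorm_smul, ENNReal.mul_rpow_of_nonneg _ _ (by norm_num), ← ENNReal.rpow_natCast ‖v ξ‖ₑ 2]
  congr 1
  rw [Real.enorm_of_nonneg (by positivity), ENNReal.ofReal_rpow_of_nonneg (by positivity)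
    (by norm_num), ← Real.rpow_mul (by positivity), div_mul_cancel₀ _ (by norm_num),
    Real.rpow_natCast]

/-- Schwartz functions are dense in `H^k(ℝⁿ; ℂ)`. -/
theorem H.exists_schwartz_complex (f : H n k ℂ) {ε : ℝ} (hε : 0 < ε) :
    ∃ (h : H n k ℂ) (p : 𝓢(𝔼 n, ℂ)), (h : 𝔼 n → ℂ) =ᵐ[volume] p ∧ ‖f - h‖ < ε := by
  obtain ⟨C, hC, hex⟩ := exists_of_sobolevEnergy_lt_top n k
  obtain ⟨C', -, hle⟩ := exists_sobolevEnergy_le n k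
  let J : 𝔼 n → ℝ := fun ξ => (1 + ‖ξ‖ ^ 2) ^ ((k : ℝ) / 2)
  let J' : 𝔼 n → ℝ := fun ξ => (1 + ‖ξ‖ ^ 2) ^ (-((k : ℝ) / 2))
  have hJJ' : ∀ ξ, J ξ * J' ξ = 1 := fun ξ => by
    simp only [J, J']
    rw [← Real.rpow_add (by positivity), add_neg_cancel, Real.rpow_zero]
  have hJ : J.HasTemperateGrowth := Function.hasTemperateGrowth_one_add_norm_sq_rpow (𝔼 n) _
  have hJ' : J'.HasTemperateGrowth := Function.hasTemperateGrowth_one_add_norm_sq_rpow (𝔼 n) _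
  have hJ'C : (fun ξ => (J' ξ : ℂ)).HasTemperateGrowth := by fun_prop
  have hw : MemLp (fun ξ => J ξ • (𝓕 (toL2 f) : 𝕃 n ℂ) ξ) 2 volume := by
    refine ⟨hJ.1.continuous.aestronglyMeasurable.smul (Lp.memLp _).1, ?_⟩
    rw [eLpNorm_lt_top_iff_lintegral_rpow_enorm_lt_top (by norm_num) (by norm_num)]
    have := (hle f).trans_lt ENNReal.ofReal_lt_top
    rwa [sobolevEnergy_eq_lintegral_rpow] at this
  set δ : ℝ := ε / (C + 1) with hδ
  have hδ0 : 0 < δ := by positivity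
  -- Approximate the weighted transform `J f̂` in `L²` and then divide by `J`: multiplication by `J'
  -- = 1/J` preserves the Schwartz class. The tolerance `ε / (C + 1)` beats the constant `C` lost on
  -- returning to the `H^k` norm.
  obtain ⟨p, hp⟩ := (SchwartzMap.denseRange_toLpCLM (F := ℂ) (E := 𝔼 n) (μ := volume)
    (p := 2) ENNReal.ofNat_ne_top).exists_dist_lt (hw.toLp _) hδ0
  let v : 𝓢(𝔼 n, ℂ) := SchwartzMap.smulLeftCLM ℂ (fun ξ => (J' ξ : ℂ)) p
  have hv : ∀ ξ, v ξ = (J' ξ : ℂ) * p ξ := fun ξ => by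
    simp only [v, SchwartzMap.smulLeftCLM_apply_apply hJ'C, smul_eq_mul]
  let u : 𝕃 n ℂ := toL2 f - (𝓕⁻ v : 𝓢(𝔼 n, ℂ)).toLp 2 volume
  have hu : (𝓕 u : 𝕃 n ℂ) = 𝓕 (toL2 f) - v.toLp 2 volume := by
    have e := SchwartzMap.toLp_fourier_eq (𝓕⁻ v : 𝓢(𝔼 n, ℂ))
    rw [FourierTransform.fourier_fourierInv_eq] at e
    rw [← e]
    exact map_sub (Lp.fourierTransformₗᵢ (𝔼 n) ℂ) _ _
  have hE : sobolevEnergy k (𝓕 u : 𝕃 n ℂ) ≤ ENNReal.ofReal (δ ^ 2) := by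
    have h1 : sobolevEnergy k (𝓕 u : 𝕃 n ℂ) = ‖hw.toLp _ - p.toLp 2 volume‖ₑ ^ 2 := by
      rw [← sobolevEnergy_zero, sobolevEnergy_eq_lintegral_rpow, sobolevEnergy_eq_lintegral_rpow]
      refine lintegral_congr_ae ?_
      filter_upwards [Lp.coeFn_sub (𝓕 (toL2 f) : 𝕃 n ℂ) (v.toLp 2 volume),
        Lp.coeFn_sub (hw.toLp _) (p.toLp 2 volume), hw.coeFn_toLp, p.coeFn_toLp 2 volume,
        v.coeFn_toLp 2 volume] with ξ e1 e2 e3 e4 e5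
      rw [hu, e1, e2, Pi.sub_apply, Pi.sub_apply, e3, e4, e5, hv]
      congr 2
      have := hJJ' ξ
      change (J ξ) • _ = _
      simp only [Nat.cast_zero, zero_div, Real.rpow_zero, one_smul, smul_sub]
      congr 1
      rw [Complex.real_smul, ← mul_assoc, ← Complex.ofReal_mul, this, Complex.ofReal_one, one_mul]
    rw [h1, ← ofReal_norm, ENNReal.ofReal_pow hδ0.le]
    gcongr
    rw [dist_eq_norm] at hp
    exact hp.le
  obtain ⟨U, hU, hUn⟩ := hex u δ hδ0.le hE
  refine ⟨f - U, 𝓕⁻ v, ?_, ?_⟩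
  · have : toL2 (f - U) = (𝓕⁻ v : 𝓢(𝔼 n, ℂ)).toLp 2 volume := by
      rw [map_sub, hU, sub_sub_cancel]
    rw [this]
    exact SchwartzMap.coeFn_toLp _ _ _
  · rw [sub_sub_cancel]
    refine hUn.trans_lt ?_
    rw [hδ, mul_div_assoc', div_lt_iff₀ (by positivity)]
    nlinarith

variable {V : Type*} [NormedAddCommGroup V] [NormedSpace ℝ V] [FiniteDimensional ℝ V]
  [CompleteSpace V]

variable (V) in
/-- The coordinates of a finite-dimensional space, as complex numbers. -/
def coordC (i : Fin (Module.finrank ℝ V)) : V →L[ℝ] ℂ :=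
  Complex.ofRealCLM ∘L LinearMap.toContinuousLinearMap ((Module.finBasis ℝ V).coord i)

variable (V) in
/-- The embedding of a coordinate axis. -/
def axisC (i : Fin (Module.finrank ℝ V)) : ℂ →L[ℝ] V :=
  (ContinuousLinearMap.toSpanSingleton ℝ (Module.finBasis ℝ V i)) ∘L Complex.reCLM

theorem sum_axisC_coordC (v : V) : ∑ i, axisC V i (coordC V i v) = v := by
  conv_rhs => rw [← (Module.finBasis ℝ V).sum_repr v]
  refine Finset.sum_congr rfl fun i _ => ?_
  simp [axisC, coordC]

theorem axisC_smul_coordC (c : ℝ) (i : Fin (Module.finrank ℝ V)) (v : V) :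
    axisC V i (c * coordC V i v) = c • axisC V i (coordC V i v) := by
  rw [← map_smul, Complex.real_smul]

theorem H.coeFn_finset_sum {ι : Type*} (t : Finset ι) (f : ι → H n k V) :
    ((∑ i ∈ t, f i : H n k V) : 𝔼 n → V) =ᵐ[volume] fun x => ∑ i ∈ t, f i x := by
  rw [map_sum]
  exact Lp.coeFn_fun_finsetSum t fun i => H.toL2 (f i)

/-- Decomposition into complex coordinate functions, which carries results for `ℂ`-valued functions
over to `V`-valued ones. -/
theorem H.sum_mapL_mapL (f : H n k V) :
    ∑ i, H.mapL n k (axisC V i) (H.mapL n k (coordC V i) f) = f := by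
  refine H.ext_ae ((H.coeFn_finset_sum _ _).trans ?_)
  have h1 : ∀ᵐ x, ∀ i, H.mapL n k (axisC V i) (H.mapL n k (coordC V i) f) x
      = axisC V i (H.mapL n k (coordC V i) f x) := ae_all_iff.mpr fun i => H.coeFn_mapL _ _
  have h2 : ∀ᵐ x, ∀ i, H.mapL n k (coordC V i) f x = coordC V i (f x) :=
    ae_all_iff.mpr fun i => H.coeFn_mapL _ _
  filter_upwards [h1, h2] with x e1 e2
  simp only [e1, e2, sum_axisC_coordC]

/-- Schwartz functions are dense in `H^k(ℝⁿ; V)`. -/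
theorem H.exists_schwartz (f : H n k V) {ε : ℝ} (hε : 0 < ε) :
    ∃ (h : H n k V) (p : 𝓢(𝔼 n, V)), (h : 𝔼 n → V) =ᵐ[volume] p ∧ ‖f - h‖ < ε := by
  set M : ℝ := ∑ i, ‖H.mapL n k (axisC V i)‖ with hM
  have hM0 : 0 ≤ M := Finset.sum_nonneg fun _ _ => norm_nonneg _
  have hδ : 0 < ε / (M + 1) := by positivity
  choose h p hp hn using fun i => H.exists_schwartz_complex (H.mapL n k (coordC V i) f) hδ
  refine ⟨∑ i, H.mapL n k (axisC V i) (h i),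
    ∑ i, SchwartzMap.postcompCLM (axisC V i) (p i), ?_, ?_⟩
  · refine (H.coeFn_finset_sum _ _).trans ?_
    have h1 : ∀ᵐ x, ∀ i, H.mapL n k (axisC V i) (h i) x = axisC V i (h i x) :=
      ae_all_iff.mpr fun i => H.coeFn_mapL _ _
    have h2 : ∀ᵐ x, ∀ i, h i x = p i x := ae_all_iff.mpr hp
    filter_upwards [h1, h2] with x e1 e2
    simp [e1, e2]
  · nth_rewrite 1 [← H.sum_mapL_mapL f]
    rw [← Finset.sum_sub_distrib]
    calc ‖∑ i, (H.mapL n k (axisC V i) (H.mapL n k (coordC V i) f) - H.mapL n k (axisC V i) (h i))‖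
        ≤ ∑ i, ‖H.mapL n k (axisC V i)‖ * (ε / (M + 1)) := by
          refine norm_sum_le_of_le _ fun i _ => ?_
          rw [← map_sub]
          refine (ContinuousLinearMap.le_opNorm _ _).trans ?_
          gcongr
          exact (hn i).le
      _ = M * (ε / (M + 1)) := by rw [← Finset.sum_mul]
      _ < ε := by
        rw [mul_div_assoc', div_lt_iff₀ (by positivity)]
        nlinarith

end Density

/-! ### Integrability of the weight and the uniform kernel bound. -/

section Kernel

open scoped ENNReal

/-- Rescaling `t` by `Y` turns the integrand into the Cauchy density, of total mass `π`. What
matters is that the bound does not depend on `Y`; for `Y = 0` the integrand vanishes. -/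
theorem lintegral_div_sq_add_sq_le (Y : ℝ) (hY : 0 ≤ Y) :
    ∫⁻ t : ℝ, ENNReal.ofReal (Y / (t ^ 2 + Y ^ 2)) ≤ ENNReal.ofReal Real.pi := by
  rcases hY.eq_or_lt with rfl | hY
  · simp
  have e : ∀ t : ℝ, Y / (t ^ 2 + Y ^ 2) = Y⁻¹ * (1 + (Y⁻¹ * t) ^ 2)⁻¹ := fun t => by
    field_simp
    ring
  simp only [e]
  rw [← ofReal_integral_eq_lintegral_ofReal
    ((integrable_inv_one_add_sq.comp_mul_left' (inv_ne_zero hY.ne')).const_mul _)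
    (Filter.Eventually.of_forall fun t => by positivity), integral_const_mul,
    Measure.integral_comp_mul_left (fun x => (1 + x ^ 2)⁻¹), integral_univ_inv_one_add_sq]
  refine ENNReal.ofReal_le_ofReal (le_of_eq ?_)
  rw [inv_inv, abs_of_pos hY, smul_eq_mul, ← mul_assoc, inv_mul_cancel₀ hY.ne', one_mul]

/-- The reciprocal of the low frequency weight is integrable. -/
theorem lintegral_low_lt_top (d : ℕ) [NeZero d] :
    ∫⁻ ζ in Metric.ball (0 : 𝔼 d) 1, ENNReal.ofReal (‖ζ‖ ^ 2 / ((ζ 0) ^ 2 + ‖ζ‖ ^ 4)) < ⊤ := by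
  obtain ⟨m, rfl⟩ : ∃ m, d = m + 1 := ⟨d - 1, (Nat.succ_pred_eq_of_ne_zero (NeZero.ne d)).symm⟩
  let B : Set (Fin m → ℝ) := Set.Icc (-1) 1
  -- Writing `ζ = (t, y)` and `Y = |y|²`, the integrand is at most `1 + Y/(t² + Y²)`. Integrating in
  -- `t` first gives a bound uniform in `y`, and `y` stays in a cube. No restriction on the
  -- dimension arises; for `m = 0` the variable `y` is trivial.
  let G : ℝ × (Fin m → ℝ) → ℝ≥0∞ := fun p =>
    B.indicator (fun y => (Set.Icc (-1 : ℝ) 1).indicator 1 p.1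
      + ENNReal.ofReal ((∑ i, y i ^ 2) / (p.1 ^ 2 + (∑ i, y i ^ 2) ^ 2))) p.2
  let e : 𝔼 (m + 1) → ℝ × (Fin m → ℝ) := fun ζ => (ζ 0, fun i => ζ i.succ)
  have he : MeasurePreserving e volume volume := by
    have h1 := EuclideanSpace.volume_preserving_symm_measurableEquiv_toLp (Fin (m + 1))
    have h2 := volume_preserving_piFinSuccAbove (fun _ : Fin (m + 1) => ℝ) 0
    exact h2.comp h1
  have hGm : Measurable G := by
    have h1 : Measurable fun p : ℝ × (Fin m → ℝ) => (Set.Icc (-1 : ℝ) 1).indicator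
        (1 : ℝ → ℝ≥0∞) p.1 :=
      (measurable_one.indicator measurableSet_Icc).comp measurable_fst
    have h2 : Measurable fun p : ℝ × (Fin m → ℝ) =>
        ENNReal.ofReal ((∑ i, p.2 i ^ 2) / (p.1 ^ 2 + (∑ i, p.2 i ^ 2) ^ 2)) := by fun_prop
    have h3 : MeasurableSet {p : ℝ × (Fin m → ℝ) | p.2 ∈ B} := measurable_snd measurableSet_Icc
    exact (h1.add h2).indicator h3
  have hle : ∀ ζ ∈ Metric.ball (0 : 𝔼 (m + 1)) 1,
      ENNReal.ofReal (‖ζ‖ ^ 2 / ((ζ 0) ^ 2 + ‖ζ‖ ^ 4)) ≤ G (e ζ) := by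
    intro ζ hζ
    rw [mem_ball_zero_iff] at hζ
    have hi : ∀ i, |ζ i| ≤ 1 := fun i => (PiLp.norm_apply_le ζ i).trans hζ.le
    have hB : (fun i : Fin m => ζ i.succ) ∈ B :=
      ⟨fun i => (abs_le.mp (hi _)).1, fun i => (abs_le.mp (hi _)).2⟩
    simp only [G, e]
    rw [Set.indicator_of_mem hB, Set.indicator_of_mem (Set.mem_Icc.mpr (abs_le.mp (hi 0))),
      Pi.one_apply, ← ENNReal.ofReal_one, ← ENNReal.ofReal_add zero_le_one (by positivity)]
    refine ENNReal.ofReal_le_ofReal ?_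
    have hn : ‖ζ‖ ^ 2 = ζ 0 ^ 2 + ∑ i : Fin m, ζ i.succ ^ 2 := by
      rw [EuclideanSpace.real_norm_sq_eq, Fin.sum_univ_succ]
    have h4 : ‖ζ‖ ^ 4 = (‖ζ‖ ^ 2) ^ 2 := by ring
    rw [h4, hn]
    have hY : 0 ≤ ∑ i : Fin m, ζ i.succ ^ 2 := Finset.sum_nonneg fun _ _ => sq_nonneg _
    generalize ∑ i : Fin m, ζ i.succ ^ 2 = Y at hY
    generalize ζ 0 = t
    rcases eq_or_ne t 0 with rfl | ht
    · simp only [ne_eq, OfNat.ofNat_ne_zero, not_false_eq_true, zero_pow, zero_add]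
      linarith
    · have ht2 : 0 < t ^ 2 := by positivity
      rw [add_div]
      refine add_le_add ?_ ?_
      · rw [div_le_one (by positivity)]
        nlinarith [sq_nonneg (t ^ 2 + Y)]
      · refine div_le_div_of_nonneg_left hY (by positivity) ?_
        gcongr
        linarith
  calc ∫⁻ ζ in Metric.ball (0 : 𝔼 (m + 1)) 1, ENNReal.ofReal (‖ζ‖ ^ 2 / ((ζ 0) ^ 2 + ‖ζ‖ ^ 4))
      ≤ ∫⁻ ζ in Metric.ball (0 : 𝔼 (m + 1)) 1, G (e ζ) :=
        setLIntegral_mono (hGm.comp he.measurable) hle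
    _ ≤ ∫⁻ ζ, G (e ζ) := setLIntegral_le_lintegral _ _
    _ = ∫⁻ p, G p := he.lintegral_comp hGm
    _ = ∫⁻ y, ∫⁻ t, G (t, y) := by
        rw [Measure.volume_eq_prod]
        exact lintegral_prod_symm' _ hGm
    _ ≤ ∫⁻ y, B.indicator (fun _ => 2 + ENNReal.ofReal Real.pi) y := by
        refine lintegral_mono fun y => ?_
        simp only [G]
        by_cases hy : y ∈ B
        · simp only [Set.indicator_of_mem hy]
          rw [lintegral_add_left (measurable_one.indicator measurableSet_Icc)]
          refine add_le_add ?_ (lintegral_div_sq_add_sq_le _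
            (Finset.sum_nonneg fun _ _ => sq_nonneg _))
          rw [lintegral_indicator_one measurableSet_Icc, Real.volume_Icc]
          norm_num
        · simp [Set.indicator_of_notMem hy]
    _ = (2 + ENNReal.ofReal Real.pi) * volume B := by
        rw [lintegral_indicator measurableSet_Icc, setLIntegral_const]
    _ < ⊤ := ENNReal.mul_lt_top (by simp) isCompact_Icc.measure_lt_top

variable {d : ℕ}

/-- The embedding `ζ ↦ (ζ, 0)` of `ℝᵈ` into `ℝ^{d+1}`. -/
def horizontalEmb (ζ : 𝔼 d) : 𝔼 (d + 1) := WithLp.toLp 2 (Fin.snoc (fun i => ζ i) (0 : ℝ))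

@[simp] theorem horizontal_apply (x : 𝔼 (d + 1)) (i : Fin d) : horizontal x i = x i.castSucc := rfl

@[simp] theorem horizontalEmb_castSucc (ζ : 𝔼 d) (i : Fin d) :
    horizontalEmb ζ i.castSucc = ζ i := by simp [horizontalEmb]

@[simp] theorem horizontalEmb_last (ζ : 𝔼 d) : horizontalEmb ζ (Fin.last d) = 0 := by
  simp [horizontalEmb]

theorem continuous_horizontalEmb : Continuous (horizontalEmb : 𝔼 d → 𝔼 (d + 1)) := by
  refine (PiLp.continuous_toLp 2 _).comp (continuous_pi fun i => ?_)
  refine Fin.lastCases ?_ (fun i => ?_) i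
  · simp only [Fin.snoc_last]; exact continuous_const
  · simp only [Fin.snoc_castSucc]; fun_prop

variable (d) in
/-- `x ↦ x'` as a continuous linear map. -/
def horizontalL : 𝔼 (d + 1) →L[ℝ] 𝔼 d :=
  LinearMap.toContinuousLinearMap
    { toFun := horizontal
      map_add' := fun _ _ => rfl
      map_smul' := fun _ _ => rfl }

@[simp] theorem horizontalL_apply (x : 𝔼 (d + 1)) : horizontalL d x = horizontal x := rfl

theorem continuous_horizontal : Continuous (horizontal : 𝔼 (d + 1) → 𝔼 d) :=
  (horizontalL d).continuous

theorem inner_horizontalEmb (ζ : 𝔼 d) (x : 𝔼 (d + 1)) :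
    inner ℝ (horizontalEmb ζ) x = inner ℝ ζ (horizontal x) := by
  rw [PiLp.inner_apply, PiLp.inner_apply, Fin.sum_univ_castSucc]
  simp

theorem norm_horizontalEmb (ζ : 𝔼 d) : ‖horizontalEmb ζ‖ = ‖ζ‖ := by
  rw [EuclideanSpace.norm_eq, EuclideanSpace.norm_eq, Fin.sum_univ_castSucc]
  simp

theorem norm_horizontal_le (x : 𝔼 (d + 1)) : ‖horizontal x‖ ≤ ‖x‖ := by
  rw [EuclideanSpace.norm_eq, EuclideanSpace.norm_eq, Fin.sum_univ_castSucc]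
  refine Real.sqrt_le_sqrt ?_
  simp only [horizontal_apply]
  linarith [sq_nonneg ‖x (Fin.last d)‖]

theorem horizontal_sub_horizontalEmb (x : 𝔼 (d + 1)) (ζ : 𝔼 d) :
    horizontal (x - horizontalEmb ζ) = horizontal x - ζ := by
  ext i
  simp

variable [NeZero d]

/-- For `|ζ| < 1` the quotient `A/D` is at most `4`, and the reciprocal low frequency weight
remains. For `|ζ| ≥ 1` the weight contributes `B^{-r}` with `r ≥ k`. If `B ≤ D`, then again `A/D ≤
4`. If `D ≤ B`, then `A ≤ 4B`, and the leftover `B^{-(r-k)}` is traded for `D^{-(r-k)}`, producing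
`D^{-r}`. Passing from `D` to its horizontal part `D'` gives a function of `ξ' - ζ`, whose integral
in `ζ` is independent of `ξ`. -/
theorem kernel_le {s k p : ℕ} (hkp : k + p ≤ s) (ξ : 𝔼 (d + 1)) (ζ : 𝔼 d) :
    ‖ζ‖ ^ (2 * p) / weight (s + 1 / 2 : ℝ) ζ
        * ((1 + ‖ξ‖ ^ 2) ^ k / (1 + ‖ξ - horizontalEmb ζ‖ ^ 2) ^ k)
      ≤ 4 ^ k * ((Metric.ball (0 : 𝔼 d) 1).indicator
          (fun ζ => ‖ζ‖ ^ 2 / ((ζ 0) ^ 2 + ‖ζ‖ ^ 4)) ζ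
        + ((1 + ‖ζ‖ ^ 2) ^ (-(s + 1 / 2 - p : ℝ))
          + (1 + ‖horizontal ξ - ζ‖ ^ 2) ^ (-(s + 1 / 2 - p : ℝ)))) := by
  set A := 1 + ‖ξ‖ ^ 2
  set D := 1 + ‖ξ - horizontalEmb ζ‖ ^ 2 with hD
  set B := 1 + ‖ζ‖ ^ 2 with hB
  set D' := 1 + ‖horizontal ξ - ζ‖ ^ 2
  set r : ℝ := s + 1 / 2 - p with hr
  have hkr : (k : ℝ) ≤ r := by
    have : (k : ℝ) + p ≤ s := by exact_mod_cast hkp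
    rw [hr]; linarith
  have hr0 : 0 ≤ r := (Nat.cast_nonneg k).trans hkr
  have hA0 : 0 < A := by positivity
  have hD1 : 1 ≤ D := by simp only [hD]; linarith [sq_nonneg ‖ξ - horizontalEmb ζ‖]
  have hB1 : 1 ≤ B := by simp only [hB]; linarith [sq_nonneg ‖ζ‖]
  have hD0 : 0 < D := by linarith
  have hB0 : 0 < B := by linarith
  have hDD' : D' ≤ D := by
    have := norm_horizontal_le (ξ - horizontalEmb ζ)
    rw [horizontal_sub_horizontalEmb] at this
    simp only [D, D']
    gcongr
  have hD'0 : 0 < D' := by positivity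
  have hABD : A ≤ 2 * (B + D) := by
    have h1 : ‖ξ‖ ≤ ‖ξ - horizontalEmb ζ‖ + ‖ζ‖ := by
      rw [← norm_horizontalEmb ζ]
      simpa using norm_add_le (ξ - horizontalEmb ζ) (horizontalEmb ζ)
    have h2 : ‖ξ‖ ^ 2 ≤ (‖ξ - horizontalEmb ζ‖ + ‖ζ‖) ^ 2 := by gcongr
    simp only [A, B, D]
    nlinarith [sq_nonneg (‖ξ - horizontalEmb ζ‖ - ‖ζ‖)]
  have hpos1 : 0 ≤ B ^ (-r) := by positivity
  have hpos2 : 0 ≤ D' ^ (-r) := by positivity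
  have h4 : (0 : ℝ) ≤ 4 ^ k := by positivity
  by_cases hζ : ‖ζ‖ < 1
  · rw [Set.indicator_of_mem (mem_ball_zero_iff.mpr hζ)]
    have hw : ‖ζ‖ ^ (2 * p) / weight (s + 1 / 2 : ℝ) ζ ≤ ‖ζ‖ ^ 2 / ((ζ 0) ^ 2 + ‖ζ‖ ^ 4) := by
      rw [weight, if_pos hζ, div_div_eq_mul_div]
      refine div_le_div_of_nonneg_right ?_ (by positivity)
      exact mul_le_of_le_one_left (by positivity) (pow_le_one₀ (norm_nonneg _) hζ.le)
    have hAD : A / D ≤ 4 := by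
      rw [div_le_iff₀ hD0]
      have : ‖ζ‖ ^ 2 ≤ 1 := pow_le_one₀ (norm_nonneg _) hζ.le
      have hB2 : B ≤ 2 := by simp only [hB]; linarith
      have : A ≤ 2 + 2 * D := by
        have h1 : ‖ξ‖ ≤ ‖ξ - horizontalEmb ζ‖ + ‖ζ‖ := by
          rw [← norm_horizontalEmb ζ]
          simpa using norm_add_le (ξ - horizontalEmb ζ) (horizontalEmb ζ)
        have h2 : ‖ξ‖ ^ 2 ≤ (‖ξ - horizontalEmb ζ‖ + ‖ζ‖) ^ 2 := by gcongr
        simp only [A, D]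
        nlinarith [sq_nonneg (‖ξ - horizontalEmb ζ‖ - ‖ζ‖)]
      linarith
    have hq : 0 ≤ ‖ζ‖ ^ 2 / ((ζ 0) ^ 2 + ‖ζ‖ ^ 4) := by positivity
    rw [← div_pow]
    calc _ ≤ ‖ζ‖ ^ 2 / ((ζ 0) ^ 2 + ‖ζ‖ ^ 4) * 4 ^ k := by gcongr
      _ = 4 ^ k * (‖ζ‖ ^ 2 / ((ζ 0) ^ 2 + ‖ζ‖ ^ 4)) := mul_comm _ _
      _ ≤ _ := mul_le_mul_of_nonneg_left (by linarith) h4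
  · rw [Set.indicator_of_notMem (by simpa using hζ), zero_add]
    have hw : ‖ζ‖ ^ (2 * p) / weight (s + 1 / 2 : ℝ) ζ ≤ B ^ (-r) := by
      rw [weight, if_neg hζ, div_le_iff₀ (by positivity), ← Real.rpow_add hB0, hr,
        show (-(s + 1 / 2 - p) + (s + 1 / 2) : ℝ) = p by ring, Real.rpow_natCast, pow_mul]
      gcongr
      simp only [hB]; linarith
    have hw0 : 0 ≤ A ^ k / D ^ k := by positivity
    refine (mul_le_mul_of_nonneg_right hw hw0).trans ?_
    rcases le_total B D with hBD | hDB
    · have : A ^ k / D ^ k ≤ 4 ^ k := by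
        rw [← div_pow]
        gcongr
        rw [div_le_iff₀ hD0]; linarith
      calc B ^ (-r) * (A ^ k / D ^ k) ≤ B ^ (-r) * 4 ^ k := by gcongr
        _ = 4 ^ k * B ^ (-r) := mul_comm _ _
        _ ≤ _ := mul_le_mul_of_nonneg_left (by linarith) h4
    · have hAB : A ^ k ≤ 4 ^ k * B ^ k := by
        rw [← mul_pow]
        gcongr
        linarith
      have e1 : B ^ (-r) * B ^ k = B ^ (-(r - k)) := by
        rw [← Real.rpow_natCast B k, ← Real.rpow_add hB0]; congr 1; ring
      have e2 : D ^ (-(r - k)) / D ^ k = D ^ (-r) := by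
        rw [← Real.rpow_natCast D k, ← Real.rpow_sub hD0]; congr 1; ring
      calc B ^ (-r) * (A ^ k / D ^ k) ≤ B ^ (-r) * (4 ^ k * B ^ k / D ^ k) := by gcongr
        _ = 4 ^ k * (B ^ (-r) * B ^ k / D ^ k) := by ring
        _ ≤ 4 ^ k * (D ^ (-(r - k)) / D ^ k) := by
            rw [e1]
            gcongr 4 ^ k * (?_ / D ^ k)
            exact Real.rpow_le_rpow_of_nonpos hD0 hDB (by linarith)
        _ = 4 ^ k * D ^ (-r) := by rw [e2]
        _ ≤ 4 ^ k * D' ^ (-r) := by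
            gcongr 4 ^ k * ?_
            exact Real.rpow_le_rpow_of_nonpos hD'0 hDD' (by linarith)
        _ ≤ _ := mul_le_mul_of_nonneg_left (by linarith) h4

theorem measurable_weight (σ : ℝ) : Measurable (weight σ : 𝔼 d → ℝ) := by
  unfold weight
  refine Measurable.ite (measurableSet_lt measurable_norm measurable_const) ?_ ?_ <;> fun_prop

/-- The uniform integral bound behind the multiplication estimates. -/
theorem exists_lintegral_kernel_le {s : ℕ} (hs : ((d + 1 : ℕ) : ℝ) / 2 < s) {k p : ℕ} (hp : p ≤ 1)
    (hkp : k + p ≤ s) : ∃ C : ℝ, 0 ≤ C ∧ ∀ ξ : 𝔼 (d + 1),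
      ∫⁻ ζ : 𝔼 d, ENNReal.ofReal (‖ζ‖ ^ (2 * p) / weight (s + 1 / 2 : ℝ) ζ)
        * ENNReal.ofReal ((1 + ‖ξ‖ ^ 2) ^ k / (1 + ‖ξ - horizontalEmb ζ‖ ^ 2) ^ k)
      ≤ ENNReal.ofReal C := by
  set r : ℝ := s + 1 / 2 - p with hr
  have hint : ∫⁻ ζ : 𝔼 d, ENNReal.ofReal ((1 + ‖ζ‖ ^ 2) ^ (-r)) < ⊤ := by
    -- Here `s > n/2` enters: `2r = 2s + 1 - 2p ≥ 2s - 1 > d`.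
    have h : (Module.finrank ℝ (𝔼 d) : ℝ) < 2 * r := by
      rw [finrank_euclideanSpace_fin, hr]
      have : (p : ℝ) ≤ 1 := by exact_mod_cast hp
      push_cast at hs
      linarith
    have h2 := (integrable_rpow_neg_one_add_norm_sq (μ := (volume : Measure (𝔼 d))) h).lintegral_lt_top
    have e : -(2 * r) / 2 = -r := by ring
    rwa [e] at h2
  set I₁ := ∫⁻ ζ : 𝔼 d, ENNReal.ofReal ((1 + ‖ζ‖ ^ 2) ^ (-r)) with hI₁
  set I₀ := ∫⁻ ζ in Metric.ball (0 : 𝔼 d) 1, ENNReal.ofReal (‖ζ‖ ^ 2 / ((ζ 0) ^ 2 + ‖ζ‖ ^ 4))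
    with hI₀
  have htop : ENNReal.ofReal (4 ^ k) * (I₀ + (I₁ + I₁)) ≠ ⊤ :=
    ENNReal.mul_ne_top ENNReal.ofReal_ne_top (ENNReal.add_ne_top.mpr
      ⟨(lintegral_low_lt_top d).ne, ENNReal.add_ne_top.mpr ⟨hint.ne, hint.ne⟩⟩)
  refine ⟨(ENNReal.ofReal (4 ^ k) * (I₀ + (I₁ + I₁))).toReal, ENNReal.toReal_nonneg, fun ξ => ?_⟩
  rw [ENNReal.ofReal_toReal htop]
  have hm : Measurable fun ζ : 𝔼 d => (1 + ‖ζ‖ ^ 2) ^ (-r) := by fun_prop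
  have hm0 : Measurable fun ζ : 𝔼 d => ‖ζ‖ ^ 2 / ((ζ 0) ^ 2 + ‖ζ‖ ^ 4) := by fun_prop
  have hnn : ∀ ζ : 𝔼 d, 0 ≤ (Metric.ball (0 : 𝔼 d) 1).indicator
      (fun ζ => ‖ζ‖ ^ 2 / ((ζ 0) ^ 2 + ‖ζ‖ ^ 4)) ζ := fun ζ =>
    Set.indicator_nonneg (fun _ _ => by positivity) _
  calc _ ≤ ∫⁻ ζ : 𝔼 d, ENNReal.ofReal (4 ^ k) * (ENNReal.ofReal ((Metric.ball (0 : 𝔼 d) 1).indicator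
          (fun ζ => ‖ζ‖ ^ 2 / ((ζ 0) ^ 2 + ‖ζ‖ ^ 4)) ζ) + (ENNReal.ofReal ((1 + ‖ζ‖ ^ 2) ^ (-r))
          + ENNReal.ofReal ((1 + ‖horizontal ξ - ζ‖ ^ 2) ^ (-r)))) := by
        refine lintegral_mono fun ζ => ?_
        rw [← ENNReal.ofReal_mul' (by positivity), ← ENNReal.ofReal_add (by positivity) (by positivity),
          ← ENNReal.ofReal_add (hnn ζ) (by positivity), ← ENNReal.ofReal_mul (by positivity)]
        exact ENNReal.ofReal_le_ofReal (kernel_le hkp ξ ζ)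
    _ = _ := by
        rw [lintegral_const_mul' _ _ ENNReal.ofReal_ne_top, lintegral_add_left, lintegral_add_left,
          lintegral_sub_left_eq_self (fun ζ : 𝔼 d => ENNReal.ofReal ((1 + ‖ζ‖ ^ 2) ^ (-r)))]
        · congr 2
          rw [hI₀, ← lintegral_indicator Metric.isOpen_ball.measurableSet]
          refine lintegral_congr fun ζ => ?_
          by_cases hζ : ζ ∈ Metric.ball (0 : 𝔼 d) 1
          · rw [Set.indicator_of_mem hζ, Set.indicator_of_mem hζ]
          · rw [Set.indicator_of_notMem hζ, Set.indicator_of_notMem hζ, ENNReal.ofReal_zero]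
        · exact hm.ennreal_ofReal
        · exact (hm0.indicator Metric.isOpen_ball.measurableSet).ennreal_ofReal

end Kernel

/-! ### Pointwise values, gradient and sup bounds of elements of `X^{s+1/2}`. -/

section Anisotropic

open scoped ENNReal

theorem sq_lintegral_mul_le {α : Type*} [MeasurableSpace α] {μ : Measure α} {f g : α → ℝ≥0∞}
    (hf : AEMeasurable f μ) (hg : AEMeasurable g μ) :
    (∫⁻ a, f a * g a ∂μ) ^ 2 ≤ (∫⁻ a, f a ^ 2 ∂μ) * ∫⁻ a, g a ^ 2 ∂μ := by
  have h := ENNReal.lintegral_mul_le_Lp_mul_Lq μ Real.HolderConjugate.two_two hf hg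
  simp only [Pi.mul_apply, ENNReal.rpow_ofNat] at h
  calc _ ≤ ((∫⁻ a, f a ^ 2 ∂μ) ^ (1 / (2 : ℝ)) * (∫⁻ a, g a ^ 2 ∂μ) ^ (1 / (2 : ℝ))) ^ 2 := by
        gcongr
    _ = _ := by
        rw [mul_pow, ← ENNReal.rpow_natCast, ← ENNReal.rpow_natCast, ← ENNReal.rpow_mul,
          ← ENNReal.rpow_mul]
        norm_num

variable {d : ℕ} [NeZero d] {s : ℕ}

namespace X

theorem aestronglyMeasurable_fourierFun {σ : ℝ} (η : X d σ) :
    AEStronglyMeasurable (fourierFun η) volume :=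
  (isFunction_fourierFun η).1.aestronglyMeasurable

theorem lintegral_weight_mul {σ : ℝ} (η : X d σ) :
    ∫⁻ ξ, ENNReal.ofReal (weight σ ξ) * ‖fourierFun η ξ‖ₑ ^ 2 = ENNReal.ofReal (‖η‖ ^ 2) := by
  have h : ‖η‖ = ‖(memLp_fourierFun η).toLp _‖ := rfl
  rw [h, ENNReal.ofReal_pow (norm_nonneg _), ofReal_norm, Lp.enorm_toLp,
    eLpNorm_eq_lintegral_rpow_enorm_toReal (by norm_num) (by norm_num), ← ENNReal.rpow_natCast,
    ← ENNReal.rpow_mul]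
  simp only [ENNReal.toReal_ofNat, Nat.cast_ofNat, one_div, ne_eq, OfNat.ofNat_ne_zero,
    not_false_eq_true, inv_mul_cancel₀, ENNReal.rpow_one, ENNReal.rpow_ofNat]
  refine lintegral_congr fun ξ => ?_
  have hw : 0 ≤ weight σ ξ := by
    unfold weight
    split_ifs <;> positivity
  rw [enorm_smul, mul_pow, Real.enorm_of_nonneg (Real.sqrt_nonneg _),
    ← ENNReal.ofReal_pow (Real.sqrt_nonneg _), Real.sq_sqrt hw]

/-- Cauchy–Schwarz for the Fourier transform of `η`. -/
theorem exists_lintegral_fourierFun_le (hs : ((d + 1 : ℕ) : ℝ) / 2 < s) {p : ℕ} (hp : p ≤ 1)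
    (hps : p ≤ s) : ∃ C : ℝ, 0 ≤ C ∧ ∀ η : X d (s + 1 / 2),
      ∫⁻ ζ, ENNReal.ofReal (‖ζ‖ ^ p) * ‖fourierFun η ζ‖ₑ ≤ ENNReal.ofReal (C * ‖η‖) := by
  obtain ⟨C, hC, h⟩ := exists_lintegral_kernel_le hs (k := 0) hp (by omega)
  -- For `k = 0` the Sobolev quotient is `1`, so what is left is the finiteness of `∫ |ζ|^{2p}/ω`.
  have h0 := h 0
  simp only [pow_zero, div_one, ENNReal.ofReal_one, mul_one] at h0
  refine ⟨√C, Real.sqrt_nonneg _, fun η => ?_⟩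
  have hm := aestronglyMeasurable_fourierFun η
  have hw := measurable_weight (d := d) (s + 1 / 2 : ℝ)
  have key : (∫⁻ ζ, ENNReal.ofReal (‖ζ‖ ^ p) * ‖fourierFun η ζ‖ₑ) ^ 2
      ≤ ENNReal.ofReal ((√C * ‖η‖) ^ 2) := by
    calc _ = (∫⁻ ζ, ENNReal.ofReal (‖ζ‖ ^ p / √(weight (s + 1 / 2 : ℝ) ζ))
          * (ENNReal.ofReal (√(weight (s + 1 / 2 : ℝ) ζ)) * ‖fourierFun η ζ‖ₑ)) ^ 2 := by
          congr 1
          refine lintegral_congr_ae ?_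
          -- At the origin the weight is `0`, the default value of a division by zero, so this null
          -- point must be removed before dividing.
          filter_upwards [(measure_eq_zero_iff_ae_notMem (s := {(0 : 𝔼 d)})).mp
            (measure_singleton _)] with ζ hζ
          have hp := Real.sqrt_pos.mpr (weight_pos (s + 1 / 2 : ℝ) (by simpa using hζ : ζ ≠ 0))
          rw [← mul_assoc, ← ENNReal.ofReal_mul (by positivity), div_mul_cancel₀ _ hp.ne']
      _ ≤ (∫⁻ ζ, ENNReal.ofReal (‖ζ‖ ^ p / √(weight (s + 1 / 2 : ℝ) ζ)) ^ 2)
          * ∫⁻ ζ, (ENNReal.ofReal (√(weight (s + 1 / 2 : ℝ) ζ)) * ‖fourierFun η ζ‖ₑ) ^ 2 := by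
          refine sq_lintegral_mul_le ?_ ?_
          · exact (((measurable_norm.pow_const p).div hw.sqrt).ennreal_ofReal).aemeasurable
          · exact hw.sqrt.ennreal_ofReal.aemeasurable.mul hm.enorm
      _ = (∫⁻ ζ : 𝔼 d, ENNReal.ofReal (‖ζ‖ ^ (2 * p) / weight (s + 1 / 2 : ℝ) ζ))
          * ∫⁻ ζ, ENNReal.ofReal (weight (s + 1 / 2 : ℝ) ζ) * ‖fourierFun η ζ‖ₑ ^ 2 := by
          have hw0 : ∀ ζ : 𝔼 d, 0 ≤ weight (s + 1 / 2 : ℝ) ζ := fun ζ => by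
            unfold weight
            split_ifs <;> positivity
          congr 1
          · refine lintegral_congr fun ζ => ?_
            rw [← ENNReal.ofReal_pow (by positivity), div_pow, Real.sq_sqrt (hw0 ζ), ← pow_mul,
              mul_comm]
          · refine lintegral_congr fun ζ => ?_
            rw [mul_pow, ← ENNReal.ofReal_pow (Real.sqrt_nonneg _), Real.sq_sqrt (hw0 ζ)]
      _ ≤ ENNReal.ofReal C * ENNReal.ofReal (‖η‖ ^ 2) := by
          rw [lintegral_weight_mul]
          exact mul_le_mul' h0 le_rfl
      _ = _ := by
          rw [← ENNReal.ofReal_mul hC, mul_pow, Real.sq_sqrt hC]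
  rw [ENNReal.ofReal_pow (by positivity)] at key
  exact (ENNReal.pow_le_pow_left_iff (by norm_num)).mp key

theorem integrable_pow_mul_fourierFun (hs : ((d + 1 : ℕ) : ℝ) / 2 < s) {p : ℕ} (hp : p ≤ 1)
    (hps : p ≤ s) (η : X d (s + 1 / 2)) : Integrable fun ζ => ‖ζ‖ ^ p * ‖fourierFun η ζ‖ := by
  obtain ⟨C, -, h⟩ := exists_lintegral_fourierFun_le hs hp hps
  have hm := aestronglyMeasurable_fourierFun η
  refine ⟨(by fun_prop : Continuous fun ζ : 𝔼 d => ‖ζ‖ ^ p).aestronglyMeasurable.mul hm.norm, ?_⟩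
  refine lt_of_eq_of_lt (lintegral_congr fun ζ => ?_) ((h η).trans_lt ENNReal.ofReal_lt_top)
  rw [enorm_mul, Real.enorm_of_nonneg (by positivity), enorm_norm]

theorem integrable_fourierFun (hs : ((d + 1 : ℕ) : ℝ) / 2 < s) (η : X d (s + 1 / 2)) :
    Integrable (fourierFun η) := by
  have h := integrable_pow_mul_fourierFun hs (p := 0) (by norm_num) (Nat.zero_le _) η
  simp only [pow_zero, one_mul] at h
  exact (integrable_norm_iff (aestronglyMeasurable_fourierFun η)).mp h

theorem integrable_norm_mul_fourierFun (hs : ((d + 1 : ℕ) : ℝ) / 2 < s) (η : X d (s + 1 / 2)) :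
    Integrable fun ζ => ‖ζ‖ * ‖fourierFun η ζ‖ := by
  have h1 : 1 ≤ s := by
    by_contra h0
    obtain rfl : s = 0 := by omega
    have : (0 : ℝ) ≤ ((d + 1 : ℕ) : ℝ) / 2 := by positivity
    push_cast at *
    linarith
  have h := integrable_pow_mul_fourierFun hs (p := 1) le_rfl h1 η
  simpa only [pow_one] using h

/-- `η̂` is integrable, so by Fubini the inverse transform moves from the test function onto `η̂`.
-/
theorem toDistribution_eq (hs : ((d + 1 : ℕ) : ℝ) / 2 < s) (η : X d (s + 1 / 2))
    (θ : 𝓢(𝔼 d, ℂ)) : toDistribution η θ = ∫ x, θ x * 𝓕⁻ (fourierFun η) x := by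
  have h1 : toDistribution η θ = 𝓕 (toDistribution η) (𝓕⁻ θ) := by
    rw [TemperedDistribution.fourier_apply, FourierTransform.fourier_fourierInv_eq]
  rw [h1, ((isFunction_fourierFun η).2 _).2]
  have := VectorFourier.integral_fourierIntegral_smul_eq_flip (L := -innerₗ (𝔼 d))
    Real.continuous_fourierChar (by
      change Continuous fun p : 𝔼 d × 𝔼 d => -inner ℝ p.1 p.2
      fun_prop) θ.integrable
    (integrable_fourierFun hs η) (μ := volume) (ν := volume)
  have hflip : (-innerₗ (𝔼 d)).flip = -innerₗ (𝔼 d) := by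
    ext x y
    simpa using real_inner_comm x y
  rw [hflip] at this
  simp only [SchwartzMap.fourierInv_coe]
  exact this

theorem continuous_fourierInv (hs : ((d + 1 : ℕ) : ℝ) / 2 < s) (η : X d (s + 1 / 2)) :
    Continuous (𝓕⁻ (fourierFun η)) :=
  VectorFourier.fourierIntegral_continuous Real.continuous_fourierChar (by
      change Continuous fun p : 𝔼 d × 𝔼 d => -inner ℝ p.1 p.2
      fun_prop) (integrable_fourierFun hs η)

/-- A real test function is its own conjugate, so reality of `η` forces the pairing with it to be
real. The imaginary part therefore vanishes a.e., and everywhere by continuity. -/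
theorem im_fourierInv (hs : ((d + 1 : ℕ) : ℝ) / 2 < s) (η : X d (s + 1 / 2)) (x : 𝔼 d) :
    (𝓕⁻ (fourierFun η) x).im = 0 := by
  have hc := continuous_fourierInv hs η
  have hci : Continuous fun x => (𝓕⁻ (fourierFun η) x).im := Complex.continuous_im.comp hc
  have h0 : (fun x => (𝓕⁻ (fourierFun η) x).im) =ᵐ[volume] fun _ => 0 := by
    refine ae_eq_zero_of_integral_contDiff_smul_eq_zero hci.locallyIntegrable fun g hg hgc => ?_
    have hc' : HasCompactSupport (Complex.ofRealCLM ∘ g) := hgc.comp_left rfl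
    have hg' : ContDiff ℝ ∞ (Complex.ofRealCLM ∘ g) := by fun_prop
    have hr := η.2.1 (hc'.toSchwartzMap hg') (hc'.toSchwartzMap hg') fun x => by
      simp
    have e : toDistribution η (hc'.toSchwartzMap hg') = ∫ x, (g x : ℂ) * 𝓕⁻ (fourierFun η) x := by
      rw [toDistribution_eq hs]
      rfl
    have him : (toDistribution η (hc'.toSchwartzMap hg')).im = 0 := by
      have := congrArg Complex.im hr
      change (toDistribution η (hc'.toSchwartzMap hg')).im
        = (star (toDistribution η (hc'.toSchwartzMap hg'))).im at this
      simp only [RCLike.star_def, Complex.conj_im] at this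
      linarith
    have hi : Integrable fun x => (g x : ℂ) * 𝓕⁻ (fourierFun η) x :=
      ((Complex.continuous_ofReal.comp hg.continuous).mul hc).integrable_of_hasCompactSupport
        hc'.mul_right
    rw [e] at him
    have := integral_im hi
    simp only [RCLike.im_to_complex] at this
    rw [him] at this
    simpa using this
  have := (hci.ae_eq_iff_eq volume continuous_const).mp h0
  exact congrFun this x

/-- The real part of the inverse transform is a witness for the choice made in `toFun`, which is
thus never the default `0`. -/
theorem isContinuousFunction_toFun (hs : ((d + 1 : ℕ) : ℝ) / 2 < s) (η : X d (s + 1 / 2)) :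
    η.IsContinuousFunction η := by
  have h : ∃ g, IsContinuousFunction η g := by
    refine ⟨fun x => (𝓕⁻ (fourierFun η) x).re,
      Complex.continuous_re.comp (continuous_fourierInv hs η), fun θ _ => ?_⟩
    rw [toDistribution_eq hs]
    refine integral_congr_ae (Filter.Eventually.of_forall fun x => ?_)
    change _ * _ = _ * _
    congr 1
    exact Complex.ext rfl (im_fourierInv hs η x)
  unfold toFun
  rw [dif_pos h]
  exact h.choose_spec

/-- The pointwise values of `η` are given by Fourier inversion. -/
theorem ofReal_toFun (hs : ((d + 1 : ℕ) : ℝ) / 2 < s) (η : X d (s + 1 / 2)) (x : 𝔼 d) :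
    ((η x : ℝ) : ℂ) = 𝓕⁻ (fourierFun η) x := by
  obtain ⟨hc, h⟩ := isContinuousFunction_toFun hs η
  have hc1 : Continuous fun x => ((η x : ℝ) : ℂ) := Complex.continuous_ofReal.comp hc
  have hc2 := continuous_fourierInv hs η
  have h0 : (fun x => ((η x : ℝ) : ℂ)) =ᵐ[volume] 𝓕⁻ (fourierFun η) := by
    refine ae_eq_of_integral_contDiff_smul_eq hc1.locallyIntegrable hc2.locallyIntegrable
      fun g hg hgc => ?_
    have hc' : HasCompactSupport (Complex.ofRealCLM ∘ g) := hgc.comp_left rfl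
    have hg' : ContDiff ℝ ∞ (Complex.ofRealCLM ∘ g) := by fun_prop
    have e := (h (hc'.toSchwartzMap hg') hc').symm.trans
      (toDistribution_eq hs η (hc'.toSchwartzMap hg'))
    simpa using e
  exact congrFun ((hc1.ae_eq_iff_eq volume hc2).mp h0) x

/-- `fourierFun` is a chosen representative, hence additive only almost everywhere; the inversion
integral does not see the null set. -/
theorem toFun_add (hs : ((d + 1 : ℕ) : ℝ) / 2 < s) (η ζ : X d (s + 1 / 2)) (x : 𝔼 d) :
    (η + ζ) x = η x + ζ x := by
  have h : IsFunction (𝓕 (toDistribution (η + ζ))) (fourierFun η + fourierFun ζ) := by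
    rw [map_add, FourierTransform.fourier_add]
    exact (isFunction_fourierFun η).add (isFunction_fourierFun ζ)
  have e := Real.fourierInv_congr_ae ((isFunction_fourierFun (η + ζ)).unique h) x
  rw [← Complex.ofReal_inj, Complex.ofReal_add, ofReal_toFun hs, ofReal_toFun hs, ofReal_toFun hs, e,
    Real.fourierInv_eq, Real.fourierInv_eq, Real.fourierInv_eq, ← integral_add]
  · simp only [Pi.add_apply, smul_add]
  · have := (Real.fourierIntegral_convergent_iff (-x)).mpr (integrable_fourierFun hs η)
    simpa using this
  · have := (Real.fourierIntegral_convergent_iff (-x)).mpr (integrable_fourierFun hs ζ)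
    simpa using this

theorem toFun_smul (hs : ((d + 1 : ℕ) : ℝ) / 2 < s) (c : ℝ) (η : X d (s + 1 / 2)) (x : 𝔼 d) :
    (c • η) x = c * η x := by
  have h : IsFunction (𝓕 (toDistribution (c • η))) (c • fourierFun η) := by
    rw [map_smul, fourier_smul_real]
    exact (isFunction_fourierFun η).smul c
  have e := Real.fourierInv_congr_ae ((isFunction_fourierFun (c • η)).unique h) x
  rw [← Complex.ofReal_inj, Complex.ofReal_mul, ofReal_toFun hs, ofReal_toFun hs, e,
    Real.fourierInv_eq, Real.fourierInv_eq, ← integral_const_mul]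
  refine integral_congr_ae (Filter.Eventually.of_forall fun ζ => ?_)
  simp only [Pi.smul_apply, Circle.smul_def, Complex.real_smul, smul_eq_mul]
  ring

theorem hasFDerivAt_fourierInv (hs : ((d + 1 : ℕ) : ℝ) / 2 < s) (η : X d (s + 1 / 2)) (x : 𝔼 d) :
    HasFDerivAt (𝓕⁻ (fourierFun η)) (VectorFourier.fourierIntegral Real.fourierChar volume
      (-innerSL ℝ : 𝔼 d →L[ℝ] 𝔼 d →L[ℝ] ℝ).toLinearMap₁₂
      (VectorFourier.fourierSMulRight (-innerSL ℝ) (fourierFun η)) x) x :=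
  VectorFourier.hasFDerivAt_fourierIntegral (-innerSL ℝ : 𝔼 d →L[ℝ] 𝔼 d →L[ℝ] ℝ)
    (integrable_fourierFun hs η) (integrable_norm_mul_fourierFun hs η) x

theorem contDiff_fourierInv (hs : ((d + 1 : ℕ) : ℝ) / 2 < s) (η : X d (s + 1 / 2)) :
    ContDiff ℝ 1 (𝓕⁻ (fourierFun η)) := by
  refine VectorFourier.contDiff_fourierIntegral (N := 1) (-innerSL ℝ : 𝔼 d →L[ℝ] 𝔼 d →L[ℝ] ℝ)
    fun p hp => ?_
  have hp : p ≤ 1 := by exact_mod_cast hp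
  interval_cases p
  · simpa using (integrable_fourierFun hs η).norm
  · simpa using integrable_norm_mul_fourierFun hs η

theorem contDiff_toFun (hs : ((d + 1 : ℕ) : ℝ) / 2 < s) (η : X d (s + 1 / 2)) :
    ContDiff ℝ 1 (η : 𝔼 d → ℝ) := by
  have : (η : 𝔼 d → ℝ) = fun x => Complex.reCLM (𝓕⁻ (fourierFun η) x) := by
    funext x
    rw [← ofReal_toFun hs]
    simp
  rw [this]
  exact Complex.reCLM.contDiff.comp (contDiff_fourierInv hs η)

/-- Differentiation under the inversion integral, justified by integrability of `|ζ| |η̂|`. It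
exhibits a directional derivative of `η` as an inverse transform dominated by `|ζ| |η̂|`, as the
multiplier bound with `p = 1` requires. -/
theorem ofReal_fderiv (hs : ((d + 1 : ℕ) : ℝ) / 2 < s) (η : X d (s + 1 / 2)) (x v : 𝔼 d) :
    ((fderiv ℝ (η : 𝔼 d → ℝ) x v : ℝ) : ℂ)
      = 𝓕⁻ (fun ζ => (2 * Real.pi * Complex.I * inner ℝ ζ v) * fourierFun η ζ) x := by
  have h1 : HasFDerivAt (Complex.ofRealCLM ∘ (η : 𝔼 d → ℝ))
      (Complex.ofRealCLM ∘L fderiv ℝ (η : 𝔼 d → ℝ) x) x :=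
    Complex.ofRealCLM.hasFDerivAt.comp x
      (((contDiff_toFun hs η).differentiable (by simp)) x).hasFDerivAt
  have e : (Complex.ofRealCLM ∘ (η : 𝔼 d → ℝ)) = 𝓕⁻ (fourierFun η) :=
    funext fun x => ofReal_toFun hs η x
  rw [e] at h1
  have h2 := congrArg (fun A : 𝔼 d →L[ℝ] ℂ => A v) (h1.unique (hasFDerivAt_fourierInv hs η x))
  simp only [ContinuousLinearMap.comp_apply, Complex.ofRealCLM_apply] at h2
  rw [h2, Real.fourierIntegral_continuousLinearMap_apply']
  · rw [Real.fourierInv_eq]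
    refine integral_congr_ae (Filter.Eventually.of_forall fun ζ => ?_)
    have hi : ∀ w, innerSL ℝ ζ w = inner ℝ ζ w := fun _ => rfl
    simp [VectorFourier.fourierSMulRight_apply, hi]
    ring_nf
  · refine Integrable.mono' ((integrable_norm_mul_fourierFun hs η).const_mul (2 * Real.pi))
      ((aestronglyMeasurable_fourierFun η).fourierSMulRight)
      (Filter.Eventually.of_forall fun ζ => ?_)
    refine (VectorFourier.norm_fourierSMulRight_le _ _ _).trans ?_
    have : ‖(-innerSL ℝ : 𝔼 d →L[ℝ] 𝔼 d →L[ℝ] ℝ)‖ ≤ 1 := by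
      refine ContinuousLinearMap.opNorm_le_bound₂ _ zero_le_one fun y z => ?_
      change ‖-inner ℝ y z‖ ≤ _
      rw [norm_neg, one_mul]
      exact norm_inner_le_norm y z
    have hp := Real.pi_pos
    calc _ ≤ 2 * Real.pi * 1 * ‖ζ‖ * ‖fourierFun η ζ‖ := by gcongr
      _ = _ := by ring

/-- `η` and its gradient are bounded by the norm of `η`. -/
theorem exists_bounds (hs : ((d + 1 : ℕ) : ℝ) / 2 < s) : ∃ C : ℝ, 0 ≤ C ∧
    ∀ (η : X d (s + 1 / 2)) (x : 𝔼 d), |η x| ≤ C * ‖η‖ ∧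
      ‖fderiv ℝ (η : 𝔼 d → ℝ) x‖ ≤ C * ‖η‖ := by
  have h1 : 1 ≤ s := by
    by_contra h0
    obtain rfl : s = 0 := by omega
    have : (0 : ℝ) ≤ ((d + 1 : ℕ) : ℝ) / 2 := by positivity
    push_cast at *
    linarith
  obtain ⟨C₀, hC₀, hb₀⟩ := exists_lintegral_fourierFun_le hs (p := 0) (by norm_num) (Nat.zero_le _)
  obtain ⟨C₁, hC₁, hb₁⟩ := exists_lintegral_fourierFun_le hs (p := 1) le_rfl h1
  have hp := Real.pi_pos
  -- The sup norm is at most the `L¹` norm of the transform; it serves both `η` and its derivatives.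
  have key : ∀ (F : 𝔼 d → ℂ) (R : ℝ) (x : 𝔼 d), 0 ≤ R → ∫⁻ ζ, ‖F ζ‖ₑ ≤ ENNReal.ofReal R →
      ‖𝓕⁻ F x‖ ≤ R := by
    intro F R x hR hF
    rw [← ENNReal.ofReal_le_ofReal_iff hR, ofReal_norm, Real.fourierInv_eq]
    refine (enorm_integral_le_lintegral_enorm _).trans (le_of_eq_of_le ?_ hF)
    exact lintegral_congr fun ζ => by rw [← ofReal_norm, Circle.norm_smul, ofReal_norm]
  refine ⟨C₀ + 2 * Real.pi * C₁, by positivity, fun η x => ⟨?_, ?_⟩⟩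
  · rw [← Real.norm_eq_abs, ← Complex.norm_real, ofReal_toFun hs]
    refine (key _ (C₀ * ‖η‖) x (by positivity) (le_of_eq_of_le ?_ (hb₀ η))).trans ?_
    · simp
    · gcongr
      linarith [mul_nonneg (mul_nonneg zero_le_two hp.le) hC₁]
  · refine ContinuousLinearMap.opNorm_le_bound _ (by positivity) fun v => ?_
    rw [← Complex.norm_real, ofReal_fderiv hs]
    have : ∫⁻ ζ, ‖(2 * Real.pi * Complex.I * inner ℝ ζ v : ℂ) * fourierFun η ζ‖ₑ
        ≤ ENNReal.ofReal (2 * Real.pi * ‖v‖ * (C₁ * ‖η‖)) := by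
      rw [ENNReal.ofReal_mul (by positivity)]
      refine le_trans ?_ (mul_le_mul' le_rfl (hb₁ η))
      rw [← lintegral_const_mul' _ _ ENNReal.ofReal_ne_top]
      refine lintegral_mono fun ζ => ?_
      rw [enorm_mul, ← mul_assoc, ← ENNReal.ofReal_mul (by positivity), ← ofReal_norm]
      refine mul_le_mul' (ENNReal.ofReal_le_ofReal ?_) le_rfl
      simp only [norm_mul, Complex.norm_I, Complex.norm_real, RCLike.norm_ofNat, mul_one,
        Real.norm_eq_abs, abs_of_pos hp, pow_one]
      have := abs_real_inner_le_norm ζ v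
      calc 2 * Real.pi * |inner ℝ ζ v| ≤ 2 * Real.pi * (‖ζ‖ * ‖v‖) := by gcongr
        _ = _ := by ring
    refine (key _ _ x (by positivity) this).trans ?_
    have h3 : 0 ≤ C₀ * ‖η‖ * ‖v‖ := by positivity
    calc 2 * Real.pi * ‖v‖ * (C₁ * ‖η‖) = 2 * Real.pi * C₁ * ‖η‖ * ‖v‖ := by ring
      _ ≤ _ := by rw [add_mul, add_mul]; linarith

end X

end Anisotropic

/-! ### Products with functions of `x'` as partial convolutions. -/

section FourierMultiplication

open scoped ENNReal

variable {d k : ℕ}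

/-- The partial convolution of `F` on `ℝᵈ` and `h` on `ℝ^{d+1}`. -/
def partialConv (F : 𝔼 d → ℂ) (h : 𝔼 (d + 1) → ℂ) (ξ : 𝔼 (d + 1)) : ℂ :=
  ∫ ζ, F ζ * h (ξ - horizontalEmb ζ)

theorem aestronglyMeasurable_partialConv_kernel {F : 𝔼 d → ℂ} (hF : AEStronglyMeasurable F volume)
    {h : 𝔼 (d + 1) → ℂ} (hh : Measurable h) :
    AEStronglyMeasurable (fun p : 𝔼 (d + 1) × 𝔼 d => F p.2 * h (p.1 - horizontalEmb p.2))
      (volume.prod volume) := by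
  have h1 : Measurable fun p : 𝔼 (d + 1) × 𝔼 d => h (p.1 - horizontalEmb p.2) :=
    hh.comp (measurable_fst.sub (continuous_horizontalEmb.measurable.comp measurable_snd))
  exact hF.comp_snd.mul h1.aestronglyMeasurable

/-- Cauchy–Schwarz in `ζ` with the weight `J(ξ - ζ)` inserted and divided out. One factor is the
kernel integral, bounded by `C` uniformly in `ξ`. The other, `∫ ρ(ζ) J(ξ-ζ) |h(ξ-ζ)|² dζ`, is
integrated over `ξ` by Tonelli and translation invariance. -/
theorem sobolevEnergy_partialConv_le [NeZero d] {F : 𝔼 d → ℂ} {κ ρ : 𝔼 d → ℝ≥0∞}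
    (hκ : Measurable κ) (hρ : AEMeasurable ρ volume)
    (hFκ : ∀ᵐ ζ, ‖F ζ‖ₑ ^ 2 ≤ κ ζ * ρ ζ) {C : ℝ≥0∞}
    (hC : ∀ ξ : 𝔼 (d + 1), ∫⁻ ζ : 𝔼 d, κ ζ
        * ENNReal.ofReal ((1 + ‖ξ‖ ^ 2) ^ k / (1 + ‖ξ - horizontalEmb ζ‖ ^ 2) ^ k) ≤ C)
    {h : 𝔼 (d + 1) → ℂ} (hh : Measurable h) :
    sobolevEnergy k (partialConv F h) ≤ C * (∫⁻ ζ, ρ ζ) * sobolevEnergy k h := by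
  let J : 𝔼 (d + 1) → ℝ≥0∞ := fun ξ => ENNReal.ofReal ((1 + ‖ξ‖ ^ 2) ^ k)
  have hJm : Measurable J := by fun_prop
  have hJ0 : ∀ ξ, J ξ ≠ 0 := fun ξ => by
    simp only [J, ne_eq, ENNReal.ofReal_eq_zero, not_le]; positivity
  have hJt : ∀ ξ, J ξ ≠ ⊤ := fun ξ => ENNReal.ofReal_ne_top
  have hdiv : ∀ ξ η : 𝔼 (d + 1), ENNReal.ofReal ((1 + ‖ξ‖ ^ 2) ^ k / (1 + ‖η‖ ^ 2) ^ k)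
      = J ξ * (J η)⁻¹ := fun ξ η => by
    rw [ENNReal.ofReal_div_of_pos (by positivity), div_eq_mul_inv]
  have hem : Measurable (horizontalEmb : 𝔼 d → 𝔼 (d + 1)) := continuous_horizontalEmb.measurable
  have hsq : ∀ a : ℝ≥0∞, (a ^ (1 / 2 : ℝ)) ^ 2 = a := fun a => by
    rw [← ENNReal.rpow_natCast, ← ENNReal.rpow_mul]; norm_num
  have point : ∀ ξ, J ξ * ‖partialConv F h ξ‖ₑ ^ 2
      ≤ C * ∫⁻ ζ, ρ ζ * (J (ξ - horizontalEmb ζ) * ‖h (ξ - horizontalEmb ζ)‖ₑ ^ 2) := by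
    intro ξ
    let f : 𝔼 d → ℝ≥0∞ := fun ζ => (κ ζ * (J (ξ - horizontalEmb ζ))⁻¹) ^ (1 / 2 : ℝ)
    let g : 𝔼 d → ℝ≥0∞ := fun ζ => (ρ ζ * (J (ξ - horizontalEmb ζ)
      * ‖h (ξ - horizontalEmb ζ)‖ₑ ^ 2)) ^ (1 / 2 : ℝ)
    have hJc : Measurable fun ζ : 𝔼 d => J (ξ - horizontalEmb ζ) :=
      hJm.comp (measurable_const.sub hem)
    have hhc : Measurable fun ζ : 𝔼 d => h (ξ - horizontalEmb ζ) :=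
      hh.comp (measurable_const.sub hem)
    have hf : AEMeasurable f volume := ((hκ.mul hJc.inv).pow_const _).aemeasurable
    have hg : AEMeasurable g volume :=
      (hρ.mul (hJc.mul (hhc.enorm.pow_const _)).aemeasurable).pow_const _
    have h1 : ‖partialConv F h ξ‖ₑ ≤ ∫⁻ ζ, f ζ * g ζ := by
      refine (enorm_integral_le_lintegral_enorm _).trans (lintegral_mono_ae ?_)
      filter_upwards [hFκ] with ζ hζ
      rw [← ENNReal.pow_le_pow_left_iff two_ne_zero, enorm_mul, mul_pow, mul_pow, hsq, hsq]
      calc ‖F ζ‖ₑ ^ 2 * ‖h (ξ - horizontalEmb ζ)‖ₑ ^ 2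
          ≤ (κ ζ * ρ ζ) * ‖h (ξ - horizontalEmb ζ)‖ₑ ^ 2 := by gcongr
        _ = (κ ζ * ρ ζ) * ‖h (ξ - horizontalEmb ζ)‖ₑ ^ 2
            * ((J (ξ - horizontalEmb ζ))⁻¹ * J (ξ - horizontalEmb ζ)) := by
            rw [ENNReal.inv_mul_cancel (hJ0 _) (hJt _), mul_one]
        _ = _ := by ring
    calc J ξ * ‖partialConv F h ξ‖ₑ ^ 2 ≤ J ξ * (∫⁻ ζ, f ζ * g ζ) ^ 2 := by gcongr
      _ ≤ J ξ * ((∫⁻ ζ, f ζ ^ 2) * ∫⁻ ζ, g ζ ^ 2) := by gcongr; exact sq_lintegral_mul_le hf hg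
      _ = (∫⁻ ζ, κ ζ * (J ξ * (J (ξ - horizontalEmb ζ))⁻¹)) * ∫⁻ ζ, g ζ ^ 2 := by
          rw [← mul_assoc, ← lintegral_const_mul' _ _ (hJt ξ)]
          congr 1
          refine lintegral_congr fun ζ => ?_
          rw [hsq]; ring
      _ ≤ C * ∫⁻ ζ, g ζ ^ 2 := by
          refine mul_le_mul' ?_ le_rfl
          have := hC ξ
          simp only [hdiv] at this
          exact this
      _ = _ := by simp only [g, hsq]
  calc sobolevEnergy k (partialConv F h)
      ≤ ∫⁻ ξ, C * ∫⁻ ζ, ρ ζ * (J (ξ - horizontalEmb ζ) * ‖h (ξ - horizontalEmb ζ)‖ₑ ^ 2) :=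
        lintegral_mono point
    _ = C * ∫⁻ ξ, ∫⁻ ζ, ρ ζ * (J (ξ - horizontalEmb ζ) * ‖h (ξ - horizontalEmb ζ)‖ₑ ^ 2) := by
        refine lintegral_const_mul'' _ ?_
        refine AEMeasurable.lintegral_prod_right' (f := fun p : 𝔼 (d + 1) × 𝔼 d =>
          ρ p.2 * (J (p.1 - horizontalEmb p.2) * ‖h (p.1 - horizontalEmb p.2)‖ₑ ^ 2)) ?_
        have hs : Measurable fun p : 𝔼 (d + 1) × 𝔼 d => p.1 - horizontalEmb p.2 :=
          measurable_fst.sub (hem.comp measurable_snd)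
        exact hρ.comp_snd.mul
          ((hJm.comp hs).mul ((hh.comp hs).enorm.pow_const _)).aemeasurable
    _ = C * ∫⁻ ζ, ∫⁻ ξ, ρ ζ * (J (ξ - horizontalEmb ζ) * ‖h (ξ - horizontalEmb ζ)‖ₑ ^ 2) := by
        rw [lintegral_lintegral_swap]
        have hs : Measurable fun p : 𝔼 (d + 1) × 𝔼 d => p.1 - horizontalEmb p.2 :=
          measurable_fst.sub (hem.comp measurable_snd)
        exact hρ.comp_snd.mul
          ((hJm.comp hs).mul ((hh.comp hs).enorm.pow_const _)).aemeasurable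
    _ = C * ∫⁻ ζ, ρ ζ * sobolevEnergy k h := by
        congr 1
        refine lintegral_congr fun ζ => ?_
        have hm : Measurable fun ξ => J (ξ - horizontalEmb ζ) * ‖h (ξ - horizontalEmb ζ)‖ₑ ^ 2 :=
          (hJm.mul (hh.enorm.pow_const 2)).comp (measurable_sub_const _)
        rw [lintegral_const_mul _ hm, lintegral_sub_right_eq_self (fun ξ => J ξ * ‖h ξ‖ₑ ^ 2)]
        rfl
    _ = _ := by rw [lintegral_mul_const'' _ hρ, mul_assoc]

theorem norm_fourierInv_le {F : 𝔼 d → ℂ} (x : 𝔼 d) : ‖𝓕⁻ F x‖ ≤ ∫ ζ, ‖F ζ‖ := by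
  rw [Real.fourierInv_eq]
  refine (norm_integral_le_integral_norm _).trans (le_of_eq ?_)
  simp only [Circle.norm_smul]

/-- The Fourier transform of a product with a function of `x'` is a partial convolution. -/
theorem integral_fourier_mul_eq {F : 𝔼 d → ℂ} (hF : Integrable F) (u : 𝕃 (d + 1) ℂ)
    (θ : 𝓢(𝔼 (d + 1), ℂ)) :
    ∫ x, 𝓕 θ x * (𝓕⁻ F (horizontal x) * u x)
      = ∫ ξ, θ ξ * partialConv F (𝓕 u : 𝕃 (d + 1) ℂ) ξ := by
  set w : 𝔼 (d + 1) → ℂ := ((𝓕 u : 𝕃 (d + 1) ℂ) : 𝔼 (d + 1) → ℂ) with hw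
  have hwm : Measurable w := (Lp.stronglyMeasurable _).measurable
  have hu2 : MemLp u 2 volume := Lp.memLp u
  have hw2 : MemLp w 2 volume := Lp.memLp _
  have hθu : Integrable fun x => 𝓕 θ x * u x :=
    memLp_one_iff_integrable.mp (hu2.mul ((𝓕 θ : 𝓢(𝔼 (d + 1), ℂ)).memLp 2))
  have hinner : Continuous fun p : 𝔼 (d + 1) × 𝔼 d => (inner ℝ p.2 (horizontal p.1) : ℝ) :=
    continuous_snd.inner (continuous_horizontal.comp continuous_fst)
  have hch : Continuous fun p : 𝔼 (d + 1) × 𝔼 d =>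
      (Real.fourierChar (inner ℝ p.2 (horizontal p.1)) : ℂ) :=
    continuous_subtype_val.comp (Real.continuous_fourierChar.comp hinner)
  have I1 : Integrable (fun p : 𝔼 (d + 1) × 𝔼 d =>
      (Real.fourierChar (inner ℝ p.2 (horizontal p.1)) : ℂ) * ((𝓕 θ p.1 * u p.1) * F p.2))
      (volume.prod volume) := by
    refine (hθu.mul_prod hF).bdd_mul (c := 1) hch.aestronglyMeasurable
      (Filter.Eventually.of_forall fun p => ?_)
    rw [Circle.norm_coe]
  -- Needed for Fubini. For fixed `ζ`, `|θ| |w(· - ζ)| ≤ |θ|² + |w(· - ζ)|²` has an integral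
  -- independent of `ζ`, and `F` is integrable.
  have I2 : Integrable (fun p : 𝔼 (d + 1) × 𝔼 d =>
      θ p.1 * (F p.2 * w (p.1 - horizontalEmb p.2))) (volume.prod volume) := by
    have hm : AEStronglyMeasurable (fun p : 𝔼 (d + 1) × 𝔼 d =>
        θ p.1 * (F p.2 * w (p.1 - horizontalEmb p.2))) (volume.prod volume) :=
      (θ.continuous.comp continuous_fst).aestronglyMeasurable.mul
        (aestronglyMeasurable_partialConv_kernel hF.1 hwm)
    refine ⟨hm, ?_⟩
    have hfin : ∀ {f : 𝔼 (d + 1) → ℂ}, MemLp f 2 volume → ∫⁻ x, ‖f x‖ₑ ^ 2 < ⊤ := fun hf => by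
      have := (eLpNorm_lt_top_iff_lintegral_rpow_enorm_lt_top (by norm_num) (by norm_num)).mp hf.2
      simpa using this
    have hM : (∫⁻ x, ‖θ x‖ₑ ^ 2) + ∫⁻ x, ‖w x‖ₑ ^ 2 < ⊤ :=
      ENNReal.add_lt_top.mpr ⟨hfin (θ.memLp 2), hfin hw2⟩
    rw [HasFiniteIntegral, lintegral_prod_symm _ hm.enorm]
    calc ∫⁻ ζ, ∫⁻ ξ, ‖θ ξ * (F ζ * w (ξ - horizontalEmb ζ))‖ₑ
        ≤ ∫⁻ ζ, ‖F ζ‖ₑ * ((∫⁻ x, ‖θ x‖ₑ ^ 2) + ∫⁻ x, ‖w x‖ₑ ^ 2) := by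
          refine lintegral_mono fun ζ => ?_
          calc ∫⁻ ξ, ‖θ ξ * (F ζ * w (ξ - horizontalEmb ζ))‖ₑ
              ≤ ∫⁻ ξ, ‖F ζ‖ₑ * (‖θ ξ‖ₑ ^ 2 + ‖w (ξ - horizontalEmb ζ)‖ₑ ^ 2) := by
                refine lintegral_mono fun ξ => ?_
                rw [enorm_mul, enorm_mul, mul_left_comm]
                refine mul_le_mul' le_rfl ?_
                rcases le_total ‖θ ξ‖ₑ ‖w (ξ - horizontalEmb ζ)‖ₑ with h | h
                · calc _ ≤ ‖w (ξ - horizontalEmb ζ)‖ₑ * ‖w (ξ - horizontalEmb ζ)‖ₑ := by gcongr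
                    _ = ‖w (ξ - horizontalEmb ζ)‖ₑ ^ 2 := (sq _).symm
                    _ ≤ _ := le_add_self
                · calc _ ≤ ‖θ ξ‖ₑ * ‖θ ξ‖ₑ := by gcongr
                    _ = ‖θ ξ‖ₑ ^ 2 := (sq _).symm
                    _ ≤ _ := le_self_add
            _ = _ := by
                rw [lintegral_const_mul' _ _ enorm_ne_top, lintegral_add_left (by fun_prop),
                  lintegral_sub_right_eq_self (fun ξ => ‖w ξ‖ₑ ^ 2)]
      _ = (∫⁻ ζ, ‖F ζ‖ₑ) * ((∫⁻ x, ‖θ x‖ₑ ^ 2) + ∫⁻ x, ‖w x‖ₑ ^ 2) :=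
          lintegral_mul_const' _ _ hM.ne
      _ < ⊤ := ENNReal.mul_lt_top hF.2 hM
  -- Modulating by the character of frequency `(ζ, 0)` is a translation on the Fourier side; the
  -- identity comes from testing `û` against the translate of `θ`.
  have shift : ∀ ζ : 𝔼 d, ∫ x, (Real.fourierChar (inner ℝ ζ (horizontal x)) : ℂ) * (𝓕 θ x * u x)
      = ∫ ξ, θ ξ * w (ξ - horizontalEmb ζ) := by
    intro ζ
    let θ' : 𝓢(𝔼 (d + 1), ℂ) := SchwartzMap.compSubConstCLM ℂ (-horizontalEmb ζ) θ
    have hθ' : ∀ ξ, θ' ξ = θ (ξ + horizontalEmb ζ) := fun ξ => by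
      simp only [θ', SchwartzMap.compSubConstCLM_apply, sub_neg_eq_add]
    have e1 : ∀ x, 𝓕 θ' x = (Real.fourierChar (inner ℝ ζ (horizontal x)) : ℂ) * 𝓕 θ x := fun x => by
      have h1 : (θ' : 𝔼 (d + 1) → ℂ) = (θ : 𝔼 (d + 1) → ℂ) ∘ fun y => y + horizontalEmb ζ :=
        funext hθ'
      rw [SchwartzMap.fourier_coe, SchwartzMap.fourier_coe, h1]
      have := congrFun (VectorFourier.fourierIntegral_comp_add_right Real.fourierChar
        (volume : Measure (𝔼 (d + 1))) (innerₗ (𝔼 (d + 1))) θ (horizontalEmb ζ)) x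
      refine this.trans ?_
      rw [innerₗ_apply_apply, inner_horizontalEmb]
      rfl
    have e2 : (𝓕 (u : 𝓢'(𝔼 (d + 1), ℂ))) θ' = ∫ ξ, θ' ξ * w ξ := by
      rw [Lp.fourier_toTemperedDistribution_eq, Lp.toTemperedDistribution_apply]
      rfl
    have e3 : (𝓕 (u : 𝓢'(𝔼 (d + 1), ℂ))) θ' = ∫ x, 𝓕 θ' x * u x := by
      rw [TemperedDistribution.fourier_apply, Lp.toTemperedDistribution_apply]
      rfl
    rw [e2] at e3
    rw [← integral_sub_right_eq_self (fun ξ => θ' ξ * w ξ) (horizontalEmb ζ)] at e3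
    simp only [hθ', sub_add_cancel, e1] at e3
    rw [e3]
    refine integral_congr_ae (Filter.Eventually.of_forall fun x => ?_)
    simp only [mul_assoc]
  calc ∫ x, 𝓕 θ x * (𝓕⁻ F (horizontal x) * u x)
      = ∫ x, ∫ ζ, (Real.fourierChar (inner ℝ ζ (horizontal x)) : ℂ) * ((𝓕 θ x * u x) * F ζ) := by
        refine integral_congr_ae (Filter.Eventually.of_forall fun x => ?_)
        simp only
        rw [Real.fourierInv_eq, mul_comm (∫ _, _), ← mul_assoc, ← integral_const_mul]
        refine integral_congr_ae (Filter.Eventually.of_forall fun ζ => ?_)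
        simp only [Circle.smul_def, smul_eq_mul]
        ring
    _ = ∫ ζ, ∫ x, (Real.fourierChar (inner ℝ ζ (horizontal x)) : ℂ) * ((𝓕 θ x * u x) * F ζ) :=
        integral_integral_swap I1
    _ = ∫ ζ, ∫ ξ, θ ξ * (F ζ * w (ξ - horizontalEmb ζ)) := by
        refine integral_congr_ae (Filter.Eventually.of_forall fun ζ => ?_)
        simp only
        have a1 : ∀ x, (Real.fourierChar (inner ℝ ζ (horizontal x)) : ℂ) * ((𝓕 θ x * u x) * F ζ)
            = F ζ * ((Real.fourierChar (inner ℝ ζ (horizontal x)) : ℂ) * (𝓕 θ x * u x)) :=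
          fun x => by ring
        have a2 : ∀ ξ, θ ξ * (F ζ * w (ξ - horizontalEmb ζ))
            = F ζ * (θ ξ * w (ξ - horizontalEmb ζ)) := fun ξ => by ring
        simp only [a1, a2]
        rw [integral_const_mul, integral_const_mul, shift]
    _ = ∫ ξ, ∫ ζ, θ ξ * (F ζ * w (ξ - horizontalEmb ζ)) := (integral_integral_swap I2).symm
    _ = _ := by
        refine integral_congr_ae (Filter.Eventually.of_forall fun ξ => ?_)
        simp only [partialConv, integral_const_mul]

/-- Multiplication by a function of `x'`, in terms of its Fourier transform. -/
theorem exists_mul_complex [NeZero d] (k : ℕ) {C : ℝ} (hC0 : 0 ≤ C) {κ : 𝔼 d → ℝ≥0∞}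
    (hκ : Measurable κ)
    (hC : ∀ ξ : 𝔼 (d + 1), ∫⁻ ζ : 𝔼 d, κ ζ
        * ENNReal.ofReal ((1 + ‖ξ‖ ^ 2) ^ k / (1 + ‖ξ - horizontalEmb ζ‖ ^ 2) ^ k)
        ≤ ENNReal.ofReal C) :
    ∃ C' : ℝ, 0 ≤ C' ∧ ∀ (F : 𝔼 d → ℂ) (ρ : 𝔼 d → ℝ≥0∞) (R : ℝ), Integrable F →
      AEMeasurable ρ volume → (∀ᵐ ζ, ‖F ζ‖ₑ ^ 2 ≤ κ ζ * ρ ζ) → 0 ≤ R →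
      ∫⁻ ζ, ρ ζ ≤ ENNReal.ofReal (R ^ 2) → ∀ h : H (d + 1) k ℂ, ∃ U : H (d + 1) k ℂ,
        ((U : 𝔼 (d + 1) → ℂ) =ᵐ[volume] fun x => 𝓕⁻ F (horizontal x) * h x) ∧
        ‖U‖ ≤ C' * R * ‖h‖ := by
  obtain ⟨C₁, hC₁, hex⟩ := exists_of_sobolevEnergy_lt_top (d + 1) k
  obtain ⟨C₂, hC₂, hle⟩ := exists_sobolevEnergy_le (d + 1) k
  refine ⟨C₁ * √(C * C₂), by positivity, fun F ρ R hF hρ hFκ hR hρR h => ?_⟩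
  set v := partialConv F (𝓕 (H.toL2 h) : 𝕃 (d + 1) ℂ) with hv
  have hwm : Measurable ((𝓕 (H.toL2 h) : 𝕃 (d + 1) ℂ) : 𝔼 (d + 1) → ℂ) :=
    (Lp.stronglyMeasurable _).measurable
  have hvE : sobolevEnergy k v ≤ ENNReal.ofReal ((√(C * C₂) * R * ‖h‖) ^ 2) := by
    refine (sobolevEnergy_partialConv_le hκ hρ hFκ hC hwm).trans ?_
    calc _ ≤ ENNReal.ofReal C * ENNReal.ofReal (R ^ 2) * ENNReal.ofReal (C₂ * ‖h‖ ^ 2) :=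
          mul_le_mul' (mul_le_mul' le_rfl hρR) (hle h)
      _ = _ := by
          rw [← ENNReal.ofReal_mul hC0, ← ENNReal.ofReal_mul (by positivity), mul_pow, mul_pow,
            Real.sq_sqrt (by positivity)]
          congr 1
          ring
  have hvm : AEStronglyMeasurable v volume :=
    (aestronglyMeasurable_partialConv_kernel hF.1 hwm).integral_prod_right'
  have hv2 : MemLp v 2 volume := by
    refine ⟨hvm, ?_⟩
    rw [eLpNorm_lt_top_iff_lintegral_rpow_enorm_lt_top (by norm_num) (by norm_num)]
    refine lt_of_le_of_lt ?_
      (((sobolevEnergy_mono (Nat.zero_le k) _).trans hvE).trans_lt ENNReal.ofReal_lt_top)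
    simp [sobolevEnergy]
  have hFc : Continuous (𝓕⁻ F) :=
    VectorFourier.fourierIntegral_continuous Real.continuous_fourierChar (by
      change Continuous fun p : 𝔼 d × 𝔼 d => -inner ℝ p.1 p.2
      fun_prop) hF
  have hu2 : MemLp (fun x => 𝓕⁻ F (horizontal x) * h x) 2 volume := by
    refine (Lp.memLp (H.toL2 h)).of_le_mul (c := ∫ ζ, ‖F ζ‖)
      ((hFc.comp continuous_horizontal).aestronglyMeasurable.mul h.aestronglyMeasurable)
      (Filter.Eventually.of_forall fun x => ?_)
    rw [norm_mul]
    exact mul_le_mul_of_nonneg_right (norm_fourierInv_le _) (norm_nonneg _)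
  let u : 𝕃 (d + 1) ℂ := hu2.toLp _
  -- The transform on `L²` has no integral formula here, so the two functions are compared as
  -- tempered distributions, into which `L²` embeds injectively.
  have hFu : (𝓕 u : 𝕃 (d + 1) ℂ) = hv2.toLp v := by
    have hinj := LinearMap.ker_eq_bot.mp (Lp.ker_toTemperedDistributionCLM_eq_bot (F := ℂ)
      (E := 𝔼 (d + 1)) (μ := (volume : Measure (𝔼 (d + 1)))) (p := 2))
    refine hinj ?_
    change ((𝓕 u : 𝕃 (d + 1) ℂ) : 𝓢'(𝔼 (d + 1), ℂ)) = (hv2.toLp v : 𝓢'(𝔼 (d + 1), ℂ))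
    rw [← Lp.fourier_toTemperedDistribution_eq]
    ext θ
    rw [TemperedDistribution.fourier_apply, Lp.toTemperedDistribution_apply,
      Lp.toTemperedDistribution_apply]
    have e1 : ∫ x, 𝓕 θ x • u x = ∫ x, 𝓕 θ x * (𝓕⁻ F (horizontal x) * h x) :=
      integral_congr_ae (by filter_upwards [hu2.coeFn_toLp] with x hx; rw [hx, smul_eq_mul])
    have e2 : ∫ x, θ x • hv2.toLp v x = ∫ x, θ x * v x :=
      integral_congr_ae (by filter_upwards [hv2.coeFn_toLp] with x hx; rw [hx, smul_eq_mul])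
    rw [e1, e2, integral_fourier_mul_eq hF]
  obtain ⟨U, hU, hUn⟩ := hex u (√(C * C₂) * R * ‖h‖) (by positivity) (by
    rw [hFu, sobolevEnergy_congr hv2.coeFn_toLp]; exact hvE)
  refine ⟨U, ?_, by rw [mul_assoc, mul_assoc, ← mul_assoc √_]; exact hUn⟩
  rw [hU]
  exact hu2.coeFn_toLp

end FourierMultiplication

/-! ### Multiplication by `φ(xₙ) ζ(x') / b` and its derivatives on `H^k(ℝⁿ; V)`. -/

section Multipliers

open scoped ENNReal

variable {n d k : ℕ} {V : Type*} [NormedAddCommGroup V] [NormedSpace ℝ V] [CompleteSpace V]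

variable (k V) in
/-- Multiplication by `m` is bounded by `C` on `H^k(ℝⁿ; V)`. -/
def IsMultiplier (m : 𝔼 n → ℝ) (C : ℝ) : Prop :=
  ∀ h : H n k V, ∃ U : H n k V,
    ((U : 𝔼 n → V) =ᵐ[volume] fun x => m x • h x) ∧ ‖U‖ ≤ C * ‖h‖

namespace IsMultiplier

theorem add {m m' : 𝔼 n → ℝ} {C C' : ℝ} (h : IsMultiplier k V m C) (h' : IsMultiplier k V m' C') :
    IsMultiplier k V (fun x => m x + m' x) (C + C') := by
  intro f
  obtain ⟨U, hU, hUn⟩ := h f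
  obtain ⟨U', hU', hUn'⟩ := h' f
  refine ⟨U + U', ?_, (norm_add_le _ _).trans (by linarith)⟩
  filter_upwards [H.coeFn_add U U', hU, hU'] with x e1 e2 e3
  rw [e1, Pi.add_apply, e2, e3, add_smul]

theorem mul {m m' : 𝔼 n → ℝ} {C C' : ℝ} (hC : 0 ≤ C) (h : IsMultiplier k V m C)
    (h' : IsMultiplier k V m' C') : IsMultiplier k V (fun x => m x * m' x) (C * C') := by
  intro f
  obtain ⟨U', hU', hUn'⟩ := h' f
  obtain ⟨U, hU, hUn⟩ := h U'
  refine ⟨U, ?_, hUn.trans (by rw [mul_assoc]; gcongr)⟩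
  filter_upwards [hU, hU'] with x e1 e2
  rw [e1, e2, mul_smul]

/-- A family of multipliers depending linearly and boundedly on a parameter gives a bounded
bilinear map. -/
theorem exists_clm {Y : Type*} [NormedAddCommGroup Y] [NormedSpace ℝ Y] {m : Y → 𝔼 n → ℝ} {C : ℝ}
    (hm : ∀ y, IsMultiplier k V (m y) (C * ‖y‖)) (hadd : ∀ y y' x, m (y + y') x = m y x + m y' x)
    (hsmul : ∀ (c : ℝ) y x, m (c • y) x = c * m y x) :
    ∃ B : Y →L[ℝ] H n k V →L[ℝ] H n k V, ∀ y h,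
      (B y h : 𝔼 n → V) =ᵐ[volume] fun x => m y x • h x := by
  choose U hU hUn using hm
  refine ⟨LinearMap.mkContinuous₂ (LinearMap.mk₂ ℝ U ?_ ?_ ?_ ?_) C hUn, fun y h => hU y h⟩
  · intro y y' h
    refine H.ext_ae ?_
    filter_upwards [H.coeFn_add (U y h) (U y' h), hU (y + y') h, hU y h, hU y' h] with x e1 e2 e3 e4
    rw [e1, e2, Pi.add_apply, e3, e4, hadd, add_smul]
  · intro c y h
    refine H.ext_ae ?_
    filter_upwards [H.coeFn_smul c (U y h), hU (c • y) h, hU y h] with x e1 e2 e3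
    rw [e1, e2, Pi.smul_apply, e3, hsmul, mul_smul]
  · intro y h h'
    refine H.ext_ae ?_
    filter_upwards [H.coeFn_add (U y h) (U y h'), hU y (h + h'), hU y h, hU y h',
      H.coeFn_add h h'] with x e1 e2 e3 e4 e5
    rw [e1, e2, Pi.add_apply, e3, e4, e5, Pi.add_apply, smul_add]
  · intro c y h
    refine H.ext_ae ?_
    filter_upwards [H.coeFn_smul c (U y h), hU y (c • h), hU y h, H.coeFn_smul c h]
      with x e1 e2 e3 e4
    rw [e1, e2, Pi.smul_apply, e3, e4, Pi.smul_apply, smul_comm]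

variable (n k V) in
/-- A constant for passing from complex-valued to `V`-valued functions. -/
def vectorConst [FiniteDimensional ℝ V] : ℝ :=
  ∑ i, ‖H.mapL n k (axisC V i)‖ * ‖H.mapL n k (coordC V i)‖

theorem vectorConst_nonneg [FiniteDimensional ℝ V] : 0 ≤ vectorConst n k V :=
  Finset.sum_nonneg fun _ _ => mul_nonneg (norm_nonneg _) (norm_nonneg _)

/-- A scalar multiplier acts separately on each coordinate; the constant is the cost of splitting
into coordinates and reassembling. -/
theorem of_complex [FiniteDimensional ℝ V] {m : 𝔼 n → ℝ} {C : ℝ} (hC : 0 ≤ C)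
    (h : ∀ f : H n k ℂ, ∃ U : H n k ℂ,
      ((U : 𝔼 n → ℂ) =ᵐ[volume] fun x => (m x : ℂ) * f x) ∧ ‖U‖ ≤ C * ‖f‖) :
    IsMultiplier k V m (vectorConst n k V * C) := by
  intro f
  choose U hU hUn using fun i => h (H.mapL n k (coordC V i) f)
  refine ⟨∑ i, H.mapL n k (axisC V i) (U i), ?_, ?_⟩
  · refine (H.coeFn_finset_sum _ _).trans ?_
    have h1 : ∀ᵐ x, ∀ i, H.mapL n k (axisC V i) (U i) x = axisC V i (U i x) :=
      ae_all_iff.mpr fun i => H.coeFn_mapL _ _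
    have h2 : ∀ᵐ x, ∀ i, U i x = (m x : ℂ) * H.mapL n k (coordC V i) f x := ae_all_iff.mpr hU
    have h3 : ∀ᵐ x, ∀ i, H.mapL n k (coordC V i) f x = coordC V i (f x) :=
      ae_all_iff.mpr fun i => H.coeFn_mapL _ _
    filter_upwards [h1, h2, h3] with x e1 e2 e3
    simp only [e1, e2, e3, axisC_smul_coordC]
    rw [← Finset.smul_sum, sum_axisC_coordC]
  · rw [vectorConst, Finset.sum_mul, Finset.sum_mul]
    refine norm_sum_le_of_le _ fun i _ => ?_
    calc _ ≤ ‖H.mapL n k (axisC V i)‖ * (C * (‖H.mapL n k (coordC V i)‖ * ‖f‖)) := by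
          refine (ContinuousLinearMap.le_opNorm _ _).trans ?_
          gcongr
          refine (hUn i).trans ?_
          gcongr
          exact ContinuousLinearMap.le_opNorm _ _
      _ = _ := by ring

end IsMultiplier

/-- The product rule for weak derivatives. -/
theorem IsWeakDeriv.smul {i : Fin n} {u g : 𝕃 n V} (h : IsWeakDeriv (fun _ : Fin 1 => i) u g)
    {c : 𝔼 n → ℝ} (hc : ContDiff ℝ ∞ c) :
    IsWeakDeriv (fun _ : Fin 1 => i) (fun x => c x • u x)
      (fun x => c x • g x + partialDeriv (fun _ : Fin 1 => i) c x • u x) := by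
  intro θ hθ hθc
  -- The derivative relation for `u` is tested with `c θ`, and `c ∂ᵢθ = ∂ᵢ(c θ) - θ ∂ᵢc`.
  have hcθ : ContDiff ℝ ∞ fun x => c x * θ x := hc.mul hθ
  have hcθc : HasCompactSupport fun x => c x * θ x := hθc.mul_left
  have hc' := contDiff_partialDeriv (fun _ : Fin 1 => i) hc
  have hd : ContDiff ℝ ∞ fun x => θ x * partialDeriv (fun _ : Fin 1 => i) c x := hθ.mul hc'
  have hdc : HasCompactSupport fun x => θ x * partialDeriv (fun _ : Fin 1 => i) c x :=
    hθc.mul_right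
  have I1 := integrable_partialDeriv_smul (fun _ : Fin 1 => i) hcθ hcθc u
  have I2 := integrable_smul_test hd hdc u
  have I3 := integrable_smul_test hcθ hcθc g
  have e := h _ hcθ hcθc
  have e1 : ∀ x, partialDeriv (fun _ : Fin 1 => i) θ x • c x • u x
      = partialDeriv (fun _ : Fin 1 => i) (fun x => c x * θ x) x • u x
        - (θ x * partialDeriv (fun _ : Fin 1 => i) c x) • u x := fun x => by
    rw [partialDeriv_mul i (hc.differentiable (by simp)) (hθ.differentiable (by simp)),
      ← sub_smul, smul_smul]
    congr 1
    ring
  have e2 : ∀ x, θ x • (c x • g x + partialDeriv (fun _ : Fin 1 => i) c x • u x)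
      = (c x * θ x) • g x + (θ x * partialDeriv (fun _ : Fin 1 => i) c x) • u x := fun x => by
    rw [smul_add, smul_smul, smul_smul, mul_comm (θ x) (c x)]
  simp only [e1, e2]
  rw [integral_sub I1 I2, integral_add I3 I2, e]
  simp only [pow_one, neg_smul, one_smul]
  abel

theorem partialDeriv_comp_last (i : Fin (d + 1)) {c : ℝ → ℝ} (hc : Differentiable ℝ c)
    (x : 𝔼 (d + 1)) :
    partialDeriv (fun _ : Fin 1 => i) (fun x : 𝔼 (d + 1) => c (x (Fin.last d))) x
      = (if i = Fin.last d then 1 else 0) * deriv c (x (Fin.last d)) := by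
  rw [partialDeriv_one]
  have h1 : HasFDerivAt (fun x : 𝔼 (d + 1) => x (Fin.last d))
      (EuclideanSpace.proj (Fin.last d) : 𝔼 (d + 1) →L[ℝ] ℝ) x :=
    (EuclideanSpace.proj (Fin.last d) : 𝔼 (d + 1) →L[ℝ] ℝ).hasFDerivAt
  have h2 := ((hc (x (Fin.last d))).hasDerivAt.comp_hasFDerivAt x h1).fderiv
  have h3 : fderiv ℝ (fun x : 𝔼 (d + 1) => c (x (Fin.last d))) x = _ := h2
  rw [h3]
  simp [eq_comm, mul_comm]

/-- Multiplication by a test function of `x_n` is bounded on `H^k`. -/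
theorem exists_isMultiplier_comp_last (k : ℕ) {c : ℝ → ℝ} (hc : ContDiff ℝ ∞ c)
    (hcc : HasCompactSupport c) :
    ∃ C : ℝ, 0 ≤ C ∧ IsMultiplier k V (fun x : 𝔼 (d + 1) => c (x (Fin.last d))) C := by
  have base : ∀ c : ℝ → ℝ, Continuous c → HasCompactSupport c → ∃ C : ℝ, 0 ≤ C ∧
      ∀ u : 𝕃 (d + 1) V, ∃ w : 𝕃 (d + 1) V,
        ((w : 𝔼 (d + 1) → V) =ᵐ[volume] fun x => c (x (Fin.last d)) • u x) ∧ ‖w‖ ≤ C * ‖u‖ := by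
    intro c hc hcc
    obtain ⟨C, hC⟩ := hc.bounded_above_of_compact_support hcc
    have hC0 : 0 ≤ C := (norm_nonneg _).trans (hC 0)
    have hcm : Continuous fun x : 𝔼 (d + 1) => c (x (Fin.last d)) := by fun_prop
    have hle : ∀ (u : 𝕃 (d + 1) V) x, ‖c (x (Fin.last d)) • u x‖ ≤ C * ‖u x‖ := fun u x => by
      rw [norm_smul]
      exact mul_le_mul_of_nonneg_right (hC _) (norm_nonneg _)
    have hL : ∀ u : 𝕃 (d + 1) V, MemLp (fun x => c (x (Fin.last d)) • u x) 2 volume := fun u =>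
      (Lp.memLp u).of_le_mul (hcm.aestronglyMeasurable.smul (Lp.memLp u).1)
        (Filter.Eventually.of_forall (hle u))
    refine ⟨C, hC0, fun u => ⟨(hL u).toLp _, (hL u).coeFn_toLp, ?_⟩⟩
    refine Lp.norm_le_mul_norm_of_ae_le_mul ?_
    filter_upwards [(hL u).coeFn_toLp] with x hx
    rw [hx]
    exact hle u x
  -- The product rule brings in `c'`, again a test function of `xₙ`, so the hypothesis must hold for
  -- all `c`.
  induction k generalizing c with
  | zero =>
    obtain ⟨C, hC, h⟩ := base c hc.continuous hcc
    refine ⟨H.numJet (d + 1) 0 * C, by positivity, fun f => ?_⟩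
    obtain ⟨w, hw, hwn⟩ := h (H.toL2 f)
    refine ⟨H.ofL2 (d + 1) V w, hw, (H.norm_zero_le _).trans ?_⟩
    rw [mul_assoc]
    gcongr
    exact hwn.trans (mul_le_mul_of_nonneg_left (H.norm_toL2_le f) hC)
  | succ k ih =>
    have hc' : ContDiff ℝ ∞ (deriv c) := (contDiff_infty_iff_deriv.mp hc).2
    obtain ⟨C₀, hC₀, h0⟩ := base c hc.continuous hcc
    obtain ⟨C₁, hC₁, h1⟩ := ih hc hcc
    obtain ⟨C₂, hC₂, h2⟩ := ih hc' hcc.deriv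
    have hcs : ContDiff ℝ ∞ fun x : 𝔼 (d + 1) => c (x (Fin.last d)) := by fun_prop
    refine ⟨H.numJet (d + 1) (k + 1) * (C₀ + ∑ i : Fin (d + 1), (C₁ * ‖H.pd V k i‖
      + C₂ * ‖H.incl (d + 1) k V‖)), by positivity, fun f => ?_⟩
    obtain ⟨w, hw, hwn⟩ := h0 (H.toL2 f)
    choose G hG hGn using fun i => h1 (H.pd V k i f)
    obtain ⟨G', hG', hGn'⟩ := h2 (H.incl (d + 1) k V f)
    let g : Fin (d + 1) → H (d + 1) k V := fun i =>
      G i + (if i = Fin.last d then (1 : ℝ) else 0) • G'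
    obtain ⟨U, hU, hUi⟩ := H.exists_of_isWeakDeriv w g fun i => by
      refine ((H.isWeakDeriv_pd i f).smul hcs).congr hw.symm ?_
      filter_upwards [H.coeFn_add (G i) ((if i = Fin.last d then (1 : ℝ) else 0) • G'),
        H.coeFn_smul (if i = Fin.last d then (1 : ℝ) else 0) G', hG i, hG'] with x e1 e2 e3 e4
      rw [e1, Pi.add_apply, e2, Pi.smul_apply, e3, e4,
        partialDeriv_comp_last i (hc.differentiable (by simp)), mul_smul]
      rfl
    refine ⟨U, by rw [hU]; exact hw, (H.norm_succ_le U).trans ?_⟩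
    rw [mul_assoc, hU, add_mul, Finset.sum_mul]
    gcongr with i
    · exact hwn.trans (mul_le_mul_of_nonneg_left (H.norm_toL2_le f) hC₀)
    · rw [hUi, add_mul]
      refine (norm_add_le _ _).trans (add_le_add ?_ ?_)
      · refine (hGn i).trans ?_
        rw [mul_assoc]
        gcongr
        exact ContinuousLinearMap.le_opNorm _ _
      · calc _ ≤ 1 * ‖G'‖ := by
              rw [norm_smul]
              gcongr
              split_ifs <;> simp
          _ ≤ C₂ * (‖H.incl (d + 1) k V‖ * ‖f‖) := by
              rw [one_mul]
              refine hGn'.trans ?_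
              gcongr
              exact ContinuousLinearMap.le_opNorm _ _
          _ = _ := by ring

variable [NeZero d] {s : ℕ} [FiniteDimensional ℝ V]

/-- Taking `κ = |ζ|^{2p}/ω` and `ρ = A² ω |η̂|²`, the assumed domination of `F` gives `|F|² ≤ κ ρ`
and `∫ ρ = A² ‖η‖²`. It is used for `η` itself with `p = 0` and for a directional derivative of `η`
with `p = 1`. -/
theorem exists_isMultiplier_of_fourier (hs : ((d + 1 : ℕ) : ℝ) / 2 < s) {p : ℕ} (hp : p ≤ 1)
    (hkp : k + p ≤ s) :
    ∃ C : ℝ, 0 ≤ C ∧ ∀ (η : X d (s + 1 / 2)) (F : 𝔼 d → ℂ) (m : 𝔼 d → ℝ) (A : ℝ), 0 ≤ A →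
      AEStronglyMeasurable F volume → (∀ ζ, ‖F ζ‖ ≤ A * (‖ζ‖ ^ p * ‖X.fourierFun η ζ‖)) →
      (∀ x, (m x : ℂ) = 𝓕⁻ F x) →
      IsMultiplier k V (fun x : 𝔼 (d + 1) => m (horizontal x)) (C * (A * ‖η‖)) := by
  obtain ⟨C, hC, hker⟩ := exists_lintegral_kernel_le hs hp hkp
  have hw : Measurable fun ζ : 𝔼 d => weight ((s : ℝ) + 1 / 2) ζ :=
    measurable_weight _
  obtain ⟨C', hC', hmul⟩ := exists_mul_complex k hC (κ := fun ζ : 𝔼 d =>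
    ENNReal.ofReal (‖ζ‖ ^ (2 * p) / weight ((s : ℝ) + 1 / 2) ζ)) (by fun_prop) hker
  refine ⟨IsMultiplier.vectorConst (d + 1) k V * C', mul_nonneg IsMultiplier.vectorConst_nonneg hC',
    fun η F m A hA hFm hF hm => ?_⟩
  rw [mul_assoc]
  refine IsMultiplier.of_complex (by positivity) fun f => ?_
  have hη := X.aestronglyMeasurable_fourierFun η
  have hFi : Integrable F :=
    ((X.integrable_pow_mul_fourierFun hs hp (by omega) η).const_mul A).mono' hFm
      (Filter.Eventually.of_forall hF)
  obtain ⟨U, hU, hUn⟩ := hmul F (fun ζ => ENNReal.ofReal (A ^ 2)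
      * (ENNReal.ofReal (weight ((s : ℝ) + 1 / 2) ζ) * ‖X.fourierFun η ζ‖ₑ ^ 2)) (A * ‖η‖) hFi
    ((hw.ennreal_ofReal.aemeasurable.mul (hη.enorm.pow_const 2)).const_mul _) (by
      filter_upwards [(measure_eq_zero_iff_ae_notMem (s := {(0 : 𝔼 d)})).mp
        (measure_singleton _)] with ζ hζ
      have hw0 := weight_pos ((s : ℝ) + 1 / 2) (ξ := ζ) (by simpa using hζ)
      rw [← ofReal_norm, ← ofReal_norm, ← ENNReal.ofReal_pow (norm_nonneg _),
        ← ENNReal.ofReal_pow (norm_nonneg _), ← ENNReal.ofReal_mul hw0.le,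
        ← ENNReal.ofReal_mul (by positivity), ← ENNReal.ofReal_mul (by positivity)]
      refine ENNReal.ofReal_le_ofReal ?_
      calc ‖F ζ‖ ^ 2 ≤ (A * (‖ζ‖ ^ p * ‖X.fourierFun η ζ‖)) ^ 2 := by
            gcongr; exact hF ζ
        _ = _ := by
            rw [pow_mul']
            generalize weight ((s : ℝ) + 1 / 2) ζ = w at hw0 ⊢
            field_simp) (by positivity) (by
      rw [lintegral_const_mul' _ _ ENNReal.ofReal_ne_top, X.lintegral_weight_mul,
        ← ENNReal.ofReal_mul (by positivity), mul_pow]) f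
  refine ⟨U, ?_, hUn⟩
  simpa only [hm] using hU

/-- The vertical displacement `φ(x_n) ζ(x') / b`. -/
def amp (b : ℝ) (ψ : ℝ → ℝ) (ζ : X d (s + 1 / 2)) (x : 𝔼 (d + 1)) : ℝ :=
  x (Fin.last d) * ψ (x (Fin.last d)) / b * ζ (horizontal x)

variable {b : ℝ} {ψ : ℝ → ℝ}

theorem amp_add (hs : ((d + 1 : ℕ) : ℝ) / 2 < s) (η ζ : X d (s + 1 / 2)) (x : 𝔼 (d + 1)) :
    amp b ψ (η + ζ) x = amp b ψ η x + amp b ψ ζ x := by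
  rw [amp, X.toFun_add hs, mul_add]; rfl

theorem amp_smul (hs : ((d + 1 : ℕ) : ℝ) / 2 < s) (c : ℝ) (ζ : X d (s + 1 / 2)) (x : 𝔼 (d + 1)) :
    amp b ψ (c • ζ) x = c * amp b ψ ζ x := by
  rw [amp, X.toFun_smul hs, mul_left_comm]; rfl

theorem IsCutoff.contDiff_profile (hψ : IsCutoff b ψ) : ContDiff ℝ ∞ fun t => t * ψ t / b :=
  (contDiff_id.mul hψ.contDiff).div_const b

theorem IsCutoff.hasCompactSupport_profile (hψ : IsCutoff b ψ) :
    HasCompactSupport fun t => t * ψ t / b :=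
  (hψ.hasCompactSupport.mul_left (f := fun t => t)).mul_right (f' := fun _ => b⁻¹)

theorem hasFDerivAt_amp (hs : ((d + 1 : ℕ) : ℝ) / 2 < s) (hψ : IsCutoff b ψ)
    (ζ : X d (s + 1 / 2)) (x : 𝔼 (d + 1)) :
    HasFDerivAt (amp b ψ ζ)
      ((x (Fin.last d) * ψ (x (Fin.last d)) / b) • (fderiv ℝ ζ (horizontal x) ∘L horizontalL d)
        + ζ (horizontal x) • (deriv (fun t => t * ψ t / b) (x (Fin.last d))
          • (EuclideanSpace.proj (Fin.last d) : 𝔼 (d + 1) →L[ℝ] ℝ))) x := by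
  have h1 : HasFDerivAt (fun x : 𝔼 (d + 1) => x (Fin.last d))
      (EuclideanSpace.proj (Fin.last d) : 𝔼 (d + 1) →L[ℝ] ℝ) x :=
    (EuclideanSpace.proj (Fin.last d) : 𝔼 (d + 1) →L[ℝ] ℝ).hasFDerivAt
  have h2 := ((hψ.contDiff_profile.differentiable (by simp)
    (x (Fin.last d))).hasDerivAt.comp_hasFDerivAt x h1)
  have h3 : HasFDerivAt (fun x : 𝔼 (d + 1) => ζ (horizontal x))
      (fderiv ℝ ζ (horizontal x) ∘L horizontalL d) x :=
    HasFDerivAt.comp x (((X.contDiff_toFun hs ζ).differentiable (by simp)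
      (horizontal x)).hasFDerivAt) (horizontalL d).hasFDerivAt
  exact h2.mul h3

theorem contDiff_amp (hs : ((d + 1 : ℕ) : ℝ) / 2 < s) (hψ : IsCutoff b ψ) (ζ : X d (s + 1 / 2)) :
    ContDiff ℝ 1 (amp b ψ ζ) := by
  have h1 : ContDiff ℝ 1 fun x : 𝔼 (d + 1) => x (Fin.last d) * ψ (x (Fin.last d)) / b :=
    (hψ.contDiff_profile.of_le (by simp)).comp
      (EuclideanSpace.proj (Fin.last d) : 𝔼 (d + 1) →L[ℝ] ℝ).contDiff
  exact h1.mul ((X.contDiff_toFun hs ζ).comp (horizontalL d).contDiff)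

theorem fderiv_amp_add (hs : ((d + 1 : ℕ) : ℝ) / 2 < s) (hψ : IsCutoff b ψ)
    (η ζ : X d (s + 1 / 2)) (x : 𝔼 (d + 1)) :
    fderiv ℝ (amp b ψ (η + ζ)) x = fderiv ℝ (amp b ψ η) x + fderiv ℝ (amp b ψ ζ) x := by
  have h : amp b ψ (η + ζ) = amp b ψ η + amp b ψ ζ := funext fun x => amp_add hs η ζ x
  rw [h, fderiv_add ((contDiff_amp hs hψ η).differentiable (by simp) x)
    ((contDiff_amp hs hψ ζ).differentiable (by simp) x)]

theorem fderiv_amp_smul (hs : ((d + 1 : ℕ) : ℝ) / 2 < s) (hψ : IsCutoff b ψ) (c : ℝ)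
    (ζ : X d (s + 1 / 2)) (x : 𝔼 (d + 1)) :
    fderiv ℝ (amp b ψ (c • ζ)) x = c • fderiv ℝ (amp b ψ ζ) x := by
  have h : amp b ψ (c • ζ) = c • amp b ψ ζ := funext fun x => amp_smul hs c ζ x
  rw [h, fderiv_const_smul ((contDiff_amp hs hψ ζ).differentiable (by simp) x)]

theorem exists_amp_bounds (hs : ((d + 1 : ℕ) : ℝ) / 2 < s) (hψ : IsCutoff b ψ) :
    ∃ C : ℝ, 0 ≤ C ∧ ∀ (ζ : X d (s + 1 / 2)) (x : 𝔼 (d + 1)), |amp b ψ ζ x| ≤ C * ‖ζ‖ ∧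
      ‖fderiv ℝ (amp b ψ ζ) x‖ ≤ C * ‖ζ‖ := by
  obtain ⟨C, hC, h⟩ := X.exists_bounds (d := d) hs
  obtain ⟨A, hA⟩ := hψ.contDiff_profile.continuous.bounded_above_of_compact_support
    hψ.hasCompactSupport_profile
  have hd : Continuous (deriv fun t => t * ψ t / b) :=
    (contDiff_infty_iff_deriv.mp hψ.contDiff_profile).2.continuous
  obtain ⟨A', hA'⟩ := hd.bounded_above_of_compact_support hψ.hasCompactSupport_profile.deriv
  have hA0 : 0 ≤ A := (norm_nonneg _).trans (hA 0)
  have hA0' : 0 ≤ A' := (norm_nonneg _).trans (hA' 0)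
  let P : ℝ := ‖(EuclideanSpace.proj (Fin.last d) : 𝔼 (d + 1) →L[ℝ] ℝ)‖
  refine ⟨A * C + A * (C * ‖horizontalL d‖) + C * (A' * P), by positivity, fun ζ x => ⟨?_, ?_⟩⟩
  · have h1 : |amp b ψ ζ x| ≤ A * (C * ‖ζ‖) := by
      rw [amp, abs_mul]
      exact mul_le_mul (hA _) (h ζ _).1 (abs_nonneg _) hA0
    have h2 : 0 ≤ (A * (C * ‖horizontalL d‖) + C * (A' * P)) * ‖ζ‖ := by positivity
    linarith
  · rw [(hasFDerivAt_amp hs hψ ζ x).fderiv]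
    have h1 : ‖(x (Fin.last d) * ψ (x (Fin.last d)) / b)
        • (fderiv ℝ ζ (horizontal x) ∘L horizontalL d)‖ ≤ A * (C * ‖ζ‖ * ‖horizontalL d‖) := by
      rw [norm_smul]
      refine mul_le_mul (hA _) ?_ (norm_nonneg _) hA0
      refine (ContinuousLinearMap.opNorm_comp_le _ _).trans ?_
      gcongr
      exact (h ζ _).2
    have h2 : ‖ζ (horizontal x) • (deriv (fun t => t * ψ t / b) (x (Fin.last d))
          • (EuclideanSpace.proj (Fin.last d) : 𝔼 (d + 1) →L[ℝ] ℝ))‖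
        ≤ C * ‖ζ‖ * (A' * P) := by
      rw [norm_smul, norm_smul]
      refine mul_le_mul (h ζ _).1 ?_ (by positivity) (by positivity)
      exact mul_le_mul_of_nonneg_right (hA' _) (norm_nonneg _)
    have h3 : 0 ≤ A * C * ‖ζ‖ := by positivity
    refine (norm_add_le _ _).trans ?_
    linarith

/-- Multiplication by `φ(x_n) ζ(x') / b` on `H^k`, `k ≤ s`. -/
theorem exists_ampMul (hs : ((d + 1 : ℕ) : ℝ) / 2 < s) (hψ : IsCutoff b ψ) (hk : k ≤ s) :
    ∃ B : X d (s + 1 / 2) →L[ℝ] H (d + 1) k V →L[ℝ] H (d + 1) k V, ∀ ζ h,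
      (B ζ h : 𝔼 (d + 1) → V) =ᵐ[volume] fun x => amp b ψ ζ x • h x := by
  obtain ⟨C, hC, h⟩ := exists_isMultiplier_of_fourier (d := d) (V := V) hs zero_le_one
    (k := k) (by omega)
  obtain ⟨C', hC', h'⟩ := exists_isMultiplier_comp_last (d := d) (V := V) k hψ.contDiff_profile
    hψ.hasCompactSupport_profile
  refine IsMultiplier.exists_clm (C := C' * C) (fun ζ => ?_) (amp_add hs) (amp_smul hs)
  have h1 := h ζ (X.fourierFun ζ) ζ 1 zero_le_one (X.aestronglyMeasurable_fourierFun ζ)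
    (fun ξ => by simp) (X.ofReal_toFun hs ζ)
  rw [one_mul] at h1
  rw [mul_assoc]
  have hmul := h'.mul hC' h1
  exact hmul

/-- Multiplication by a derivative of `φ(x_n) ζ(x') / b` on `H^k`, `k + 1 ≤ s`. -/
theorem exists_fderivAmpMul (hs : ((d + 1 : ℕ) : ℝ) / 2 < s) (hψ : IsCutoff b ψ) (hk : k + 1 ≤ s)
    (v : 𝔼 (d + 1)) :
    ∃ B : X d (s + 1 / 2) →L[ℝ] H (d + 1) k V →L[ℝ] H (d + 1) k V, ∀ ζ h,
      (B ζ h : 𝔼 (d + 1) → V) =ᵐ[volume] fun x => fderiv ℝ (amp b ψ ζ) x v • h x := by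
  obtain ⟨C₀, hC₀, h0⟩ := exists_isMultiplier_of_fourier (d := d) (V := V) hs zero_le_one
    (k := k) (by omega)
  obtain ⟨C₁, hC₁, h1⟩ := exists_isMultiplier_of_fourier (d := d) (V := V) hs le_rfl hk
  obtain ⟨A, hA, g0⟩ := exists_isMultiplier_comp_last (d := d) (V := V) k hψ.contDiff_profile
    hψ.hasCompactSupport_profile
  have hc' : ContDiff ℝ ∞ fun t => v (Fin.last d) * deriv (fun t => t * ψ t / b) t :=
    contDiff_const.mul (contDiff_infty_iff_deriv.mp hψ.contDiff_profile).2
  obtain ⟨A', hA', g1⟩ := exists_isMultiplier_comp_last (d := d) (V := V) k hc'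
    (hψ.hasCompactSupport_profile.deriv.mul_left)
  let w : 𝔼 d := horizontal v
  refine IsMultiplier.exists_clm (C := A * (C₁ * (2 * Real.pi * ‖w‖)) + A' * C₀) (fun ζ => ?_)
    (fun η ζ x => by rw [fderiv_amp_add hs hψ]; rfl)
    (fun c ζ x => by rw [fderiv_amp_smul hs hψ]; rfl)
  have k0 := h0 ζ (X.fourierFun ζ) ζ 1 zero_le_one (X.aestronglyMeasurable_fourierFun ζ)
    (fun ξ => by simp) (X.ofReal_toFun hs ζ)
  have hin : Continuous fun ξ : 𝔼 d => 2 * Real.pi * Complex.I * ((inner ℝ ξ w : ℝ) : ℂ) := by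
    fun_prop
  have k1 := h1 ζ (fun ξ => (2 * Real.pi * Complex.I * inner ℝ ξ w) * X.fourierFun ζ ξ)
    (fun x => fderiv ℝ ζ x w) (2 * Real.pi * ‖w‖) (by positivity)
    (hin.aestronglyMeasurable.mul (X.aestronglyMeasurable_fourierFun ζ))
    (fun ξ => by
      rw [norm_mul, norm_mul, norm_mul, norm_mul, Complex.norm_I, Complex.norm_real,
        Complex.norm_real, Complex.norm_ofNat, pow_one, mul_one, Real.norm_of_nonneg Real.pi_nonneg]
      have := norm_inner_le_norm (𝕜 := ℝ) ξ w
      calc _ ≤ 2 * Real.pi * (‖ξ‖ * ‖w‖) * ‖X.fourierFun ζ ξ‖ := by gcongr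
        _ = _ := by ring)
    (fun x => X.ofReal_fderiv hs ζ x w)
  -- The product rule in the direction `v`: profile times `∂_w ζ`, plus `vₙ` times the profile's
  -- derivative times `ζ`.
  have key := (g0.mul hA k1).add (g1.mul hA' k0)
  have e1 : (fun x : 𝔼 (d + 1) => x (Fin.last d) * ψ (x (Fin.last d)) / b
      * fderiv ℝ ζ (horizontal x) w
      + v (Fin.last d) * deriv (fun t => t * ψ t / b) (x (Fin.last d)) * ζ (horizontal x))
      = fun x => fderiv ℝ (amp b ψ ζ) x v := by
    funext x
    rw [(hasFDerivAt_amp hs hψ ζ x).fderiv]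
    simp only [add_apply, smul_apply,
      ContinuousLinearMap.comp_apply, horizontalL_apply, smul_eq_mul, w]
    have e : (EuclideanSpace.proj (Fin.last d) : 𝔼 (d + 1) →L[ℝ] ℝ) v = v (Fin.last d) := rfl
    rw [e]
    ring
  rw [e1] at key
  have e2 : (A * (C₁ * (2 * Real.pi * ‖w‖)) + A' * C₀) * ‖ζ‖
      = A * (C₁ * (2 * Real.pi * ‖w‖ * ‖ζ‖)) + A' * (C₀ * (1 * ‖ζ‖)) := by ring
  rw [e2]
  exact key

end Multipliers

/-! ### The map `𝔈_η`: invertibility, distortion of volume, admissible radii. -/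

section Geometry

open scoped ENNReal NNReal

variable {n d : ℕ}

/-- By the mean value inequality `Φ - id` is `1/2`-Lipschitz, so `|Φ x - Φ y| ≥ |x - y| / 2`. -/
theorem antilipschitzWith_two_of_fderiv_sub_id_le {Φ : 𝔼 n → 𝔼 n} (hd : Differentiable ℝ Φ)
    (h : ∀ x, ‖fderiv ℝ Φ x - ContinuousLinearMap.id ℝ _‖ ≤ 1 / 2) : AntilipschitzWith 2 Φ := by
  refine AntilipschitzWith.of_le_mul_dist fun x y => ?_
  rw [dist_eq_norm, dist_eq_norm]
  have h1 := Convex.norm_image_sub_le_of_norm_fderiv_le' (f := Φ) (s := Set.univ)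
      (φ := ContinuousLinearMap.id ℝ (𝔼 n)) (fun x _ => hd x) (fun x _ => h x) convex_univ
      (Set.mem_univ y) (Set.mem_univ x)
  have h2 := norm_sub_norm_le (x - y) (Φ x - Φ y)
  rw [norm_sub_rev (x - y)] at h2
  rw [ContinuousLinearMap.id_apply] at h1
  have h3 : ((2 : ℝ≥0) : ℝ) = 2 := rfl
  rw [h3]
  linarith

/-- A perturbation of the identity with small derivative is a bi-Lipschitz `C¹` diffeomorphism. -/
theorem exists_inverse_of_fderiv_sub_id_le {Φ : 𝔼 n → 𝔼 n} (hΦ : ContDiff ℝ 1 Φ)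
    (h : ∀ x, ‖fderiv ℝ Φ x - ContinuousLinearMap.id ℝ _‖ ≤ 1 / 4) :
    ∃ G : 𝔼 n → 𝔼 n, Function.LeftInverse G Φ ∧ Function.RightInverse G Φ ∧
      (∃ K, LipschitzWith K Φ) ∧ (∃ K, LipschitzWith K G) ∧ ContDiff ℝ 1 Φ ∧ ContDiff ℝ 1 G := by
  have hd : Differentiable ℝ Φ := hΦ.differentiable (by simp)
  -- `Φ - id` is a contraction, so the quantitative inverse function theorem on the whole space
  -- gives a global homeomorphism; its inverse is `C¹` because each derivative of `Φ` is invertible.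
  have happ : ApproximatesLinearOn Φ ((ContinuousLinearEquiv.refl ℝ (𝔼 n) : 𝔼 n ≃L[ℝ] 𝔼 n) :
      𝔼 n →L[ℝ] 𝔼 n) Set.univ (1 / 4 : ℝ≥0) := by
    intro x _ y _
    have := Convex.norm_image_sub_le_of_norm_fderiv_le' (f := Φ) (s := Set.univ)
      (φ := ContinuousLinearMap.id ℝ (𝔼 n)) (fun x _ => hd x) (fun x _ => h x) convex_univ
      (Set.mem_univ y) (Set.mem_univ x)
    simpa using this
  have hc : Subsingleton (𝔼 n) ∨
      (1 / 4 : ℝ≥0) < ‖((ContinuousLinearEquiv.refl ℝ (𝔼 n)).symm : 𝔼 n →L[ℝ] 𝔼 n)‖₊⁻¹ := by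
    rcases subsingleton_or_nontrivial (𝔼 n) with hn | hn
    · exact Or.inl hn
    · right
      have : ‖((ContinuousLinearEquiv.refl ℝ (𝔼 n)).symm : 𝔼 n →L[ℝ] 𝔼 n)‖₊ = 1 := by
        simp
      rw [this, inv_one, ← NNReal.coe_lt_coe]
      norm_num
  let e : 𝔼 n ≃ₜ 𝔼 n := happ.toHomeomorph Φ hc
  have he : ∀ x, e x = Φ x := fun _ => rfl
  have hanti : AntilipschitzWith 2 Φ :=
    antilipschitzWith_two_of_fderiv_sub_id_le hd fun x => (h x).trans (by norm_num)
  have hequiv : ∀ x, ∃ L : 𝔼 n ≃L[ℝ] 𝔼 n, (L : 𝔼 n →L[ℝ] 𝔼 n) = fderiv ℝ Φ x := by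
    intro x
    have hinj : Function.Injective (fderiv ℝ Φ x).toLinearMap := by
      rw [injective_iff_map_eq_zero]
      intro v hv
      have h1 := (fderiv ℝ Φ x - ContinuousLinearMap.id ℝ _).le_of_opNorm_le (h x) v
      have h2 : fderiv ℝ Φ x v = 0 := hv
      rw [sub_apply, h2, zero_sub, norm_neg, ContinuousLinearMap.id_apply] at h1
      exact norm_le_zero_iff.mp (by linarith [norm_nonneg v])
    exact ⟨(LinearEquiv.ofInjectiveEndo _ hinj).toContinuousLinearEquiv, by ext v; rfl⟩
  choose L hL using hequiv
  refine ⟨e.symm, e.symm_apply_apply, e.apply_symm_apply, ⟨5 / 4, ?_⟩, ⟨2, ?_⟩, hΦ, ?_⟩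
  · refine lipschitzWith_of_nnnorm_fderiv_le (𝕜 := ℝ) hd fun x => ?_
    rw [← NNReal.coe_le_coe, coe_nnnorm]
    have h1 := norm_add_le (fderiv ℝ Φ x - ContinuousLinearMap.id ℝ _)
      (ContinuousLinearMap.id ℝ (𝔼 n))
    rw [sub_add_cancel] at h1
    have h2 := ContinuousLinearMap.norm_id_le (𝕜 := ℝ) (E := 𝔼 n)
    have h3 := h x
    push_cast
    linarith
  · refine LipschitzWith.of_dist_le_mul fun x y => ?_
    have := hanti.le_mul_dist (e.symm x) (e.symm y)
    rw [← he, ← he, e.apply_symm_apply, e.apply_symm_apply] at this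
    exact this
  · exact e.contDiff_symm (f₀' := L) (fun x => by rw [hL]; exact (hd x).hasFDerivAt) hΦ

/-- An antilipschitz map with constant `2` enlarges the `n`-dimensional Hausdorff measure of
preimages at most `2ⁿ` times, and Lebesgue measure is a multiple of that measure. No Jacobian is
involved. -/
theorem map_volume_le {Φ : 𝔼 n → 𝔼 n} (hΦ : Continuous Φ) (h : AntilipschitzWith 2 Φ) :
    Measure.map Φ (volume : Measure (𝔼 n)) ≤ (2 ^ n : ℝ≥0∞) • volume := by
  have hH : (Measure.hausdorffMeasure (n : ℝ) : Measure (𝔼 n)).IsAddHaarMeasure := by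
    have := isAddHaarMeasure_hausdorffMeasure (E := 𝔼 n)
    rwa [finrank_euclideanSpace_fin] at this
  have hv := Measure.isAddLeftInvariant_eq_smul (volume : Measure (𝔼 n))
    (Measure.hausdorffMeasure (n : ℝ) : Measure (𝔼 n))
  refine Measure.le_iff.mpr fun s hs => ?_
  rw [Measure.map_apply hΦ.measurable hs, Measure.smul_apply, smul_eq_mul, hv, Measure.smul_apply,
    Measure.smul_apply]
  have := h.hausdorffMeasure_preimage_le (Nat.cast_nonneg n : (0 : ℝ) ≤ n) s
  rw [ENNReal.rpow_natCast] at this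
  simp only [ENNReal.smul_def, smul_eq_mul]
  rw [mul_left_comm]
  gcongr
  exact this

theorem quasiMeasurePreserving_of_antilipschitz {Φ : 𝔼 n → 𝔼 n} (hΦ : Continuous Φ)
    (h : AntilipschitzWith 2 Φ) : Measure.QuasiMeasurePreserving Φ volume volume :=
  ⟨hΦ.measurable, (Measure.absolutelyContinuous_of_le (map_volume_le hΦ h)).trans
    Measure.smul_absolutelyContinuous⟩

variable {V : Type*} [NormedAddCommGroup V] [NormedSpace ℝ V]

variable (n) in
/-- The bound for composition on `L²`. -/
def compConst : ℝ := ((2 ^ n : ℝ≥0∞) ^ (1 / (2 : ℝ≥0∞)).toReal).toReal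

theorem compConst_nonneg : 0 ≤ compConst n := ENNReal.toReal_nonneg

theorem eLpNorm_comp_le {Φ : 𝔼 n → 𝔼 n} (hΦ : Continuous Φ) (h : AntilipschitzWith 2 Φ)
    {u : 𝔼 n → V} (hu : AEStronglyMeasurable u volume) :
    eLpNorm (u ∘ Φ) 2 volume ≤ ENNReal.ofReal (compConst n) * eLpNorm u 2 volume := by
  have hle := map_volume_le hΦ h
  rw [← eLpNorm_map_measure ?_ hΦ.measurable.aemeasurable]
  · refine (eLpNorm_mono_measure u hle).trans (le_of_eq ?_)
    rw [eLpNorm_smul_measure_of_ne_top (by norm_num), smul_eq_mul, compConst,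
      ENNReal.ofReal_toReal]
    exact ENNReal.rpow_ne_top_of_nonneg (by positivity) (by simp)
  · exact hu.mono_ac (quasiMeasurePreserving_of_antilipschitz hΦ h).absolutelyContinuous

theorem memLp_comp {Φ : 𝔼 n → 𝔼 n} (hΦ : Continuous Φ) (h : AntilipschitzWith 2 Φ)
    {u : 𝔼 n → V} (hu : MemLp u 2 volume) : MemLp (u ∘ Φ) 2 volume :=
  ⟨hu.1.comp_quasiMeasurePreserving (quasiMeasurePreserving_of_antilipschitz hΦ h),
    (eLpNorm_comp_le hΦ h hu.1).trans_lt (ENNReal.mul_lt_top ENNReal.ofReal_lt_top hu.2)⟩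

variable (V) in
/-- Composition with `Φ` on `L²`. -/
def compL2 {Φ : 𝔼 n → 𝔼 n} (hΦ : Continuous Φ) (h : AntilipschitzWith 2 Φ) :
    𝕃 n V →L[ℝ] 𝕃 n V :=
  LinearMap.mkContinuous
    { toFun := fun u => (memLp_comp hΦ h (Lp.memLp u)).toLp _
      map_add' := fun u v => by
        rw [← MemLp.toLp_add]
        exact (MemLp.toLp_eq_toLp_iff _ _).mpr
          ((quasiMeasurePreserving_of_antilipschitz hΦ h).ae_eq_comp (Lp.coeFn_add u v))
      map_smul' := fun c u => by
        rw [RingHom.id_apply, ← MemLp.toLp_const_smul]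
        exact (MemLp.toLp_eq_toLp_iff _ _).mpr
          ((quasiMeasurePreserving_of_antilipschitz hΦ h).ae_eq_comp (Lp.coeFn_smul c u)) }
    (compConst n) fun u => by
      refine (Lp.norm_toLp _ (memLp_comp hΦ h (Lp.memLp u))).le.trans ?_
      refine ENNReal.toReal_le_of_le_ofReal (mul_nonneg compConst_nonneg (norm_nonneg _)) ?_
      rw [ENNReal.ofReal_mul compConst_nonneg, ofReal_norm, Lp.enorm_def]
      exact eLpNorm_comp_le hΦ h (Lp.memLp u).1

theorem coeFn_compL2 {Φ : 𝔼 n → 𝔼 n} (hΦ : Continuous Φ) (h : AntilipschitzWith 2 Φ)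
    (u : 𝕃 n V) : (compL2 V hΦ h u : 𝔼 n → V) =ᵐ[volume] fun x => u (Φ x) :=
  (memLp_comp hΦ h (Lp.memLp u)).coeFn_toLp

theorem norm_compL2_le {Φ : 𝔼 n → 𝔼 n} (hΦ : Continuous Φ) (h : AntilipschitzWith 2 Φ)
    (u : 𝕃 n V) : ‖compL2 V hΦ h u‖ ≤ compConst n * ‖u‖ :=
  (compL2 V hΦ h).le_of_opNorm_le (LinearMap.mkContinuous_norm_le _ compConst_nonneg _) u

variable [NeZero d] {s : ℕ} {b : ℝ} {ψ : ℝ → ℝ}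

/-- Only the last coordinate moves; this is the form `x + a(x) eⱼ` required by the chain rule
`isWeakDeriv_comp`. -/
theorem E_eq (η : X d (s + 1 / 2)) (x : 𝔼 (d + 1)) :
    E b ψ η x = x + amp b ψ η x • EuclideanSpace.single (Fin.last d) 1 := by
  ext i
  refine Fin.lastCases ?_ (fun i => ?_) i
  · simp [E, amp]
    ring
  · simp [E, amp, horizontal, Fin.castSucc_ne_last]

theorem contDiff_E (hs : ((d + 1 : ℕ) : ℝ) / 2 < s) (hψ : IsCutoff b ψ) (η : X d (s + 1 / 2)) :
    ContDiff ℝ 1 (E b ψ η) := by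
  rw [funext (E_eq (b := b) (ψ := ψ) η)]
  exact contDiff_id.add ((contDiff_amp hs hψ η).smul contDiff_const)

theorem hasFDerivAt_E (hs : ((d + 1 : ℕ) : ℝ) / 2 < s) (hψ : IsCutoff b ψ)
    (η : X d (s + 1 / 2)) (x : 𝔼 (d + 1)) :
    HasFDerivAt (E b ψ η) (ContinuousLinearMap.id ℝ _
      + (fderiv ℝ (amp b ψ η) x).smulRight (EuclideanSpace.single (Fin.last d) 1)) x := by
  rw [funext (E_eq (b := b) (ψ := ψ) η)]
  exact (hasFDerivAt_id x).add
    (((contDiff_amp hs hψ η).differentiable (by simp) x).hasFDerivAt.smul_const _)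

theorem exists_isAdmissibleRadius (hs : ((d + 1 : ℕ) : ℝ) / 2 < s) (hψ : IsCutoff b ψ) :
    ∃ δ, IsAdmissibleRadius d (s + 1 / 2) b ψ δ := by
  obtain ⟨C, hC, h⟩ := exists_amp_bounds (d := d) hs hψ
  -- Below this radius `‖∇𝔈_η - I‖ ≤ C ‖η‖ ≤ 1/4`, which gives the inverse and stays strictly under
  -- `1/2`.
  refine ⟨1 / (4 * (C + 1)), by positivity, ?_, fun η hη => ?_⟩
  · rw [div_lt_one (by positivity)]; linarith
  have hle : ∀ x, ‖fderiv ℝ (E b ψ η) x - ContinuousLinearMap.id ℝ _‖ ≤ 1 / 4 := fun x => by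
    rw [(hasFDerivAt_E hs hψ η x).fderiv, add_sub_cancel_left,
      ContinuousLinearMap.norm_smulRight_apply]
    refine (mul_le_mul_of_nonneg_right (h η x).2 (norm_nonneg _)).trans ?_
    rw [lt_div_iff₀ (by positivity)] at hη
    simp only [PiLp.norm_single, norm_one, mul_one]
    nlinarith [norm_nonneg η]
  exact ⟨exists_inverse_of_fderiv_sub_id_le (contDiff_E hs hψ η) hle, 1 / 4, by norm_num, hle⟩

/-- From admissibility, the analysis of `Λ` uses only this property and the bound `δ < 1`. -/
theorem IsAdmissibleRadius.antilipschitz {δ : ℝ}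
    (hδ : IsAdmissibleRadius d (s + 1 / 2) b ψ δ) {η : X d (s + 1 / 2)} (hη : ‖η‖ < δ) :
    AntilipschitzWith 2 (E b ψ η) := by
  obtain ⟨⟨G, -, -, -, -, hE, -⟩, c, hc, hle⟩ := hδ.2.2 η hη
  exact antilipschitzWith_two_of_fderiv_sub_id_le (hE.differentiable (by simp))
    fun x => (hle x).trans hc.le

end Geometry

/-! ### Chain rule and boundedness of composition on `H^k`. -/

section Composition

open scoped ENNReal NNReal

variable {n d k : ℕ} {V : Type*} [NormedAddCommGroup V] [NormedSpace ℝ V] [CompleteSpace V]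

/-- Integration by parts: a classical derivative is a weak derivative. -/
theorem isWeakDeriv_of_contDiff (i : Fin n) {g : 𝔼 n → V} (hg : ContDiff ℝ 1 g) :
    IsWeakDeriv (fun _ : Fin 1 => i) g (fun x => fderiv ℝ g x (EuclideanSpace.single i 1)) := by
  intro θ hθ hc
  have hgd : Continuous fun x => fderiv ℝ g x (EuclideanSpace.single i 1) :=
    (hg.continuous_fderiv (by simp)).clm_apply continuous_const
  have hθd : Continuous fun x => fderiv ℝ θ x (EuclideanSpace.single i 1) :=
    (hθ.continuous_fderiv (by simp)).clm_apply continuous_const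
  have key := integral_smul_fderiv_eq_neg_fderiv_smul_of_integrable (f := θ) (g := g)
    (μ := volume) (v := EuclideanSpace.single i (1 : ℝ)) (𝕜 := ℝ)
    ((hθd.smul hg.continuous).integrable_of_hasCompactSupport
      ((hc.fderiv_apply ℝ _).smul_right))
    ((hθ.continuous.smul hgd).integrable_of_hasCompactSupport hc.smul_right)
    ((hθ.continuous.smul hg.continuous).integrable_of_hasCompactSupport hc.smul_right)
    (fun x _ => hθ.differentiable (by simp) x) (fun x _ => hg.differentiable (by simp) x)
  simp only [partialDeriv_one, pow_one, neg_smul, one_smul]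
  rw [key, neg_neg]

/-- The density principle: a closed condition on `H^k` need only be checked on Schwartz functions.
-/
theorem H.forall_of_schwartz [FiniteDimensional ℝ V] {P : H n k V → Prop} (hP : IsClosed {f | P f})
    (h : ∀ (f : H n k V) (p : 𝓢(𝔼 n, V)), (f : 𝔼 n → V) =ᵐ[volume] p → P f) (f : H n k V) : P f := by
  have : f ∈ closure {f | P f} := Metric.mem_closure_iff.mpr fun ε hε => by
    obtain ⟨g, p, hp, hg⟩ := H.exists_schwartz f hε
    exact ⟨g, h g p hp, by rwa [dist_eq_norm]⟩
  rwa [hP.closure_eq] at this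

theorem H.coeFn_pd_of_schwartz (i : Fin n) {f : H n (k + 1) V} {p : 𝓢(𝔼 n, V)}
    (hf : (f : 𝔼 n → V) =ᵐ[volume] p) :
    (H.pd V k i f : 𝔼 n → V) =ᵐ[volume] fun x => fderiv ℝ p x (EuclideanSpace.single i 1) := by
  let q : 𝓢(𝔼 n, V) := LineDeriv.lineDerivOp (EuclideanSpace.single i (1 : ℝ)) p
  have hq : ∀ x, q x = fderiv ℝ p x (EuclideanSpace.single i 1) :=
    SchwartzMap.lineDerivOp_apply_eq_fderiv _ _
  have h1 : IsWeakDeriv (fun _ : Fin 1 => i) p q := by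
    have := isWeakDeriv_of_contDiff i (p.smooth 1)
    rwa [← funext hq] at this
  have h2 := (h1.congr hf.symm (q.coeFn_toLp 2 volume).symm).unique (H.isWeakDeriv_pd i f)
  rw [← h2, ← funext hq]
  exact q.coeFn_toLp 2 volume

/-- The chain rule for `x ↦ x + a(x) e_j`. -/
theorem isWeakDeriv_comp [FiniteDimensional ℝ V] {a : 𝔼 n → ℝ} (ha : ContDiff ℝ 1 a) (j : Fin n)
    {Φ : 𝔼 n → 𝔼 n} (hΦ : ∀ x, Φ x = x + a x • EuclideanSpace.single j 1)
    (h : AntilipschitzWith 2 Φ) (f : H n (k + 1) V) (i : Fin n) :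
    IsWeakDeriv (fun _ : Fin 1 => i) (fun x => f (Φ x))
      (fun x => H.pd V k i f (Φ x)
        + fderiv ℝ a x (EuclideanSpace.single i 1) • H.pd V k j f (Φ x)) := by
  have hΦ1 : ContDiff ℝ 1 Φ := by
    rw [funext hΦ]
    exact contDiff_id.add (ha.smul contDiff_const)
  have hq := quasiMeasurePreserving_of_antilipschitz hΦ1.continuous h
  have hm : Continuous fun x => fderiv ℝ a x (EuclideanSpace.single i 1) :=
    (ha.continuous_fderiv (by simp)).clm_apply continuous_const
  set T := compL2 V hΦ1.continuous h
  have hT : ∀ u : 𝕃 n V, (T u : 𝔼 n → V) =ᵐ[volume] fun x => u (Φ x) :=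
    coeFn_compL2 hΦ1.continuous h
  intro θ hθ hc
  have hθ' := memLp_test (contDiff_partialDeriv (fun _ : Fin 1 => i) hθ).continuous
    (hasCompactSupport_partialDeriv (fun _ : Fin 1 => i) hc)
  have hθ0 := memLp_test hθ.continuous hc
  have hθm := memLp_test (hθ.continuous.mul hm) hc.mul_right
  -- For a fixed test function both sides of the weak identity are continuous functionals of `f ∈
  -- H^{k+1}`, since composition with `Φ` is bounded on `L²`. The claim thus reduces to Schwartz
  -- `f`, where the classical chain rule applies.
  have e1 : ∀ f : H n (k + 1) V,
      ∫ x, partialDeriv (fun _ : Fin 1 => i) θ x • f (Φ x) = pairing V hθ' (T (H.toL2L n _ V f)) := by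
    intro f
    rw [pairing_apply]
    exact integral_congr_ae (by filter_upwards [hT (H.toL2 f)] with x hx; rw [H.toL2L_apply, hx])
  have e2 : ∀ f : H n (k + 1) V,
      ∫ x, θ x • (H.pd V k i f (Φ x)
        + fderiv ℝ a x (EuclideanSpace.single i 1) • H.pd V k j f (Φ x))
      = pairing V hθ0 (T (H.toL2L n _ V (H.pd V k i f)))
        + pairing V hθm (T (H.toL2L n _ V (H.pd V k j f))) := by
    intro f
    rw [pairing_apply, pairing_apply, ← integral_add]
    · refine integral_congr_ae ?_
      filter_upwards [hT (H.toL2 (H.pd V k i f)), hT (H.toL2 (H.pd V k j f))] with x h1 h2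
      rw [H.toL2L_apply, H.toL2L_apply, h1, h2, smul_add, smul_smul]
      rfl
    · exact memLp_one_iff_integrable.mp ((Lp.memLp _).smul hθ0)
    · exact memLp_one_iff_integrable.mp ((Lp.memLp _).smul hθm)
  revert f
  refine H.forall_of_schwartz ?_ fun f p hf => ?_
  · simp only [e1, e2]
    exact isClosed_eq (by fun_prop) (by fun_prop)
  · have hp : ContDiff ℝ 1 fun x => p (Φ x) := (p.smooth 1).comp hΦ1
    refine ((isWeakDeriv_of_contDiff i hp).congr (hq.ae_eq_comp hf.symm) ?_) θ hθ hc
    filter_upwards [hq.ae_eq_comp (H.coeFn_pd_of_schwartz i hf),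
      hq.ae_eq_comp (H.coeFn_pd_of_schwartz j hf)] with x h1 h2
    simp only [Function.comp_apply] at h1 h2
    have hd : HasFDerivAt Φ (ContinuousLinearMap.id ℝ _
        + (fderiv ℝ a x).smulRight (EuclideanSpace.single j 1)) x := by
      rw [funext hΦ]
      exact (hasFDerivAt_id x).add ((ha.differentiable (by simp) x).hasFDerivAt.smul_const _)
    have hpd : HasFDerivAt (fun x => p (Φ x)) _ x := (p.hasFDerivAt (Φ x)).comp x hd
    rw [h1, h2, hpd.fderiv]
    simp

variable [NeZero d] {s : ℕ} {b : ℝ} {ψ : ℝ → ℝ} [FiniteDimensional ℝ V]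

/-- Induction through `∂ᵢ(f ∘ 𝔈) = ∂ᵢf ∘ 𝔈 + ∂ᵢa · (∂ₙf ∘ 𝔈)`, with `a` the vertical displacement.
Reaching `H^{k+1}` uses `∂ᵢa` as a multiplier on `H^k`, available exactly when `k + 1 ≤ s`. The
condition `‖η‖ ≤ 1` makes the constant uniform. -/
theorem exists_comp_E (hs : ((d + 1 : ℕ) : ℝ) / 2 < s) (hψ : IsCutoff b ψ) (hk : k ≤ s) :
    ∃ C : ℝ, 0 ≤ C ∧ ∀ η : X d (s + 1 / 2), AntilipschitzWith 2 (E b ψ η) → ‖η‖ ≤ 1 →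
      ∀ f : H (d + 1) k V, ∃ U : H (d + 1) k V,
        ((U : 𝔼 (d + 1) → V) =ᵐ[volume] fun x => f (E b ψ η x)) ∧ ‖U‖ ≤ C * ‖f‖ := by
  induction k with
  | zero =>
    refine ⟨H.numJet (d + 1) 0 * compConst (d + 1), mul_nonneg (by positivity) compConst_nonneg,
      fun η hη _ f => ?_⟩
    have hc := (contDiff_E hs hψ η).continuous
    refine ⟨H.ofL2 (d + 1) V (compL2 V hc hη (H.toL2 f)), coeFn_compL2 hc hη _,
      (H.norm_zero_le _).trans ?_⟩
    rw [mul_assoc]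
    gcongr
    exact (norm_compL2_le hc hη _).trans
      (mul_le_mul_of_nonneg_left (H.norm_toL2_le f) compConst_nonneg)
  | succ k ih =>
    obtain ⟨C, hC, h⟩ := ih (by omega)
    choose B hB using fun i : Fin (d + 1) => exists_fderivAmpMul (d := d) (V := V) hs hψ hk
      (EuclideanSpace.single i 1)
    have hcc := compConst_nonneg (n := d + 1)
    refine ⟨H.numJet (d + 1) (k + 1) * (compConst (d + 1) + ∑ i : Fin (d + 1),
      (C * ‖H.pd V k i‖ + ‖B i‖ * (C * ‖H.pd V k (Fin.last d)‖))), by positivity,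
      fun η hη hη1 f => ?_⟩
    have hc := (contDiff_E hs hψ η).continuous
    choose U hU hUn using fun i : Fin (d + 1) => h η hη hη1 (H.pd V k i f)
    obtain ⟨W, hW, hWi⟩ := H.exists_of_isWeakDeriv (compL2 V hc hη (H.toL2 f))
      (fun i => U i + B i η (U (Fin.last d))) fun i => by
        refine (isWeakDeriv_comp (contDiff_amp hs hψ η) (Fin.last d) (E_eq η) hη f i).congr
          (coeFn_compL2 hc hη _).symm ?_
        filter_upwards [hU i, hU (Fin.last d), hB i η (U (Fin.last d)),
          H.coeFn_add (U i) (B i η (U (Fin.last d)))] with x h1 h2 h3 h4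
        rw [h4, Pi.add_apply, h1, h3, h2]
    refine ⟨W, by rw [hW]; exact coeFn_compL2 hc hη _, (H.norm_succ_le W).trans ?_⟩
    have hUf : ∀ i, ‖U i‖ ≤ C * ‖H.pd V k i‖ * ‖f‖ := fun i => by
      refine (hUn i).trans ?_
      rw [mul_assoc]
      gcongr
      exact ContinuousLinearMap.le_opNorm _ _
    rw [mul_assoc, add_mul, Finset.sum_mul, hW]
    gcongr with i
    · exact (norm_compL2_le hc hη _).trans (mul_le_mul_of_nonneg_left (H.norm_toL2_le f) hcc)
    · rw [hWi, add_mul]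
      refine (norm_add_le _ _).trans (add_le_add (hUf i) ?_)
      calc ‖B i η (U (Fin.last d))‖ ≤ ‖B i‖ * ‖η‖ * ‖U (Fin.last d)‖ := (B i).le_opNorm₂ _ _
        _ ≤ ‖B i‖ * 1 * (C * ‖H.pd V k (Fin.last d)‖ * ‖f‖) := by
            gcongr
            exact hUf _
        _ = _ := by ring

variable (k V b ψ) in
open scoped Classical in
/-- Composition with `𝔈_η` as a bounded operator on `H^k`. -/
def compH (η : X d (s + 1 / 2)) : H (d + 1) k V →L[ℝ] H (d + 1) k V :=
  if h : ∃ T : H (d + 1) k V →L[ℝ] H (d + 1) k V,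
    ∀ f, (T f : 𝔼 (d + 1) → V) =ᵐ[volume] fun x => f (E b ψ η x) then h.choose else 0

theorem coeFn_compH (hs : ((d + 1 : ℕ) : ℝ) / 2 < s) (hψ : IsCutoff b ψ) (hk : k ≤ s)
    {η : X d (s + 1 / 2)} (hη : AntilipschitzWith 2 (E b ψ η)) (hη1 : ‖η‖ ≤ 1)
    (f : H (d + 1) k V) :
    (compH k V b ψ η f : 𝔼 (d + 1) → V) =ᵐ[volume] fun x => f (E b ψ η x) := by
  have h : ∃ T : H (d + 1) k V →L[ℝ] H (d + 1) k V,
      ∀ f, (T f : 𝔼 (d + 1) → V) =ᵐ[volume] fun x => f (E b ψ η x) := by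
    obtain ⟨C, -, h⟩ := exists_comp_E (V := V) hs hψ hk
    choose U hU hUn using h η hη hη1
    have hq := quasiMeasurePreserving_of_antilipschitz (contDiff_E hs hψ η).continuous hη
    refine ⟨LinearMap.mkContinuous ⟨⟨U, fun f g => H.ext_ae ?_⟩, fun c f => H.ext_ae ?_⟩ C hUn, hU⟩
    · filter_upwards [hU (f + g), hU f, hU g, H.coeFn_add (U f) (U g),
        hq.ae_eq_comp (H.coeFn_add f g)] with x h1 h2 h3 h4 h5
      rw [h1, h4, Pi.add_apply, h2, h3]
      exact h5
    · filter_upwards [hU (c • f), hU f, H.coeFn_smul c (U f),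
        hq.ae_eq_comp (H.coeFn_smul c f)] with x h1 h2 h3 h4
      rw [h1]
      refine Eq.trans h4 ?_
      simp only [RingHom.id_apply]
      rw [h3, Pi.smul_apply, h2]
      rfl
  rw [compH, dif_pos h]
  exact h.choose_spec f

theorem exists_norm_compH_le (hs : ((d + 1 : ℕ) : ℝ) / 2 < s) (hψ : IsCutoff b ψ) (hk : k ≤ s) :
    ∃ C : ℝ, 0 ≤ C ∧ ∀ η : X d (s + 1 / 2), AntilipschitzWith 2 (E b ψ η) → ‖η‖ ≤ 1 →
      ‖compH k V b ψ η‖ ≤ C := by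
  obtain ⟨C, hC, h⟩ := exists_comp_E (V := V) hs hψ hk
  refine ⟨C, hC, fun η hη hη1 => ContinuousLinearMap.opNorm_le_bound _ hC fun f => ?_⟩
  obtain ⟨U, hU, hUn⟩ := h η hη hη1 f
  rwa [H.ext_ae ((coeFn_compH hs hψ hk hη hη1 f).trans hU.symm)]

theorem toL2_compH (hs : ((d + 1 : ℕ) : ℝ) / 2 < s) (hψ : IsCutoff b ψ) (hk : k ≤ s)
    {η : X d (s + 1 / 2)} (hη : AntilipschitzWith 2 (E b ψ η)) (hη1 : ‖η‖ ≤ 1)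
    (f : H (d + 1) k V) :
    H.toL2 (compH k V b ψ η f) = compL2 V (contDiff_E hs hψ η).continuous hη (H.toL2 f) :=
  Lp.ext ((coeFn_compH hs hψ hk hη hη1 f).trans (coeFn_compL2 _ hη _).symm)

/-- The chain rule as an identity in `H^k`, with multiplication by `∂ᵢa` written as the bounded
bilinear map `B`. It allows continuity in `η` to be proved by induction on `k`. -/
theorem pd_compH (hs : ((d + 1 : ℕ) : ℝ) / 2 < s) (hψ : IsCutoff b ψ) (hk : k + 1 ≤ s)
    {i : Fin (d + 1)} {B : X d (s + 1 / 2) →L[ℝ] H (d + 1) k V →L[ℝ] H (d + 1) k V}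
    (hB : ∀ ζ h, (B ζ h : 𝔼 (d + 1) → V) =ᵐ[volume] fun x =>
      fderiv ℝ (amp b ψ ζ) x (EuclideanSpace.single i 1) • h x)
    {η : X d (s + 1 / 2)} (hη : AntilipschitzWith 2 (E b ψ η)) (hη1 : ‖η‖ ≤ 1)
    (f : H (d + 1) (k + 1) V) :
    H.pd V k i (compH (k + 1) V b ψ η f) = compH k V b ψ η (H.pd V k i f)
      + B η (compH k V b ψ η (H.pd V k (Fin.last d) f)) := by
  have hT := fun f => coeFn_compH (V := V) hs hψ (Nat.le_of_succ_le hk) hη hη1 f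
  refine H.pd_eq ?_
  refine (isWeakDeriv_comp (contDiff_amp hs hψ η) (Fin.last d) (E_eq η) hη f i).congr
    (coeFn_compH hs hψ hk hη hη1 f).symm ?_
  filter_upwards [H.coeFn_add (compH k V b ψ η (H.pd V k i f))
      (B η (compH k V b ψ η (H.pd V k (Fin.last d) f))), hT (H.pd V k i f),
    hT (H.pd V k (Fin.last d) f), hB η (compH k V b ψ η (H.pd V k (Fin.last d) f))]
    with x h1 h2 h3 h4
  rw [h1, Pi.add_apply, h4, h2, h3]

end Composition

/-! ### Continuity of `(f, η) ↦ f ∘ 𝔈_η`. -/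

section Continuity

open scoped ENNReal NNReal

variable {n d k : ℕ} {V : Type*} [NormedAddCommGroup V] [NormedSpace ℝ V] [CompleteSpace V]

theorem H.continuousOn_zero {Y : Type*} [TopologicalSpace Y] {S : Set Y} {F : Y → H n 0 V}
    (h : ContinuousOn (fun y => H.toL2 (F y)) S) : ContinuousOn F S := by
  intro y hy
  have h0 := tendsto_iff_norm_sub_tendsto_zero.mp (h y hy)
  refine tendsto_iff_norm_sub_tendsto_zero.mpr (squeeze_zero (fun _ => norm_nonneg _)
    (fun z => H.norm_zero_le (F z - F y)) ?_)
  simpa only [map_sub, mul_zero] using h0.const_mul (H.numJet n 0 : ℝ)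

theorem H.continuousOn_succ {Y : Type*} [TopologicalSpace Y] {S : Set Y} {F : Y → H n (k + 1) V}
    (h : ContinuousOn (fun y => H.toL2 (F y)) S)
    (hi : ∀ i, ContinuousOn (fun y => H.pd V k i (F y)) S) : ContinuousOn F S := by
  intro y hy
  have h0 := tendsto_iff_norm_sub_tendsto_zero.mp (h y hy)
  have h1 := tendsto_finsetSum Finset.univ fun i _ =>
    tendsto_iff_norm_sub_tendsto_zero.mp (hi i y hy)
  refine tendsto_iff_norm_sub_tendsto_zero.mpr (squeeze_zero (fun _ => norm_nonneg _)
    (fun z => H.norm_succ_le (F z - F y)) ?_)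
  simpa only [map_sub, Finset.sum_const_zero, add_zero, mul_zero]
    using (h0.add h1).const_mul (H.numJet n (k + 1) : ℝ)

/-- Composition with nearby maps on `C_c`, in `L²`. -/
theorem eLpNorm_comp_sub_comp_le {g : 𝔼 n → V} (hg : Continuous g) (hgc : HasCompactSupport g)
    (M : ℝ) {ε : ℝ} (hε : 0 < ε) :
    ∃ r > 0, ∀ Φ Ψ : 𝔼 n → 𝔼 n, (∀ x, ‖Φ x - x‖ ≤ M) → (∀ x, ‖Ψ x - x‖ ≤ M) →
      (∀ x, ‖Φ x - Ψ x‖ < r) →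
      eLpNorm (fun x => g (Φ x) - g (Ψ x)) 2 volume ≤ ENNReal.ofReal ε := by
  obtain ⟨R, hR⟩ := hgc.isCompact.isBounded.subset_closedBall 0
  -- Maps displacing points by at most `M` send the complement of `K` off the support of `g`. So the
  -- difference lives on `K`, of finite measure, where uniform continuity makes it small.
  set K : Set (𝔼 n) := Metric.closedBall 0 (R + M) with hK
  set A : ℝ := (volume K ^ (1 / (2 : ℝ≥0∞).toReal)).toReal with hA
  have hA0 : 0 ≤ A := ENNReal.toReal_nonneg
  have hKt : volume K ^ (1 / (2 : ℝ≥0∞).toReal) ≠ ⊤ :=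
    ENNReal.rpow_ne_top_of_nonneg (by positivity) measure_closedBall_lt_top.ne
  obtain ⟨r, hr, hu⟩ := Metric.uniformContinuous_iff.mp
    (hgc.uniformContinuous_of_continuous hg) (ε / (A + 1)) (by positivity)
  refine ⟨r, hr, fun Φ Ψ hΦ hΨ hΦΨ => ?_⟩
  have hout : ∀ Θ : 𝔼 n → 𝔼 n, (∀ x, ‖Θ x - x‖ ≤ M) → ∀ x ∉ K, g (Θ x) = 0 := by
    intro Θ hΘ x hx
    by_contra h0
    have h1 := hR (subset_tsupport g (Function.mem_support.mpr h0))
    rw [mem_closedBall_zero_iff] at h1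
    refine hx ?_
    rw [hK, mem_closedBall_zero_iff]
    have h2 := norm_sub_norm_le x (Θ x)
    rw [norm_sub_rev] at h2
    have := hΘ x
    linarith
  have hle : ∀ x, ‖g (Φ x) - g (Ψ x)‖ ≤ ‖K.indicator (fun _ => ε / (A + 1)) x‖ := by
    intro x
    by_cases hx : x ∈ K
    · rw [Set.indicator_of_mem hx, Real.norm_of_nonneg (by positivity), ← dist_eq_norm]
      exact (hu (by rw [dist_eq_norm]; exact hΦΨ x)).le
    · rw [hout Φ hΦ x hx, hout Ψ hΨ x hx, sub_zero, norm_zero]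
      exact norm_nonneg _
  refine (eLpNorm_mono hle).trans ((eLpNorm_indicator_const_le _ _).trans ?_)
  rw [Real.enorm_of_nonneg (by positivity), ← ENNReal.ofReal_toReal hKt,
    ← ENNReal.ofReal_mul (by positivity)]
  refine ENNReal.ofReal_le_ofReal ?_
  rw [div_mul_eq_mul_div, div_le_iff₀ (by positivity)]
  change ε * A ≤ _
  nlinarith

variable [NeZero d] {s : ℕ} {b : ℝ} {ψ : ℝ → ℝ}

/-- Replace `u` by a compactly supported continuous `g`. The replacement costs little because the
compositions are uniformly bounded on `L²`, and for `g` a small `‖η - η'‖` means uniformly close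
maps. -/
theorem exists_norm_compL2_sub_le (hs : ((d + 1 : ℕ) : ℝ) / 2 < s) (hψ : IsCutoff b ψ)
    (u : 𝕃 (d + 1) V) {ε : ℝ} (hε : 0 < ε) :
    ∃ r > 0, ∀ (η η' : X d (s + 1 / 2)) (hη : AntilipschitzWith 2 (E b ψ η))
      (hη' : AntilipschitzWith 2 (E b ψ η')), ‖η‖ ≤ 1 → ‖η'‖ ≤ 1 → ‖η - η'‖ < r →
      ‖compL2 V (contDiff_E hs hψ η).continuous hη u
        - compL2 V (contDiff_E hs hψ η').continuous hη' u‖ < ε := by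
  obtain ⟨M, hM, hamp⟩ := exists_amp_bounds (d := d) hs hψ
  set A := compConst (d + 1)
  have hA : 0 ≤ A := compConst_nonneg
  -- The three errors add up to `(2A + 1) ε₁ < ε`.
  set ε₁ : ℝ := ε / (2 * A + 2) with hε₁
  have hε₁0 : 0 < ε₁ := by positivity
  obtain ⟨g, hgc, hug, hg, hg2⟩ := (Lp.memLp u).exists_hasCompactSupport_eLpNorm_sub_le
    (by norm_num) (ε := ENNReal.ofReal ε₁) (by simpa using hε₁0)
  obtain ⟨r, hr, hgr⟩ := eLpNorm_comp_sub_comp_le hg hgc M hε₁0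
  refine ⟨r / (M + 1), by positivity, fun η η' hη hη' h1 h1' hr' => ?_⟩
  have hdisp : ∀ (η : X d (s + 1 / 2)), ‖η‖ ≤ 1 → ∀ x, ‖E b ψ η x - x‖ ≤ M := fun η h1 x => by
    rw [E_eq, add_sub_cancel_left, norm_smul, PiLp.norm_single, norm_one, mul_one]
    exact (hamp η x).1.trans (mul_le_of_le_one_right hM h1)
  have hclose : ∀ x, ‖E b ψ η x - E b ψ η' x‖ < r := fun x => by
    have e : amp b ψ η x = amp b ψ (η - η') x + amp b ψ η' x := by
      rw [← amp_add hs, sub_add_cancel]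
    rw [E_eq, E_eq, add_sub_add_left_eq_sub, ← sub_smul, norm_smul, PiLp.norm_single, norm_one,
      mul_one, e, add_sub_cancel_right]
    refine (hamp (η - η') x).1.trans_lt ?_
    rw [lt_div_iff₀ (by positivity)] at hr'
    nlinarith [norm_nonneg (η - η')]
  let G : 𝕃 (d + 1) V := hg2.toLp g
  have huG : ‖u - G‖ ≤ ε₁ := by
    have e : eLpNorm ((u - G : 𝕃 (d + 1) V) : 𝔼 (d + 1) → V) 2 volume
        = eLpNorm ((u : 𝔼 (d + 1) → V) - g) 2 volume := by
      refine eLpNorm_congr_ae ((Lp.coeFn_sub u G).trans ?_)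
      filter_upwards [hg2.coeFn_toLp] with x hx
      rw [Pi.sub_apply, Pi.sub_apply, hx]
    rw [Lp.norm_def, e]
    exact ENNReal.toReal_le_of_le_ofReal hε₁0.le hug
  have hc := (contDiff_E hs hψ η).continuous
  have hc' := (contDiff_E hs hψ η').continuous
  have hGG : ‖compL2 V hc hη G - compL2 V hc' hη' G‖ ≤ ε₁ := by
    have e : eLpNorm ((compL2 V hc hη G - compL2 V hc' hη' G : 𝕃 (d + 1) V) : 𝔼 (d + 1) → V) 2
        volume = eLpNorm (fun x => g (E b ψ η x) - g (E b ψ η' x)) 2 volume := by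
      refine eLpNorm_congr_ae ((Lp.coeFn_sub _ _).trans ?_)
      filter_upwards [coeFn_compL2 hc hη G, coeFn_compL2 hc' hη' G,
        (quasiMeasurePreserving_of_antilipschitz hc hη).ae_eq_comp hg2.coeFn_toLp,
        (quasiMeasurePreserving_of_antilipschitz hc' hη').ae_eq_comp hg2.coeFn_toLp]
        with x e1 e2 e3 e4
      rw [Pi.sub_apply, e1, e2]
      exact congrArg₂ _ e3 e4
    rw [Lp.norm_def, e]
    exact ENNReal.toReal_le_of_le_ofReal hε₁0.le
      (hgr _ _ (hdisp η h1) (hdisp η' h1') hclose)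
  have b1 := (norm_compL2_le hc hη (u - G)).trans (mul_le_mul_of_nonneg_left huG hA)
  have b2 := (norm_compL2_le hc' hη' (u - G)).trans (mul_le_mul_of_nonneg_left huG hA)
  calc ‖compL2 V hc hη u - compL2 V hc' hη' u‖
      = ‖compL2 V hc hη (u - G) - compL2 V hc' hη' (u - G)
          + (compL2 V hc hη G - compL2 V hc' hη' G)‖ := by
        rw [map_sub, map_sub]
        congr 1
        abel
    _ ≤ A * ε₁ + A * ε₁ + ε₁ :=
        (norm_add_le _ _).trans (add_le_add ((norm_sub_le _ _).trans (add_le_add b1 b2)) hGG)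
    _ < (2 * A + 2) * ε₁ := by nlinarith
    _ = ε := by rw [hε₁]; field_simp

variable [FiniteDimensional ℝ V]

/-- Here `f` is fixed: this is strong continuity of the operators. The `L²` part comes from the
preceding estimate, and the derivatives from `pd_compH` and induction. -/
theorem continuousOn_compH (hs : ((d + 1 : ℕ) : ℝ) / 2 < s) (hψ : IsCutoff b ψ)
    {S : Set (X d (s + 1 / 2))} (hS : ∀ η ∈ S, AntilipschitzWith 2 (E b ψ η) ∧ ‖η‖ ≤ 1)
    (hk : k ≤ s) (f : H (d + 1) k V) : ContinuousOn (fun η => compH k V b ψ η f) S := by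
  have base : ∀ {k : ℕ}, k ≤ s → ∀ f : H (d + 1) k V,
      ContinuousOn (fun η => H.toL2 (compH k V b ψ η f)) S := by
    intro k hk f
    refine Metric.continuousOn_iff.mpr fun η₀ h₀ ε hε => ?_
    obtain ⟨r, hr, h⟩ := exists_norm_compL2_sub_le hs hψ (H.toL2 f) hε
    refine ⟨r, hr, fun η hη hd => ?_⟩
    rw [toL2_compH hs hψ hk (hS η hη).1 (hS η hη).2, toL2_compH hs hψ hk (hS η₀ h₀).1 (hS η₀ h₀).2,
      dist_eq_norm]
    rw [dist_eq_norm] at hd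
    exact h η η₀ _ _ (hS η hη).2 (hS η₀ h₀).2 hd
  induction k with
  | zero => exact H.continuousOn_zero (base hk f)
  | succ k ih =>
    refine H.continuousOn_succ (base hk f) fun i => ?_
    obtain ⟨B, hB⟩ := exists_fderivAmpMul (d := d) (V := V) hs hψ hk (EuclideanSpace.single i 1)
    refine ContinuousOn.congr (f := fun η => compH k V b ψ η (H.pd V k i f)
      + B η (compH k V b ψ η (H.pd V k (Fin.last d) f))) ?_ fun η hη =>
        pd_compH hs hψ hk hB (hS η hη).1 (hS η hη).2 f
    exact (ih (by omega) _).add (B.continuous.continuousOn.clm_apply (ih (by omega) _))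

/-- Joint continuity of composition. -/
theorem continuousOn_compH_uncurry (hs : ((d + 1 : ℕ) : ℝ) / 2 < s) (hψ : IsCutoff b ψ)
    {S : Set (X d (s + 1 / 2))} (hS : ∀ η ∈ S, AntilipschitzWith 2 (E b ψ η) ∧ ‖η‖ ≤ 1)
    (hk : k ≤ s) : ContinuousOn
      (fun p : H (d + 1) k V × X d (s + 1 / 2) => compH k V b ψ p.2 p.1) (Set.univ ×ˢ S) := by
  obtain ⟨C, hC, hle⟩ := exists_norm_compH_le (V := V) hs hψ hk
  rintro ⟨f, η⟩ ⟨-, hη⟩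
  refine tendsto_iff_norm_sub_tendsto_zero.mpr ?_
  have h1 : Filter.Tendsto (fun p : H (d + 1) k V × X d (s + 1 / 2) => ‖compH k V b ψ p.2 f
      - compH k V b ψ η f‖) (nhdsWithin (f, η) (Set.univ ×ˢ S)) (nhds 0) :=
    tendsto_iff_norm_sub_tendsto_zero.mp ((continuousOn_compH hs hψ hS hk f η hη).tendsto.comp
      (continuous_snd.continuousWithinAt.tendsto_nhdsWithin fun p hp => hp.2))
  have h2 : Filter.Tendsto (fun p : H (d + 1) k V × X d (s + 1 / 2) => C * ‖p.1 - f‖)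
      (nhdsWithin (f, η) (Set.univ ×ˢ S)) (nhds 0) := by
    have : Continuous fun p : H (d + 1) k V × X d (s + 1 / 2) => C * ‖p.1 - f‖ := by fun_prop
    simpa using (this.tendsto (f, η)).mono_left nhdsWithin_le_nhds
  have h3 := h2.add h1
  rw [add_zero] at h3
  refine squeeze_zero' (Filter.Eventually.of_forall fun _ => norm_nonneg _) ?_ h3
  filter_upwards [self_mem_nhdsWithin] with p hp
  -- Uniform boundedness controls the change of `f`, strong continuity the change of `η`.
  have e : compH k V b ψ p.2 p.1 - compH k V b ψ η f
      = compH k V b ψ p.2 (p.1 - f) + (compH k V b ψ p.2 f - compH k V b ψ η f) := by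
    rw [map_sub]; abel
  rw [e]
  refine (norm_add_le _ _).trans (add_le_add ?_ le_rfl)
  exact (compH k V b ψ p.2).le_of_opNorm_le (hle _ (hS _ hp.2).1 (hS _ hp.2).2) _

end Continuity

/-! ### The fundamental theorem of calculus along `η + tζ`, and the derivative of `Λ`. -/

section Differentiability

open scoped ENNReal NNReal

variable {n d k : ℕ} {V : Type*} [NormedAddCommGroup V] [NormedSpace ℝ V] [CompleteSpace V]

/-- Reduces an identity in `H^k` to `V`-valued test integrals, where differentiation in `t` is
elementary. -/
theorem H.ext_pairing {f g : H n k V}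
    (h : ∀ (θ : 𝔼 n → ℝ) (hθ : ContDiff ℝ ∞ θ) (hc : HasCompactSupport θ),
      pairing V (memLp_test hθ.continuous hc) (H.toL2L n k V f)
        = pairing V (memLp_test hθ.continuous hc) (H.toL2L n k V g)) : f = g := by
  refine H.ext_ae (ae_eq_of_integral_contDiff_smul_eq
    ((Lp.memLp (H.toL2 f)).locallyIntegrable (by norm_num))
    ((Lp.memLp (H.toL2 g)).locallyIntegrable (by norm_num)) fun θ hθ hc => ?_)
  have e := h θ hθ hc
  rw [pairing_apply, pairing_apply] at e
  exact e

variable [NeZero d] {s : ℕ} {b : ℝ} {ψ : ℝ → ℝ}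

theorem E_add_smul (hs : ((d + 1 : ℕ) : ℝ) / 2 < s) (η ζ : X d (s + 1 / 2)) (t : ℝ)
    (x : 𝔼 (d + 1)) : E b ψ (η + t • ζ) x
      = x + (amp b ψ η x + t * amp b ψ ζ x) • EuclideanSpace.single (Fin.last d) 1 := by
  rw [E_eq, amp_add hs, amp_smul hs]

/-- The derivative of a test integral of `p ∘ 𝔈_{η + tζ}`, for a Schwartz function `p`. -/
theorem hasDerivAt_integral_comp_E (hs : ((d + 1 : ℕ) : ℝ) / 2 < s) (hψ : IsCutoff b ψ)
    {θ : 𝔼 (d + 1) → ℝ} (hθ : Continuous θ) (hc : HasCompactSupport θ) (p : 𝓢(𝔼 (d + 1), V))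
    (η ζ : X d (s + 1 / 2)) (t : ℝ) :
    HasDerivAt (fun t : ℝ => ∫ x, θ x • p (E b ψ (η + t • ζ) x))
      (∫ x, θ x • amp b ψ ζ x • fderiv ℝ p (E b ψ (η + t • ζ) x)
        (EuclideanSpace.single (Fin.last d) 1)) t := by
  let q : 𝓢(𝔼 (d + 1), V) := LineDeriv.lineDerivOp (EuclideanSpace.single (Fin.last d) (1 : ℝ)) p
  have hq : ∀ x, q x = fderiv ℝ p x (EuclideanSpace.single (Fin.last d) 1) :=
    SchwartzMap.lineDerivOp_apply_eq_fderiv _ _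
  simp only [← hq]
  have hE : ∀ t : ℝ, Continuous (E b ψ (η + t • ζ)) := fun t => (contDiff_E hs hψ _).continuous
  have ha := (contDiff_amp hs hψ ζ).continuous
  obtain ⟨M, hM⟩ : ∃ M, ∀ x, ‖q x‖ ≤ M := ⟨_, SchwartzMap.norm_le_seminorm ℝ q⟩
  refine (hasDerivAt_integral_of_dominated_loc_of_deriv_le (s := Set.univ)
    (bound := fun x => ‖θ x‖ * (‖amp b ψ ζ x‖ * M)) (F := fun t x => θ x • p (E b ψ (η + t • ζ) x))
    (F' := fun t x => θ x • amp b ψ ζ x • q (E b ψ (η + t • ζ) x)) Filter.univ_mem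
    (Filter.Eventually.of_forall fun t =>
      (hθ.smul (p.continuous.comp (hE t))).aestronglyMeasurable)
    ((hθ.smul (p.continuous.comp (hE t))).integrable_of_hasCompactSupport hc.smul_right)
    (hθ.smul (ha.smul (q.continuous.comp (hE t)))).aestronglyMeasurable
    (Filter.Eventually.of_forall fun x t _ => ?_)
    ((hθ.norm.mul (ha.norm.mul continuous_const)).integrable_of_hasCompactSupport
      hc.norm.mul_right) (Filter.Eventually.of_forall fun x t _ => ?_)).2
  · rw [norm_smul, norm_smul]
    gcongr
    exact hM _
  · have h1 : HasDerivAt (fun t : ℝ => E b ψ (η + t • ζ) x)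
        (amp b ψ ζ x • EuclideanSpace.single (Fin.last d) (1 : ℝ)) t := by
      simp only [E_add_smul hs]
      have := (((hasDerivAt_id t).mul_const (amp b ψ ζ x)).const_add (amp b ψ η x)).smul_const
        (EuclideanSpace.single (Fin.last d) (1 : ℝ))
      rw [one_mul] at this
      exact this.const_add x
    have h2 := ((p.hasFDerivAt (E b ψ (η + t • ζ) x)).comp_hasDerivAt t h1).const_smul (θ x)
    rw [map_smul, ← hq] at h2
    exact h2

variable [FiniteDimensional ℝ V]

section Increment

variable {S : Set (X d (s + 1 / 2))}
  {A : X d (s + 1 / 2) →L[ℝ] H (d + 1) k V →L[ℝ] H (d + 1) k V}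

theorem continuousOn_path (hs : ((d + 1 : ℕ) : ℝ) / 2 < s) (hψ : IsCutoff b ψ)
    (hS : ∀ η ∈ S, AntilipschitzWith 2 (E b ψ η) ∧ ‖η‖ ≤ 1) (hk : k ≤ s) {η ζ : X d (s + 1 / 2)}
    (hηζ : ∀ t ∈ Set.Icc (0 : ℝ) 1, η + t • ζ ∈ S) : ContinuousOn
      (fun p : H (d + 1) k V × ℝ => A ζ (compH k V b ψ (η + p.2 • ζ) p.1))
      (Set.univ ×ˢ Set.Icc 0 1) :=
  (A ζ).continuous.comp_continuousOn ((continuousOn_compH_uncurry hs hψ hS hk).comp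
    (f := fun p : H (d + 1) k V × ℝ => (p.1, η + p.2 • ζ)) (by fun_prop)
    fun p hp => ⟨Set.mem_univ _, hηζ _ hp.2⟩)

/-- The fundamental theorem of calculus along `t ↦ f ∘ 𝔈_{η + tζ}`. -/
theorem compH_add_sub_compH (hs : ((d + 1 : ℕ) : ℝ) / 2 < s) (hψ : IsCutoff b ψ)
    (hS : ∀ η ∈ S, AntilipschitzWith 2 (E b ψ η) ∧ ‖η‖ ≤ 1) (hk : k ≤ s)
    (hA : ∀ ζ h, (A ζ h : 𝔼 (d + 1) → V) =ᵐ[volume] fun x => amp b ψ ζ x • h x)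
    {η ζ : X d (s + 1 / 2)} (hηζ : ∀ t ∈ Set.Icc (0 : ℝ) 1, η + t • ζ ∈ S)
    (f : H (d + 1) (k + 1) V) :
    compH k V b ψ (η + ζ) (H.incl (d + 1) k V f) - compH k V b ψ η (H.incl (d + 1) k V f)
      = ∫ t in (0 : ℝ)..1, A ζ (compH k V b ψ (η + t • ζ) (H.pd V k (Fin.last d) f)) := by
  have hpath := continuousOn_path (V := V) (A := A) hs hψ hS hk hηζ
  -- Clamping `t` to `[0, 1]` extends the integrand continuously to all real `t` without changing
  -- the integral, as continuity of the parametric integral requires.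
  let κ : ℝ → ℝ := fun t => Set.projIcc (0 : ℝ) 1 zero_le_one t
  have hκc : Continuous κ := continuous_subtype_val.comp continuous_projIcc
  have hκ : ∀ t, κ t ∈ Set.Icc (0 : ℝ) 1 := fun t => (Set.projIcc (0 : ℝ) 1 zero_le_one t).2
  have hκt : ∀ t ∈ Set.Icc (0 : ℝ) 1, κ t = t := fun t ht => by
    simp only [κ, Set.projIcc_of_mem zero_le_one ht]
  let c : H (d + 1) (k + 1) V → ℝ → H (d + 1) k V := fun f t =>
    A ζ (compH k V b ψ (η + κ t • ζ) (H.pd V k (Fin.last d) f))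
  have hc : Continuous (Function.uncurry c) :=
    hpath.comp_continuous (f := fun p : H (d + 1) (k + 1) V × ℝ => (H.pd V k (Fin.last d) p.1, κ p.2))
      (by fun_prop) fun p => ⟨Set.mem_univ _, hκ _⟩
  have hcf : ∀ f, Continuous (c f) := fun f => hc.uncurry_left f
  have hint : ∫ t in (0 : ℝ)..1, A ζ (compH k V b ψ (η + t • ζ) (H.pd V k (Fin.last d) f))
      = ∫ t in (0 : ℝ)..1, c f t := by
    refine intervalIntegral.integral_congr fun t ht => ?_
    rw [Set.uIcc_of_le zero_le_one] at ht
    simp only [c, hκt t ht]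
  rw [hint]
  refine H.ext_pairing fun θ hθ hθc => ?_
  set L : H (d + 1) k V →L[ℝ] V :=
    pairing V (memLp_test hθ.continuous hθc) ∘L H.toL2L (d + 1) k V with hL
  have hLa : ∀ u : H (d + 1) k V, L u = ∫ x, θ x • u x := fun u => pairing_apply _ _
  change L _ = L _
  clear hint
  revert f
  -- Both sides are continuous in `f ∈ H^{k+1}`, so the identity is proved for Schwartz functions,
  -- where differentiation under the test integral is allowed.
  refine H.forall_of_schwartz ?_ fun f p hf => ?_
  · refine isClosed_eq (by fun_prop) (L.continuous.comp ?_)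
    exact intervalIntegral.continuous_parametric_intervalIntegral_of_continuous' hc 0 1
  · have hT : ∀ t ∈ Set.Icc (0 : ℝ) 1, L (compH k V b ψ (η + t • ζ) (H.incl (d + 1) k V f))
        = ∫ x, θ x • p (E b ψ (η + t • ζ) x) := fun t ht => by
      obtain ⟨h1, h2⟩ := hS _ (hηζ t ht)
      have hq := quasiMeasurePreserving_of_antilipschitz (contDiff_E hs hψ _).continuous h1
      rw [hLa]
      refine integral_congr_ae ?_
      filter_upwards [coeFn_compH hs hψ hk h1 h2 (H.incl (d + 1) k V f), hq.ae_eq_comp hf]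
        with x e1 e2
      rw [e1]
      exact congrArg _ e2
    have hT' : ∀ t ∈ Set.Icc (0 : ℝ) 1, L (c f t)
        = ∫ x, θ x • amp b ψ ζ x • fderiv ℝ p (E b ψ (η + t • ζ) x)
          (EuclideanSpace.single (Fin.last d) 1) := fun t ht => by
      obtain ⟨h1, h2⟩ := hS _ (hηζ t ht)
      have hq := quasiMeasurePreserving_of_antilipschitz (contDiff_E hs hψ _).continuous h1
      rw [hLa]
      refine integral_congr_ae ?_
      simp only [c, hκt t ht]
      filter_upwards [hA ζ (compH k V b ψ (η + t • ζ) (H.pd V k (Fin.last d) f)),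
        coeFn_compH hs hψ hk h1 h2 (H.pd V k (Fin.last d) f),
        hq.ae_eq_comp (H.coeFn_pd_of_schwartz (Fin.last d) hf)] with x e1 e2 e3
      simp only [Function.comp_apply] at e3
      rw [e1, e2, e3]
    have h0 := hT 0 ⟨le_rfl, zero_le_one⟩
    have h1 := hT 1 ⟨zero_le_one, le_rfl⟩
    have hftc := intervalIntegral.integral_eq_sub_of_hasDerivAt (a := 0) (b := 1)
      (f := fun t : ℝ => ∫ x, θ x • p (E b ψ (η + t • ζ) x)) (f' := fun t : ℝ =>
        ∫ x, θ x • amp b ψ ζ x • fderiv ℝ p (E b ψ (η + t • ζ) x)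
          (EuclideanSpace.single (Fin.last d) 1))
      (fun t _ => hasDerivAt_integral_comp_E hs hψ hθ.continuous hθc p η ζ t) (by
        refine ContinuousOn.intervalIntegrable ?_
        rw [Set.uIcc_of_le zero_le_one]
        exact (L.continuous.comp (hcf f)).continuousOn.congr fun t ht => (hT' t ht).symm)
    rw [← h0, ← h1, zero_smul, add_zero, one_smul] at hftc
    rw [map_sub, ← hftc, ← L.intervalIntegral_comp_comm ((hcf f).intervalIntegrable 0 1)]
    refine intervalIntegral.integral_congr fun t ht => ?_
    rw [Set.uIcc_of_le zero_le_one] at ht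
    exact (hT' t ht).symm

/-- Subtract the constant `A ζ v` under the integral of `compH_add_sub_compH`. With `v = 0` this
yields the Lipschitz bound, and with `v = ∂ₙf ∘ 𝔈_η` the Taylor remainder. -/
theorem norm_compH_add_sub_compH_sub_le (hs : ((d + 1 : ℕ) : ℝ) / 2 < s) (hψ : IsCutoff b ψ)
    (hS : ∀ η ∈ S, AntilipschitzWith 2 (E b ψ η) ∧ ‖η‖ ≤ 1) (hk : k ≤ s)
    (hA : ∀ ζ h, (A ζ h : 𝔼 (d + 1) → V) =ᵐ[volume] fun x => amp b ψ ζ x • h x)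
    {η ζ : X d (s + 1 / 2)} (hηζ : ∀ t ∈ Set.Icc (0 : ℝ) 1, η + t • ζ ∈ S)
    (f : H (d + 1) (k + 1) V) (v : H (d + 1) k V) {ε : ℝ}
    (h : ∀ t ∈ Set.Icc (0 : ℝ) 1,
      ‖compH k V b ψ (η + t • ζ) (H.pd V k (Fin.last d) f) - v‖ ≤ ε) :
    ‖compH k V b ψ (η + ζ) (H.incl (d + 1) k V f) - compH k V b ψ η (H.incl (d + 1) k V f)
      - A ζ v‖ ≤ ‖A‖ * ‖ζ‖ * ε := by
  have hpath := continuousOn_path (V := V) (A := A) hs hψ hS hk hηζ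
  have hi : IntervalIntegrable (fun t : ℝ => A ζ (compH k V b ψ (η + t • ζ)
      (H.pd V k (Fin.last d) f))) volume 0 1 := by
    refine ContinuousOn.intervalIntegrable ?_
    rw [Set.uIcc_of_le zero_le_one]
    exact hpath.comp (f := fun t : ℝ => (H.pd V k (Fin.last d) f, t)) (by fun_prop)
      fun t ht => ⟨Set.mem_univ _, ht⟩
  have e : A ζ v = ∫ _ in (0 : ℝ)..1, A ζ v := by simp
  rw [compH_add_sub_compH hs hψ hS hk hA hηζ, e, ← intervalIntegral.integral_sub hi (by simp)]
  refine (intervalIntegral.norm_integral_le_of_norm_le_const fun t ht => ?_).trans_eq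
    (by rw [sub_zero, abs_one, mul_one])
  rw [Set.uIoc_of_le zero_le_one] at ht
  rw [← map_sub]
  refine (A.le_opNorm₂ _ _).trans ?_
  gcongr
  exact h t ⟨ht.1.le, ht.2⟩

/-- Giving up one derivative of `f` upgrades strong continuity to Lipschitz dependence on `η` in
operator norm. Convexity keeps the segment from `η` to `η'` in `S`. -/
theorem exists_norm_compH_incl_sub_le (hs : ((d + 1 : ℕ) : ℝ) / 2 < s) (hψ : IsCutoff b ψ)
    (hS : ∀ η ∈ S, AntilipschitzWith 2 (E b ψ η) ∧ ‖η‖ ≤ 1) (hSc : Convex ℝ S) (hk : k ≤ s) :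
    ∃ C : ℝ, 0 ≤ C ∧ ∀ η ∈ S, ∀ η' ∈ S,
      ‖compH k V b ψ η' ∘L H.incl (d + 1) k V - compH k V b ψ η ∘L H.incl (d + 1) k V‖
        ≤ C * ‖η' - η‖ := by
  obtain ⟨A, hA⟩ := exists_ampMul (d := d) (V := V) hs hψ hk
  obtain ⟨C, hC, hle⟩ := exists_norm_compH_le (V := V) hs hψ hk
  refine ⟨‖A‖ * (C * ‖H.pd V k (Fin.last d)‖), by positivity, fun η hη η' hη' => ?_⟩
  refine ContinuousLinearMap.opNorm_le_bound _ (by positivity) fun f => ?_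
  have hηζ : ∀ t ∈ Set.Icc (0 : ℝ) 1, η + t • (η' - η) ∈ S := fun t ht =>
    hSc.add_smul_sub_mem hη hη' ht
  have := norm_compH_add_sub_compH_sub_le hs hψ hS hk hA hηζ f 0
    (ε := C * (‖H.pd V k (Fin.last d)‖ * ‖f‖)) fun t ht => by
      obtain ⟨h1, h2⟩ := hS _ (hηζ t ht)
      rw [sub_zero]
      refine ((compH k V b ψ _).le_of_opNorm_le (hle _ h1 h2) _).trans ?_
      gcongr
      exact ContinuousLinearMap.le_opNorm _ _
  rw [add_sub_cancel, map_zero, sub_zero] at this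
  refine le_trans this (le_of_eq ?_)
  ring

end Increment

theorem Lam_eq (hs : ((d + 1 : ℕ) : ℝ) / 2 < s) (hψ : IsCutoff b ψ) (f : H (d + 1) (s + 1) V)
    {η : X d (s + 1 / 2)} (hη : AntilipschitzWith 2 (E b ψ η)) (hη1 : ‖η‖ ≤ 1) :
    Lam b ψ s (f, η) = compH s V b ψ η (H.incl (d + 1) s V f) := by
  have hT : (compH s V b ψ η (H.incl (d + 1) s V f) : 𝔼 (d + 1) → V) =ᵐ[volume]
      fun x => f (E b ψ η x) := coeFn_compH hs hψ le_rfl hη hη1 (H.incl (d + 1) s V f)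
  have h : ∃ u : H (d + 1) s V, u =ᵐ[volume] fun x => f (E b ψ η x) := ⟨_, hT⟩
  rw [Lam, dif_pos h]
  exact H.ext_ae (h.choose_spec.trans hT.symm)

variable (b ψ) in
/-- The derivative of composition, in terms of the multiplication operator `A`. -/
def LamDeriv (A : X d (s + 1 / 2) →L[ℝ] H (d + 1) s V →L[ℝ] H (d + 1) s V)
    (p : H (d + 1) (s + 1) V × X d (s + 1 / 2)) :
    H (d + 1) (s + 1) V × X d (s + 1 / 2) →L[ℝ] H (d + 1) s V :=
  A.flip (compH s V b ψ p.2 (H.pd V s (Fin.last d) p.1)) ∘L ContinuousLinearMap.snd ℝ _ _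
    + (compH s V b ψ p.2 ∘L H.incl (d + 1) s V) ∘L ContinuousLinearMap.fst ℝ _ _

variable {S : Set (X d (s + 1 / 2))}
  {A : X d (s + 1 / 2) →L[ℝ] H (d + 1) s V →L[ℝ] H (d + 1) s V}

/-- In the `ζ` component, operator-norm continuity follows from joint continuity of `∂ₙf ∘ 𝔈_η` in
`H^s`, because `A.flip` is bounded. In the `g` component it is the Lipschitz bound on `H^{s+1} →
H^s`. -/
theorem continuousOn_LamDeriv (hs : ((d + 1 : ℕ) : ℝ) / 2 < s) (hψ : IsCutoff b ψ)
    (hS : ∀ η ∈ S, AntilipschitzWith 2 (E b ψ η) ∧ ‖η‖ ≤ 1) (hSc : Convex ℝ S) :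
    ContinuousOn (LamDeriv b ψ A) (Set.univ ×ˢ S) := by
  obtain ⟨C, hC, hle⟩ := exists_norm_compH_incl_sub_le (V := V) hs hψ hS hSc le_rfl
  have h1 : ContinuousOn (fun p : H (d + 1) (s + 1) V × X d (s + 1 / 2) =>
      A.flip (compH s V b ψ p.2 (H.pd V s (Fin.last d) p.1))) (Set.univ ×ˢ S) :=
    A.flip.continuous.comp_continuousOn ((continuousOn_compH_uncurry hs hψ hS le_rfl).comp
      (f := fun p : H (d + 1) (s + 1) V × X d (s + 1 / 2) => (H.pd V s (Fin.last d) p.1, p.2))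
      (by fun_prop) fun p hp => ⟨Set.mem_univ _, hp.2⟩)
  have h2 : ContinuousOn (fun η : X d (s + 1 / 2) =>
      compH s V b ψ η ∘L H.incl (d + 1) s V) S := by
    refine LipschitzOnWith.continuousOn (K := C.toNNReal) ?_
    refine LipschitzOnWith.of_dist_le_mul fun η hη η' hη' => ?_
    rw [dist_eq_norm, dist_eq_norm, Real.coe_toNNReal _ hC]
    exact hle η' hη' η hη
  have h3 := h2.comp (f := fun p : H (d + 1) (s + 1) V × X d (s + 1 / 2) => p.2)
    (s := Set.univ ×ˢ S) continuousOn_snd fun p hp => hp.2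
  exact (h1.clm_comp continuousOn_const).add (h3.clm_comp continuousOn_const)

/-- The remainder at `(g, ζ)` is the Taylor remainder in `η` for the fixed `f`, which is `o(‖ζ‖)`,
plus the change in `η` of the operator applied to `g`, at most `C ‖ζ‖ ‖g‖`. Each takes half of `ε`,
which fixes `ε₁` and the radius. -/
theorem hasFDerivAt_Lam (hs : ((d + 1 : ℕ) : ℝ) / 2 < s) (hψ : IsCutoff b ψ)
    (hS : ∀ η ∈ S, AntilipschitzWith 2 (E b ψ η) ∧ ‖η‖ ≤ 1) (hSc : Convex ℝ S) (hSo : IsOpen S)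
    (hA : ∀ ζ h, (A ζ h : 𝔼 (d + 1) → V) =ᵐ[volume] fun x => amp b ψ ζ x • h x)
    (f : H (d + 1) (s + 1) V) {η : X d (s + 1 / 2)} (hη : η ∈ S) :
    HasFDerivAt (Lam b ψ s) (LamDeriv b ψ A (f, η)) (f, η) := by
  obtain ⟨C, hC, hle⟩ := exists_norm_compH_incl_sub_le (V := V) hs hψ hS hSc le_rfl
  rw [hasFDerivAt_iff_isLittleO_nhds_zero, Asymptotics.isLittleO_iff]
  intro ε hε
  set v := compH s V b ψ η (H.pd V s (Fin.last d) f)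
  set ε₁ : ℝ := ε / (2 * (‖A‖ + 1)) with hε₁
  have hcont := (continuousOn_compH hs hψ hS le_rfl (H.pd V s (Fin.last d) f)).continuousAt
    (hSo.mem_nhds hη)
  obtain ⟨r, hr, hball⟩ := Metric.mem_nhds_iff.mp (Filter.inter_mem (hSo.mem_nhds hη)
    (Metric.tendsto_nhds.mp hcont ε₁ (by positivity)))
  have hε2 : 0 < ε / (2 * (C + 1)) := by positivity
  filter_upwards [Metric.ball_mem_nhds (0 : H (d + 1) (s + 1) V × X d (s + 1 / 2))
    (lt_min hr hε2)] with z hz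
  obtain ⟨g, ζ⟩ := z
  rw [mem_ball_zero_iff] at hz
  have hg : ‖g‖ ≤ ‖(g, ζ)‖ := norm_fst_le (g, ζ)
  have hζ : ‖ζ‖ ≤ ‖(g, ζ)‖ := norm_snd_le (g, ζ)
  have hzr := hz.trans_le (min_le_left _ _)
  have hzε := hz.trans_le (min_le_right _ _)
  have hmem : ∀ t ∈ Set.Icc (0 : ℝ) 1, η + t • ζ ∈ Metric.ball η r := fun t ht => by
    rw [mem_ball_iff_norm, add_sub_cancel_left, norm_smul, Real.norm_of_nonneg ht.1]
    exact (mul_le_of_le_one_left (norm_nonneg _) ht.2).trans_lt (hζ.trans_lt hzr)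
  have hηζ : ∀ t ∈ Set.Icc (0 : ℝ) 1, η + t • ζ ∈ S := fun t ht => (hball (hmem t ht)).1
  have hS1 : η + ζ ∈ S := by simpa using hηζ 1 ⟨zero_le_one, le_rfl⟩
  have b1 := norm_compH_add_sub_compH_sub_le hs hψ hS le_rfl hA hηζ f v (ε := ε₁) fun t ht => by
    have h2 : dist _ _ < ε₁ := (hball (hmem t ht)).2
    rw [dist_eq_norm] at h2
    exact h2.le
  have b2 := (compH s V b ψ (η + ζ) ∘L H.incl (d + 1) s V
    - compH s V b ψ η ∘L H.incl (d + 1) s V).le_of_opNorm_le (hle η hη _ hS1) g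
  rw [add_sub_cancel_left] at b2
  have e : Lam b ψ s ((f, η) + (g, ζ)) - Lam b ψ s (f, η) - LamDeriv b ψ A (f, η) (g, ζ)
      = (compH s V b ψ (η + ζ) (H.incl (d + 1) s V f) - compH s V b ψ η (H.incl (d + 1) s V f)
        - A ζ v) + (compH s V b ψ (η + ζ) ∘L H.incl (d + 1) s V
          - compH s V b ψ η ∘L H.incl (d + 1) s V) g := by
    rw [Prod.mk_add_mk, Lam_eq hs hψ _ (hS _ hS1).1 (hS _ hS1).2,
      Lam_eq hs hψ _ (hS _ hη).1 (hS _ hη).2, map_add, map_add]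
    change _ - _ - (A ζ v + compH s V b ψ η (H.incl (d + 1) s V g))
      = _ + (compH s V b ψ (η + ζ) (H.incl (d + 1) s V g)
        - compH s V b ψ η (H.incl (d + 1) s V g))
    abel
  rw [e]
  set m := ‖(g, ζ)‖
  have hm : 0 ≤ m := norm_nonneg _
  have c1 : ‖A‖ * ‖ζ‖ * ε₁ ≤ ε / 2 * m := by
    calc ‖A‖ * ‖ζ‖ * ε₁ ≤ (‖A‖ + 1) * m * ε₁ := by gcongr; linarith
      _ = _ := by rw [hε₁]; field_simp
  have c2 : C * ‖ζ‖ * ‖g‖ ≤ ε / 2 * m := by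
    calc C * ‖ζ‖ * ‖g‖ ≤ (C + 1) * (ε / (2 * (C + 1))) * m := by
          gcongr
          · linarith
          · exact hζ.trans hzε.le
      _ = _ := by field_simp
  refine (norm_add_le _ _).trans ((add_le_add (b1.trans c1) (b2.trans c2)).trans_eq ?_)
  ring

theorem contDiffOn_Lam (hs : ((d + 1 : ℕ) : ℝ) / 2 < s) (hψ : IsCutoff b ψ)
    (hS : ∀ η ∈ S, AntilipschitzWith 2 (E b ψ η) ∧ ‖η‖ ≤ 1) (hSc : Convex ℝ S)
    (hSo : IsOpen S) : ContDiffOn ℝ 1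
      (Lam b ψ s : H (d + 1) (s + 1) V × X d (s + 1 / 2) → H (d + 1) s V) (Set.univ ×ˢ S) := by
  obtain ⟨A, hA⟩ := exists_ampMul (d := d) (V := V) hs hψ le_rfl
  have hd : ∀ p ∈ (Set.univ : Set (H (d + 1) (s + 1) V)) ×ˢ S,
      HasFDerivAt (Lam b ψ s) (LamDeriv b ψ A p) p := fun p hp =>
    hasFDerivAt_Lam hs hψ hS hSc hSo hA p.1 hp.2
  rw [← zero_add (1 : WithTop ℕ∞), contDiffOn_succ_iff_fderiv_of_isOpen (isOpen_univ.prod hSo)]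
  refine ⟨fun p hp => (hd p hp).differentiableAt.differentiableWithinAt, by simp, ?_⟩
  rw [contDiffOn_zero]
  exact (continuousOn_LamDeriv (A := A) hs hψ hS hSc).congr fun p hp => (hd p hp).fderiv

theorem coeFn_LamDeriv (hs : ((d + 1 : ℕ) : ℝ) / 2 < s) (hψ : IsCutoff b ψ)
    (hA : ∀ ζ h, (A ζ h : 𝔼 (d + 1) → V) =ᵐ[volume] fun x => amp b ψ ζ x • h x)
    {η : X d (s + 1 / 2)} (hη : AntilipschitzWith 2 (E b ψ η)) (hη1 : ‖η‖ ≤ 1)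
    (f g : H (d + 1) (s + 1) V) (ζ : X d (s + 1 / 2)) :
    (LamDeriv b ψ A (f, η) (g, ζ) : 𝔼 (d + 1) → V) =ᵐ[volume] fun x =>
      amp b ψ ζ x • lastDeriv (Nat.le_add_left 1 s) f (E b ψ η x) + g (E b ψ η x) := by
  have e : LamDeriv b ψ A (f, η) (g, ζ) = A ζ (compH s V b ψ η (H.pd V s (Fin.last d) f))
    + compH s V b ψ η (H.incl (d + 1) s V g) := rfl
  rw [e]
  filter_upwards [H.coeFn_add (A ζ (compH s V b ψ η (H.pd V s (Fin.last d) f)))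
      (compH s V b ψ η (H.incl (d + 1) s V g)),
    hA ζ (compH s V b ψ η (H.pd V s (Fin.last d) f)),
    coeFn_compH hs hψ le_rfl hη hη1 (H.pd V s (Fin.last d) f),
    coeFn_compH hs hψ le_rfl hη hη1 (H.incl (d + 1) s V g)] with x h1 h2 h3 h4
  rw [h1, Pi.add_apply, h2, h3, h4]
  rfl

end Differentiability

end

end OmegaLemma

theorem mainTheorem12 (d : ℕ) [NeZero d] (s : ℕ) (hs : ((d + 1 : ℕ) : ℝ) / 2 < s)
    (b : ℝ) (hb : 0 < b) (ψ : ℝ → ℝ) (hψ : OmegaLemma.IsCutoff b ψ)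
    (V : Type*) [NormedAddCommGroup V] [InnerProductSpace ℝ V] [FiniteDimensional ℝ V] :
    (∀ η : OmegaLemma.X d (s + 1 / 2), η.IsContinuousFunction η) ∧
    (∃ δ, OmegaLemma.IsAdmissibleRadius d (s + 1 / 2) b ψ δ) ∧
    ∀ δ, OmegaLemma.IsAdmissibleRadius d (s + 1 / 2) b ψ δ →
      (∀ (f : OmegaLemma.H (d + 1) (s + 1) V) (η : OmegaLemma.X d (s + 1 / 2)), ‖η‖ < δ →
        OmegaLemma.Lam b ψ s (f, η) =ᵐ[MeasureTheory.volume] fun x => f (OmegaLemma.E b ψ η x)) ∧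
      ContDiffOn ℝ 1 (OmegaLemma.Lam b ψ s :
          OmegaLemma.H (d + 1) (s + 1) V × OmegaLemma.X d (s + 1 / 2) → OmegaLemma.H (d + 1) s V)
        (Set.univ ×ˢ Metric.ball 0 δ) ∧
      ∀ (f : OmegaLemma.H (d + 1) (s + 1) V) (η : OmegaLemma.X d (s + 1 / 2)), ‖η‖ < δ →
        ∃ D : OmegaLemma.H (d + 1) (s + 1) V × OmegaLemma.X d (s + 1 / 2) →L[ℝ]
            OmegaLemma.H (d + 1) s V,
          HasFDerivAt (OmegaLemma.Lam b ψ s) D (f, η) ∧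
          ∀ (g : OmegaLemma.H (d + 1) (s + 1) V) (ζ : OmegaLemma.X d (s + 1 / 2)),
            D (g, ζ) =ᵐ[MeasureTheory.volume] fun x =>
              (x (Fin.last d) * ψ (x (Fin.last d)) / b * ζ (OmegaLemma.horizontal x)) •
                  OmegaLemma.lastDeriv (Nat.le_add_left 1 s) f (OmegaLemma.E b ψ η x)
                + g (OmegaLemma.E b ψ η x) := by
  -- The set `S` of the preceding results is the ball, which is open and convex and satisfies their
  -- two standing conditions.
  have hS : ∀ δ, OmegaLemma.IsAdmissibleRadius d (s + 1 / 2) b ψ δ →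
      ∀ η ∈ Metric.ball (0 : OmegaLemma.X d (s + 1 / 2)) δ,
        AntilipschitzWith 2 (OmegaLemma.E b ψ η) ∧ ‖η‖ ≤ 1 := fun δ hδ η hη => by
    rw [mem_ball_zero_iff] at hη
    exact ⟨hδ.antilipschitz hη, (hη.trans hδ.2.1).le⟩
  refine ⟨OmegaLemma.X.isContinuousFunction_toFun hs,
    OmegaLemma.exists_isAdmissibleRadius hs hψ, fun δ hδ => ⟨fun f η hη => ?_,
    OmegaLemma.contDiffOn_Lam hs hψ (hS δ hδ) (convex_ball 0 δ) Metric.isOpen_ball,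
    fun f η hη => ?_⟩⟩
  · obtain ⟨h1, h2⟩ := hS δ hδ η (mem_ball_zero_iff.mpr hη)
    rw [OmegaLemma.Lam_eq hs hψ f h1 h2]
    exact OmegaLemma.coeFn_compH hs hψ le_rfl h1 h2 (OmegaLemma.H.incl (d + 1) s V f)
  · obtain ⟨h1, h2⟩ := hS δ hδ η (mem_ball_zero_iff.mpr hη)
    obtain ⟨A, hA⟩ := OmegaLemma.exists_ampMul (d := d) (V := V) hs hψ le_rfl
    exact ⟨OmegaLemma.LamDeriv b ψ A (f, η),
      OmegaLemma.hasFDerivAt_Lam hs hψ (hS δ hδ) (convex_ball 0 δ) Metric.isOpen_ball hA f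
        (mem_ball_zero_iff.mpr hη),
      fun g ζ => OmegaLemma.coeFn_LamDeriv hs hψ hA h1 h2 f g ζ⟩
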